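/- Let $d\ge 3$ be an integer and let $\mathbb B^d$ be the set of nonoriented nearest-neighbour bonds $e=\{x,y\}$, $x,y\in\mathbb Z^d$, $|x-y|=1$. Each bond is written $e=\{\underline e,\overline e\}$ with $\overline e-\underline e\in\{e_1,\dots,e_d\}$. For $u:\mathbb Z^d\to\mathbb R$ put $\nabla u(e)=u(\overline e)-u(\underline e)$, and for $F:\mathbb B^d\to\mathbb R$ put $\nabla^*F(x)=\sum_{i=1}^d\big(F(\{x-e_i,x\})-F(\{x,x+e_i\})\big)$. For $n\in\mathbb N=\{1,2,\dots\}$ let $B(n)=([-n,n]\cap\mathbb Z)^d$. For a finite set $S$ of vertices or bonds, a real function $f$ on it and $r\in(0,\infty)$ let $$\|f\|_{\underline L^r(S)}=\Big(\frac1{|S|}\sum_{z\in S}|f(z)|^r\Big)^{1/r},\qquad \|f\|_{\underline L^\infty(S)}=\sup_{z\in S}|f(z)|.$$ Let $p,q\in(1,\infty]$ satisfy $\frac1p+\frac1q<\frac2{d-1}$ (with $\frac1\infty=0$). Put $p'=\frac p{p-1}$ (so $p'=1$ if $p=\infty$) and $\delta=\frac1{d-1}-\frac1{2p}-\frac1{2q}$.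 For $\omega:\mathbb B^d\to(0,\infty)$ and finite $S\subset\mathbb Z^d$ put $$\Lambda^\omega(S)=\|\omega\|_{\underline L^p(S_{\mathbb B^d})}\,\|\omega^{-1}\|_{\underline L^q(S_{\mathbb B^d})},$$ where $S_{\mathbb B^d}$ is the set of bonds with both end-points in $S$. Then $\delta>0$, and for every $\gamma\in(0,1]$ there is a constant $c=c(d,p,q,\gamma)\in[1,\infty)$ such that for every $\omega:\mathbb B^d\to(0,\infty)$, every $u:\mathbb Z^d\to\mathbb R$ with $\nabla^*(\omega\nabla u)=0$ in $\mathbb Z^d$, and every $n\in\mathbb N$, $$\max_{x\in B(n)}|u(x)|\le c\,\Lambda^\omega(B(2n))^{\frac{\delta+1}{2\delta\gamma}}\,\|u\|_{\underline L^{2p'\gamma}(B(2n))}.$$ -/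

import Mathlib

open scoped ENNReal

noncomputable section

namespace RandomConductance

/-- The vertices of the lattice `ℤ^d`. -/
abbrev Vertex (d : ℕ) : Type := Fin d → ℤ

/-- The nearest neighbour bonds of `ℤ^d`.  Every nonoriented bond has exactly one lower end-point `x`
and one direction `i` such that its end-points are `x` and `x + e_i`; it is encoded as `(x, i)`.
See `Bond.toSym2_injective` and `Bond.range_toSym2`. -/
abbrev Bond (d : ℕ) : Type := Vertex d × Fin d

/-- The lower end-point of a bond. -/
def Bond.lower {d : ℕ} (e : Bond d) : Vertex d := e.1

/-- The upper end-point of a bond: lower end-point plus the unit vector of its direction. -/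
def Bond.upper {d : ℕ} (e : Bond d) : Vertex d := e.1 + Pi.single e.2 1

/-- The nonoriented pair of end-points. -/
def Bond.toSym2 {d : ℕ} (e : Bond d) : Sym2 (Vertex d) := s(Bond.lower e, Bond.upper e)

theorem Bond.toSym2_injective (d : ℕ) :
    Function.Injective (Bond.toSym2 : Bond d → Sym2 (Vertex d)) := by
  rintro ⟨x, i⟩ ⟨y, j⟩ h
  simp only [Bond.toSym2, Bond.lower, Bond.upper, Sym2.eq_iff] at h
  rcases h with ⟨rfl, h⟩ | ⟨h1, h2⟩
  · have h := congrFun (add_left_cancel h) i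
    by_cases hij : i = j
    · rw [hij]
    · simp [Pi.single_eq_of_ne hij] at h
  · exfalso
    rw [h1] at h2
    have h3 := congrFun h2 i
    simp only [Pi.add_apply, Pi.single_eq_same] at h3
    by_cases hij : i = j
    · subst hij
      simp at h3
      omega
    · rw [Pi.single_eq_of_ne hij] at h3
      omega

theorem Bond.range_toSym2 (d : ℕ) :
    Set.range (Bond.toSym2 : Bond d → Sym2 (Vertex d)) =
      {e | ∃ x y : Vertex d, e = s(x, y) ∧ ∑ i, (x i - y i) ^ 2 = 1} := by
  ext e
  constructor
  · rintro ⟨⟨x, i⟩, rfl⟩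
    refine ⟨x, x + Pi.single i 1, rfl, ?_⟩
    rw [Finset.sum_eq_single i]
    · simp
    · intro j _ hj
      simp [Pi.single_eq_of_ne hj]
    · simp
  · rintro ⟨x, y, rfl, h⟩
    obtain ⟨i, hi⟩ : ∃ i, x i - y i ≠ 0 := by
      by_contra! hc
      simp [hc] at h
    have hsplit : (x i - y i) ^ 2 + ∑ j ∈ Finset.univ.erase i, (x j - y j) ^ 2 = 1 :=
      (Finset.add_sum_erase Finset.univ (fun i => (x i - y i) ^ 2) (Finset.mem_univ i)).trans h
    have hnn : 0 ≤ ∑ j ∈ Finset.univ.erase i, (x j - y j) ^ 2 :=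
      Finset.sum_nonneg fun j _ => sq_nonneg _
    have hpos : 0 < (x i - y i) ^ 2 := by positivity
    have hone : (x i - y i) ^ 2 = 1 := by linarith
    have hzero : ∑ j ∈ Finset.univ.erase i, (x j - y j) ^ 2 = 0 := by linarith
    have hoff : ∀ j, j ≠ i → x j = y j := by
      intro j hj
      have := (Finset.sum_eq_zero_iff_of_nonneg fun j _ => sq_nonneg (x j - y j)).1 hzero j
        (Finset.mem_erase.2 ⟨hj, Finset.mem_univ j⟩)
      have := pow_eq_zero_iff (two_ne_zero) |>.1 this
      omega
    have hh : x i - y i = 1 ∨ x i - y i = -1 := by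
      have : (x i - y i - 1) * (x i - y i + 1) = 0 := by linear_combination hone
      rcases mul_eq_zero.1 this with h | h
      · left; omega
      · right; omega
    rcases hh with h1 | h1
    · have hx : y + Pi.single i 1 = x := by
        ext j
        by_cases hj : j = i
        · subst hj
          simp
          omega
        · simp [Pi.single_eq_of_ne hj, hoff j hj]
      exact ⟨(y, i), by simp only [Bond.toSym2, Bond.lower, Bond.upper, hx, Sym2.eq_swap]⟩
    · have hy : x + Pi.single i 1 = y := by
        ext j
        by_cases hj : j = i
        · subst hj
          simp
          omega
        · simp [Pi.single_eq_of_ne hj, hoff j hj]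
      exact ⟨(x, i), by simp only [Bond.toSym2, Bond.lower, Bond.upper, hy]⟩

/-- `∇f (e) = f (upper e) - f (lower e)`. -/
def grad {d : ℕ} (f : Vertex d → ℝ) (e : Bond d) : ℝ := f (Bond.upper e) - f (Bond.lower e)

/-- The discrete divergence
`∇* F (x) = ∑ i, (F {x - e_i, x} - F {x, x + e_i})`. -/
def divStar {d : ℕ} (F : Bond d → ℝ) (x : Vertex d) : ℝ :=
  ∑ i : Fin d, (F (x - Pi.single i 1, i) - F (x, i))

/-- `u` solves `∇* (ω ∇u) = 0` in all of `ℤ^d`. -/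
def IsSolution {d : ℕ} (ω : Bond d → ℝ) (u : Vertex d → ℝ) : Prop :=
  ∀ x : Vertex d, divStar (fun e => ω e * grad u e) x = 0

/-- The box `B(n) = ([-n, n] ∩ ℤ)^d` centred at the origin. -/
def box (d n : ℕ) : Finset (Vertex d) := Finset.Icc (fun _ => -(n : ℤ)) (fun _ => (n : ℤ))

/-- The bonds both of whose end-points belong to `S`. -/
def bondsIn {d : ℕ} (S : Finset (Vertex d)) : Finset (Bond d) :=
  (S ×ˢ Finset.univ).filter fun e => Bond.lower e ∈ S ∧ Bond.upper e ∈ S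

/-- The averaged `L^r` norm over a finite set `S`, for `r ∈ (0, ∞]`:
`((1 / |S|) ∑_{x ∈ S} |f x| ^ r) ^ (1 / r)` for `r < ∞`, and `sup_{x ∈ S} |f x|` for `r = ∞`. -/
def avgNorm {α : Type*} (r : ℝ≥0∞) (S : Finset α) (f : α → ℝ) : ℝ :=
  if r = ∞ then sSup ((fun x => |f x|) '' (S : Set α))
  else ((1 / (S.card : ℝ)) * ∑ x ∈ S, |f x| ^ r.toReal) ^ (1 / r.toReal)

/-- `Λ^ω(S)`: the averaged `L^p` norm of `ω` times the averaged `L^q` norm of `ω⁻¹`, both over the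
bonds in `S`. -/
def Lam {d : ℕ} (p q : ℝ≥0∞) (ω : Bond d → ℝ) (S : Finset (Vertex d)) : ℝ :=
  avgNorm p (bondsIn S) ω * avgNorm q (bondsIn S) fun e => (ω e)⁻¹

/-- `δ = 1/(d-1) - 1/(2p) - 1/(2q)`, where `1/∞ = 0`. -/
def delta (d : ℕ) (p q : ℝ≥0∞) : ℝ :=
  1 / ((d : ℝ) - 1) - p⁻¹.toReal / 2 - q⁻¹.toReal / 2

/-- The conjugate exponent `p' = p/(p-1)` of `p ∈ (1, ∞]`, with `p' = 1` for `p = ∞`. -/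
def conj (p : ℝ≥0∞) : ℝ := (1 - p⁻¹.toReal)⁻¹

end RandomConductance

end

/-!
The absolute value `v` of a solution is a nonnegative subsolution. In the Caccioppoli inequality
for `v ^ ((1 + δ) a)` between two boxes, take a cutoff that decreases only across good layers, on
whose bounding spheres `ω ^ p` and the `W^{1,s}` norm of `v ^ a` are of the order of their
averages; at least half of the layers are good. The Hölder inequality and the Sobolev inequality
on spheres, which have dimension `d - 1` (whence the condition `1/p + 1/q < 2/(d-1)`), bound the
right-hand side by the `W^{1,s}` norm of `v ^ a`; the left-hand side controls that of
`v ^ ((1 + δ) a)` by the integrability of `ω⁻¹`, where `s = 2q/(q+1)`. Iterating over dyadically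
shrinking boxes bounds the maximum of `v` by its `L^{2p'}` norm. For `γ < 1`, interpolate this
norm between the maximum and the `L^{2p'γ}` norm, and absorb the maximum by iterating once more
over nested boxes.
-/

noncomputable section

namespace RandomConductance

open Finset MeasureTheory

theorem rpow_le_of_le_one_le {a c r : ℝ} (ha : 0 ≤ a) (hac : a ≤ c) (hc : 1 ≤ c) (hr : 0 ≤ r)
    (hr1 : r ≤ 1) : a ^ r ≤ c :=
  (Real.rpow_le_rpow ha hac hr).trans (Real.rpow_le_self_of_one_le hc hr1)

theorem le_rpow_of_rpow_le_mul_rpow {a b t x y : ℝ} (hx : 0 ≤ x) (hy : 0 ≤ y) (ht : 0 < t)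
    (hab : a - b = 1 / t) (h : x ^ a ≤ y * x ^ b) : x ≤ y ^ t := by
  rcases hx.eq_or_lt with rfl | hx
  · positivity
  rw [← div_le_iff₀ (by positivity), ← Real.rpow_sub hx, hab] at h
  calc x = (x ^ (1 / t)) ^ t := by
        rw [← Real.rpow_mul hx.le, one_div_mul_cancel ht.ne', Real.rpow_one]
    _ ≤ y ^ t := by gcongr

section FiniteSums

variable {ι : Type*} {S : Finset ι} {f g : ι → ℝ} {a b V : ℝ}

theorem sum_rpow_mul_rpow_div_le (hf : ∀ i ∈ S, 0 ≤ f i) (hg : ∀ i ∈ S, 0 ≤ g i) (ha : 0 ≤ a)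
    (hb : 0 ≤ b) (hab : a + b = 1) (hV : 0 ≤ V) :
    (∑ i ∈ S, f i ^ a * g i ^ b) / V ≤ ((∑ i ∈ S, f i) / V) ^ a * ((∑ i ∈ S, g i) / V) ^ b := by
  have holder : ∑ i ∈ S, f i ^ a * g i ^ b ≤ (∑ i ∈ S, f i) ^ a * (∑ i ∈ S, g i) ^ b := by
    rcases ha.eq_or_lt with rfl | ha
    · simp [show b = 1 by linarith]
    rcases hb.eq_or_lt with rfl | hb
    · simp [show a = 1 by linarith]
    have hconj : Real.HolderConjugate (1 / a) (1 / b) := by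
      rw [Real.holderConjugate_iff, one_lt_div ha]
      exact ⟨by linarith, by simpa using hab⟩
    have h := Real.inner_le_Lp_mul_Lq_of_nonneg S hconj
      (fun i hi => Real.rpow_nonneg (hf i hi) a) fun i hi => Real.rpow_nonneg (hg i hi) b
    simp only [one_div_one_div] at h
    have hf' : ∑ i ∈ S, (f i ^ a) ^ (1 / a) = ∑ i ∈ S, f i :=
      sum_congr rfl fun i hi => by rw [one_div, Real.rpow_rpow_inv (hf i hi) ha.ne']
    have hg' : ∑ i ∈ S, (g i ^ b) ^ (1 / b) = ∑ i ∈ S, g i :=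
      sum_congr rfl fun i hi => by rw [one_div, Real.rpow_rpow_inv (hg i hi) hb.ne']
    rwa [hf', hg'] at h
  rw [Real.div_rpow (sum_nonneg hf) hV, Real.div_rpow (sum_nonneg hg) hV, div_mul_div_comm,
    ← Real.rpow_add_of_nonneg hV ha hb, hab, Real.rpow_one]
  gcongr

theorem sum_rpow_div_le (hf : ∀ i ∈ S, 0 ≤ f i) (ha : 0 ≤ a) (ha1 : a ≤ 1) (hV : 0 ≤ V) :
    (∑ i ∈ S, f i ^ a) / V ≤ ((∑ i ∈ S, f i) / V) ^ a * (#S / V) ^ (1 - a) := by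
  simpa using sum_rpow_mul_rpow_div_le (g := fun _ => 1) hf (by simp) ha (sub_nonneg.2 ha1)
    (by ring) hV

theorem sum_rpow_mul_rpow_div_le_of_add_le_one (hf : ∀ i ∈ S, 0 ≤ f i) (hg : ∀ i ∈ S, 0 ≤ g i)
    (ha : 0 ≤ a) (hb : 0 ≤ b) (hab : a + b ≤ 1) (hV : 0 ≤ V) :
    (∑ i ∈ S, f i ^ a * g i ^ b) / V ≤
      ((∑ i ∈ S, f i) / V) ^ a * ((∑ i ∈ S, g i) / V) ^ b * (#S / V) ^ (1 - (a + b)) := by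
  rcases (add_nonneg ha hb).eq_or_lt with hzero | hpos
  · obtain ⟨rfl, rfl⟩ := (add_eq_zero_iff_of_nonneg ha hb).1 hzero.symm
    simp
  set c := a + b
  have hF : 0 ≤ (∑ i ∈ S, f i) / V := div_nonneg (sum_nonneg hf) hV
  have hG : 0 ≤ (∑ i ∈ S, g i) / V := div_nonneg (sum_nonneg hg) hV
  have hrescale (x y : ℝ) (hx : 0 ≤ x) (hy : 0 ≤ y) :
      (x ^ (a / c) * y ^ (b / c)) ^ c = x ^ a * y ^ b := by
    rw [Real.mul_rpow (by positivity) (by positivity), ← Real.rpow_mul hx, ← Real.rpow_mul hy,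
      div_mul_cancel₀ _ hpos.ne', div_mul_cancel₀ _ hpos.ne']
  have hprod (i) (hi : i ∈ S) : 0 ≤ f i ^ (a / c) * g i ^ (b / c) :=
    mul_nonneg (Real.rpow_nonneg (hf i hi) _) (Real.rpow_nonneg (hg i hi) _)
  calc (∑ i ∈ S, f i ^ a * g i ^ b) / V
      = (∑ i ∈ S, (f i ^ (a / c) * g i ^ (b / c)) ^ c) / V := by
        rw [sum_congr rfl fun i hi => hrescale _ _ (hf i hi) (hg i hi)]
    _ ≤ ((∑ i ∈ S, f i ^ (a / c) * g i ^ (b / c)) / V) ^ c * (#S / V) ^ (1 - c) :=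
        sum_rpow_div_le hprod hpos.le hab hV
    _ ≤ (((∑ i ∈ S, f i) / V) ^ (a / c) * ((∑ i ∈ S, g i) / V) ^ (b / c)) ^ c *
          (#S / V) ^ (1 - c) := by
        gcongr
        · exact div_nonneg (sum_nonneg hprod) hV
        · exact sum_rpow_mul_rpow_div_le hf hg (by positivity) (by positivity)
            (by rw [← add_div, div_self hpos.ne']) hV
    _ = _ := by rw [hrescale _ _ hF hG]

theorem sum_rpow_mul_rpow_div_le_of_le {c K F G : ℝ} (hf : ∀ i ∈ S, 0 ≤ f i)
    (hg : ∀ i ∈ S, 0 ≤ g i) (ha : 0 ≤ a) (hb : 0 ≤ b) (hab : a + b ≤ 1) (hV : 0 < V)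
    (hK : 1 ≤ K) (hc : 1 ≤ c) (hF : (∑ i ∈ S, f i) / V ≤ K * F) (hG : (∑ i ∈ S, g i) / V ≤ G)
    (hS : #S / V ≤ c) :
    (∑ i ∈ S, f i ^ a * g i ^ b) / V ≤ K * c * (F ^ a * G ^ b) := by
  have hf0 : 0 ≤ (∑ i ∈ S, f i) / V := div_nonneg (sum_nonneg hf) hV.le
  have hg0 : 0 ≤ (∑ i ∈ S, g i) / V := div_nonneg (sum_nonneg hg) hV.le
  have hG0 : 0 ≤ G := hg0.trans hG
  have hF0 : 0 ≤ F := nonneg_of_mul_nonneg_right (hf0.trans hF) (by linarith)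
  calc (∑ i ∈ S, f i ^ a * g i ^ b) / V
      ≤ ((∑ i ∈ S, f i) / V) ^ a * ((∑ i ∈ S, g i) / V) ^ b * (#S / V) ^ (1 - (a + b)) :=
        sum_rpow_mul_rpow_div_le_of_add_le_one hf hg ha hb hab hV.le
    _ ≤ (K * F) ^ a * G ^ b * c := by
        gcongr
        exact rpow_le_of_le_one_le (by positivity) hS hc (by linarith) (by linarith)
    _ ≤ K * F ^ a * G ^ b * c := by
        rw [Real.mul_rpow (by linarith) hF0]
        gcongr
        exact Real.rpow_le_self_of_one_le hK (by linarith)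
    _ = _ := by ring

theorem card_filter_lt_average_le {c : ℝ} (hf : ∀ i ∈ S, 0 ≤ f i) :
    c * (#{i ∈ S | c * ∑ j ∈ S, f j < #S * f i} : ℝ) ≤ #S := by
  set T := {i ∈ S | c * ∑ j ∈ S, f j < #S * f i}
  rcases (sum_nonneg hf).eq_or_lt with hzero | hpos
  · have hT : T = ∅ := filter_eq_empty_iff.2 fun _ hi => by
      simp [← hzero, (sum_eq_zero_iff_of_nonneg hf).1 hzero.symm _ hi]
    simp [hT]
  refine le_of_mul_le_mul_right ?_ hpos
  calc c * (#T : ℝ) * ∑ j ∈ S, f j = ∑ _i ∈ T, c * ∑ j ∈ S, f j := by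
        rw [sum_const, nsmul_eq_mul]
        ring
    _ ≤ ∑ i ∈ T, #S * f i := sum_le_sum fun _ hi => (mem_filter.1 hi).2.le
    _ ≤ ∑ i ∈ S, #S * f i := sum_le_sum_of_subset_of_nonneg (filter_subset _ _) fun i hi _ =>
        mul_nonneg (Nat.cast_nonneg _) (hf i hi)
    _ = #S * ∑ j ∈ S, f j := (mul_sum ..).symm

theorem exists_large_subset_le_average (hf : ∀ i ∈ S, 0 ≤ f i) (hg : ∀ i ∈ S, 0 ≤ g i) :
    ∃ T ⊆ S, (#S : ℝ) ≤ 2 * #T ∧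
      ∀ i ∈ T, #S * f i ≤ 4 * ∑ j ∈ S, f j ∧ #S * g i ≤ 4 * ∑ j ∈ S, g j := by
  classical
  set Bf := {i ∈ S | 4 * ∑ j ∈ S, f j < #S * f i}
  set Bg := {i ∈ S | 4 * ∑ j ∈ S, g j < #S * g i}
  refine ⟨S \ (Bf ∪ Bg), sdiff_subset, ?_, fun i hi => ?_⟩
  · have hBf : 4 * (#Bf : ℝ) ≤ #S := card_filter_lt_average_le hf
    have hBg : 4 * (#Bg : ℝ) ≤ #S := card_filter_lt_average_le hg
    have hcard : (#S : ℝ) ≤ #(S \ (Bf ∪ Bg)) + (#Bf + #Bg) := by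
      exact_mod_cast (tsub_le_iff_right.1 (le_card_sdiff (Bf ∪ Bg) S)).trans
        (Nat.add_le_add_left (card_union_le _ _) _)
    linarith
  · simp only [Bf, Bg, mem_sdiff, mem_union, mem_filter, not_or, not_and, not_lt] at hi
    exact ⟨hi.2.1 hi.1, hi.2.2 hi.1⟩

end FiniteSums

section PowerInequalities

variable {a b x y α β r : ℝ}

theorem rpow_sub_rpow_le (hb : 0 ≤ b) (hab : b ≤ a) (hβ : 1 ≤ β) :
    a ^ β - b ^ β ≤ β * a ^ (β - 1) * (a - b) := by
  rcases (hb.trans hab).eq_or_lt with rfl | ha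
  · simp [le_antisymm hab hb]
  have bernoulli := one_add_mul_self_le_rpow_one_add (s := b / a - 1)
    (by linarith [div_nonneg hb ha.le]) hβ
  rw [add_sub_cancel, Real.div_rpow hb ha.le, le_div_iff₀ (Real.rpow_pos_of_pos ha β)] at bernoulli
  have hpow : a ^ β = a ^ (β - 1) * a := by rw [← Real.rpow_add_one ha.ne', sub_add_cancel]
  have hexpand : (1 + β * (b / a - 1)) * a ^ β = a ^ β - β * a ^ (β - 1) * (a - b) := by
    rw [hpow]
    field_simp
    ring
  linarith

theorem abs_rpow_sub_rpow_le (ha : 0 ≤ a) (hb : 0 ≤ b) (hβ : 1 ≤ β) :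
    |a ^ β - b ^ β| ≤ β * max a b ^ (β - 1) * |a - b| := by
  wlog hab : b ≤ a generalizing a b
  · simpa only [abs_sub_comm, max_comm] using this hb ha (le_of_not_ge hab)
  rw [max_eq_left hab, abs_of_nonneg (sub_nonneg.2 hab),
    abs_of_nonneg (sub_nonneg.2 (Real.rpow_le_rpow hb hab (by linarith)))]
  exact rpow_sub_rpow_le hb hab hβ

theorem max_rpow_le_add (ha : 0 ≤ a) (hb : 0 ≤ b) : max a b ^ r ≤ a ^ r + b ^ r := by
  rcases max_choice a b with h | h <;> rw [h]
  · linarith [Real.rpow_nonneg hb r]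
  · linarith [Real.rpow_nonneg ha r]

theorem rpow_add_rpow_le_two_mul (ha : 0 ≤ a) (hb : 0 ≤ b) (hr : 0 ≤ r) :
    a ^ r + b ^ r ≤ 2 * (a + b) ^ r := by
  linarith [Real.rpow_le_rpow ha (le_add_of_nonneg_right hb) hr,
    Real.rpow_le_rpow hb (le_add_of_nonneg_left ha) hr]

theorem sq_rpow_sub_rpow_le (ha : 0 ≤ a) (hb : 0 ≤ b) (hα : 1 ≤ α) :
    (a ^ α - b ^ α) ^ 2 ≤ α * ((a - b) * (a ^ (2 * α - 1) - b ^ (2 * α - 1))) := by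
  wlog hab : b ≤ a generalizing a b
  · linarith [this hb ha (le_of_not_ge hab)]
  have hsplit (c : ℝ) (hc : 0 ≤ c) : c ^ (2 * α - 1) = c ^ (α - 1) * c ^ α := by
    rw [← Real.rpow_add_of_nonneg hc (by linarith) (by linarith)]
    congr 1
    ring
  have hα' : b ^ α ≤ a ^ α := Real.rpow_le_rpow hb hab (by linarith)
  have hα'' : b ^ (α - 1) ≤ a ^ (α - 1) := Real.rpow_le_rpow hb hab (by linarith)
  calc (a ^ α - b ^ α) ^ 2 ≤ α * a ^ (α - 1) * (a - b) * (a ^ α - b ^ α) := by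
        rw [sq]
        exact mul_le_mul_of_nonneg_right (rpow_sub_rpow_le hb hab hα) (by linarith)
    _ = α * ((a - b) * (a ^ (α - 1) * a ^ α - a ^ (α - 1) * b ^ α)) := by ring
    _ ≤ α * ((a - b) * (a ^ (2 * α - 1) - b ^ (2 * α - 1))) := by
        rw [hsplit a ha, hsplit b hb]
        have := sub_nonneg.2 hab
        gcongr

theorem abs_sub_mul_rpow_add_rpow_le (ha : 0 ≤ a) (hb : 0 ≤ b) (hα : 1 ≤ α) :
    |a - b| * (a ^ (2 * α - 1) + b ^ (2 * α - 1)) ≤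
      2 * (|a ^ α - b ^ α| * (a ^ α + b ^ α)) := by
  wlog hab : b ≤ a generalizing a b
  · simpa only [abs_sub_comm, add_comm] using this hb ha (le_of_not_ge hab)
  have hmono (c : ℝ) (hc : 0 ≤ c) : b ^ c ≤ a ^ c := Real.rpow_le_rpow hb hab hc
  have hsplit (c : ℝ) (hc : 0 ≤ c) : c ^ α = c * c ^ (α - 1) := by
    rw [← Real.rpow_one_add' hc (by linarith), add_sub_cancel]
  have hsplit' : a ^ (2 * α - 1) = a ^ (α - 1) * a ^ α := by
    rw [← Real.rpow_add_of_nonneg ha (by linarith) (by linarith)]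
    congr 1
    ring
  have hdiff : (a - b) * a ^ (α - 1) ≤ a ^ α - b ^ α := by
    rw [hsplit a ha, hsplit b hb, sub_mul]
    have := hmono (α - 1) (by linarith)
    gcongr
  have hsub := sub_nonneg.2 hab
  have hsubα := sub_nonneg.2 (hmono α (by linarith))
  rw [abs_of_nonneg hsub, abs_of_nonneg hsubα]
  calc (a - b) * (a ^ (2 * α - 1) + b ^ (2 * α - 1))
      ≤ (a - b) * (a ^ (2 * α - 1) + a ^ (2 * α - 1)) := by
        have := hmono (2 * α - 1) (by linarith)
        gcongr
    _ = 2 * ((a - b) * a ^ (α - 1) * a ^ α) := by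
        rw [hsplit']
        ring
    _ ≤ 2 * ((a ^ α - b ^ α) * (a ^ α + b ^ α)) := by
        have := Real.rpow_nonneg hb α
        gcongr
        linarith

theorem sq_add_sq_mul_sq_rpow_sub_le (ha : 0 ≤ a) (hb : 0 ≤ b) (hx : 0 ≤ x) (hy : 0 ≤ y)
    (hα : 1 ≤ α) :
    (x ^ 2 + y ^ 2) * (a ^ α - b ^ α) ^ 2 ≤
      4 * α * ((a - b) * (x ^ 2 * a ^ (2 * α - 1) - y ^ 2 * b ^ (2 * α - 1))) +
        8 * α ^ 2 * ((x - y) ^ 2 * (a ^ α + b ^ α) ^ 2) := by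
  set X := |a ^ α - b ^ α|
  set A := a ^ (2 * α - 1)
  set B := b ^ (2 * α - 1)
  set s := a ^ α + b ^ α
  have hX : X ^ 2 = (a ^ α - b ^ α) ^ 2 := sq_abs _
  have hAB : 0 ≤ A + B := by positivity
  have hmain : (x ^ 2 + y ^ 2) * X ^ 2 ≤ (x ^ 2 + y ^ 2) * (α * ((a - b) * (A - B))) := by
    rw [hX]
    exact mul_le_mul_of_nonneg_left (sq_rpow_sub_rpow_le ha hb hα) (by positivity)
  have hcross : -((x ^ 2 - y ^ 2) * ((a - b) * (A + B))) ≤ 2 * (|x - y| * (x + y) * (X * s)) :=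
    calc -((x ^ 2 - y ^ 2) * ((a - b) * (A + B)))
        ≤ |(x ^ 2 - y ^ 2) * ((a - b) * (A + B))| := neg_le_abs _
      _ = |x - y| * (x + y) * (|a - b| * (A + B)) := by
          rw [abs_mul, abs_mul, abs_of_nonneg hAB, sq_sub_sq, abs_mul,
            abs_of_nonneg (add_nonneg hx hy)]
          ring
      _ ≤ |x - y| * (x + y) * (2 * (X * s)) := by
          have hxy : 0 ≤ |x - y| * (x + y) := by positivity
          exact mul_le_mul_of_nonneg_left (abs_sub_mul_rpow_add_rpow_le ha hb hα) hxy
      _ = 2 * (|x - y| * (x + y) * (X * s)) := by ring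
  have hyoung : 4 * α * (|x - y| * (x + y) * (X * s)) ≤
      (x ^ 2 + y ^ 2) * X ^ 2 + 8 * α ^ 2 * ((x - y) ^ 2 * s ^ 2) := by
    have h := sq_nonneg ((x + y) * X - 4 * α * (|x - y| * s))
    have h' := mul_nonneg (sq_nonneg (x - y)) (sq_nonneg X)
    linear_combination h / 2 + h' / 2 + 8 * α ^ 2 * s ^ 2 * sq_abs (x - y)
  rw [← hX]
  linear_combination 2 * hmain + 2 * α * hcross + hyoung

end PowerInequalities

section Boxes

variable {d m n : ℕ} {S T : Finset (Vertex d)}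

theorem mem_box {x : Vertex d} : x ∈ box d n ↔ ∀ i, |x i| ≤ n := by
  simp only [box, Finset.mem_Icc, Pi.le_def, abs_le]
  exact forall_and.symm

theorem mem_bondsIn {e : Bond d} : e ∈ bondsIn S ↔ e.lower ∈ S ∧ e.upper ∈ S := by
  simp only [bondsIn, mem_filter, mem_product, mem_univ, and_true]
  exact and_iff_right_of_imp And.left

theorem card_box : #(box d n) = (2 * n + 1) ^ d := by
  rw [box, Pi.card_Icc]
  simp only [Int.card_Icc, prod_const, card_univ, Fintype.card_fin]
  congr 1
  omega

theorem sum_bondsIn (F : Bond d → ℝ) :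
    ∑ e ∈ bondsIn S, F e = ∑ x ∈ S, ∑ i, if (x, i) ∈ bondsIn S then F (x, i) else 0 := by
  rw [← sum_product', ← sum_filter]
  refine sum_congr ?_ fun _ _ => rfl
  ext e
  simp only [mem_filter, mem_product, mem_univ, and_true, Prod.mk.eta]
  exact ⟨fun h => ⟨(mem_bondsIn.1 h).1, h⟩, And.right⟩

theorem bondsIn_mono (h : S ⊆ T) : bondsIn S ⊆ bondsIn T := fun _ he =>
  mem_bondsIn.2 ((mem_bondsIn.1 he).imp (h ·) (h ·))

theorem box_mono (h : m ≤ n) : box d m ⊆ box d n := fun _ hx =>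
  mem_box.2 fun i => (mem_box.1 hx i).trans (by exact_mod_cast h)

theorem update_mem_box {x : Vertex d} (hx : x ∈ box d n) (i : Fin d) {s : ℤ} :
    Function.update x i s ∈ box d n ↔ s ∈ Icc (-(n : ℤ)) n := by
  rw [mem_box, mem_Icc, ← abs_le]
  refine ⟨fun h => by simpa using h i, fun h j => ?_⟩
  rcases eq_or_ne j i with rfl | hj
  · simpa using h
  · simpa [hj] using mem_box.1 hx j

theorem upper_update (x : Vertex d) (i : Fin d) (s : ℤ) :
    Bond.upper (Function.update x i s, i) = Function.update x i (s + 1) := by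
  ext j
  rcases eq_or_ne j i with rfl | hj <;> simp [Bond.upper, *]

theorem sum_bondsIn_lower_add_upper_le {f : Vertex d → ℝ} (hf : ∀ x ∈ S, 0 ≤ f x) :
    ∑ e ∈ bondsIn S, (f e.lower + f e.upper) ≤ 2 * d * ∑ x ∈ S, f x := by
  have hlower : ∑ e ∈ bondsIn S, f e.lower ≤ d * ∑ x ∈ S, f x := by
    calc ∑ e ∈ bondsIn S, f e.lower ≤ ∑ e ∈ S ×ˢ (univ : Finset (Fin d)), f e.1 :=
          sum_le_sum_of_subset_of_nonneg (filter_subset _ _) fun e he _ => hf _ (mem_product.1 he).1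
      _ = d * ∑ x ∈ S, f x := by simp [sum_product, mul_sum]
  have hupper : ∑ e ∈ bondsIn S, f e.upper ≤ d * ∑ x ∈ S, f x := by
    have hinj : Set.InjOn (fun e : Bond d => (e.upper, e.2)) (bondsIn S) := by
      rintro ⟨x, i⟩ _ ⟨y, j⟩ _ h
      simp only [Bond.upper, Prod.mk.injEq] at h
      obtain ⟨h, rfl⟩ := h
      rw [add_right_cancel h]
    calc ∑ e ∈ bondsIn S, f e.upper
        = ∑ e ∈ (bondsIn S).image fun e : Bond d => (e.upper, e.2), f e.1 := by
          rw [sum_image hinj]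
      _ ≤ ∑ e ∈ S ×ˢ (univ : Finset (Fin d)), f e.1 := by
          refine sum_le_sum_of_subset_of_nonneg (fun e he => ?_)
            fun e he _ => hf _ (mem_product.1 he).1
          obtain ⟨e', he', rfl⟩ := mem_image.1 he
          exact mem_product.2 ⟨(mem_bondsIn.1 he').2, mem_univ _⟩
      _ = d * ∑ x ∈ S, f x := by simp [sum_product, mul_sum]
  rw [sum_add_distrib]
  linarith

theorem card_bondsIn_le : #(bondsIn S) ≤ d * #S :=
  (card_filter_le _ _).trans_eq (by simp [mul_comm])

end Boxes

section GagliardoNirenberg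

variable {D k : ℕ}

theorem abs_sub_le_sum_Icc (g : ℤ → ℝ) {a b : ℤ} (ha : a ∈ Icc (-(k : ℤ)) k)
    (hb : b ∈ Icc (-(k : ℤ)) k) :
    |g a - g b| ≤ ∑ s ∈ Icc (-(k : ℤ)) k, if s < k then |g (s + 1) - g s| else 0 := by
  wlog hab : a ≤ b generalizing a b
  · rw [abs_sub_comm]
    exact this hb ha (le_of_not_ge hab)
  obtain ⟨n, rfl⟩ := Int.le.dest hab
  rw [mem_Icc] at ha hb
  have hsub : (range n).image (fun m : ℕ => a + (m : ℤ)) ⊆ Icc (-(k : ℤ)) k := fun s hs => by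
    obtain ⟨m, hm, rfl⟩ := mem_image.1 hs
    rw [mem_range] at hm
    rw [mem_Icc]
    omega
  calc |g a - g (a + n)| ≤ ∑ m ∈ range n, |g (a + m) - g (a + (m + 1 : ℕ))| := by
        simpa [Real.dist_eq] using dist_le_range_sum_dist (fun m : ℕ => g (a + m)) n
    _ = ∑ m ∈ range n, if a + (m : ℤ) < k then |g (a + m + 1) - g (a + m)| else 0 :=
        sum_congr rfl fun m hm => by
          rw [mem_range] at hm
          rw [if_pos (by omega), abs_sub_comm, Nat.cast_succ, add_assoc]
    _ = ∑ s ∈ (range n).image (fun m : ℕ => a + (m : ℤ)),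
          if s < k then |g (s + 1) - g s| else 0 := by
        rw [sum_image fun x _ y _ hxy => by simpa using hxy]
    _ ≤ _ := sum_le_sum_of_subset_of_nonneg hsub fun s _ _ => by positivity

theorem le_sum_Icc_abs_sub_add_average (g : ℤ → ℝ) {a : ℤ} (ha : a ∈ Icc (-(k : ℤ)) k) :
    g a ≤ ∑ s ∈ Icc (-(k : ℤ)) k,
      ((if s < k then |g (s + 1) - g s| else 0) + (2 * k + 1 : ℝ)⁻¹ * g s) := by
  set V := ∑ s ∈ Icc (-(k : ℤ)) k, if s < k then |g (s + 1) - g s| else 0 with hV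
  have hcard : (#(Icc (-(k : ℤ)) k) : ℝ) = 2 * k + 1 := by
    rw [Int.card_Icc, show ((k : ℤ) + 1 - -k).toNat = 2 * k + 1 by omega]
    push_cast
    rfl
  have h : ∑ _s ∈ Icc (-(k : ℤ)) k, g a ≤ ∑ s ∈ Icc (-(k : ℤ)) k, (g s + V) :=
    sum_le_sum fun s hs => by linarith [le_abs_self (g a - g s), abs_sub_le_sum_Icc g ha hs]
  rw [sum_add_distrib, sum_const, sum_const, nsmul_eq_mul, nsmul_eq_mul, hcard] at h
  rw [sum_add_distrib, ← mul_sum, ← hV]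
  have hpos : (0 : ℝ) < 2 * k + 1 := by positivity
  refine le_of_mul_le_mul_left ?_ hpos
  rw [mul_add, mul_inv_cancel_left₀ hpos.ne']
  linarith

theorem lintegral_pi_count {ι : Type*} [Fintype ι] (f : (ι → ℤ) → ℝ≥0∞) :
    ∫⁻ x, f x ∂(Measure.pi fun _ : ι => Measure.count) = ∑' x, f x := by
  rw [lintegral_countable']
  refine tsum_congr fun x => ?_
  rw [← Set.univ_pi_singleton, Measure.pi_pi]
  simp

theorem tsum_prod_tsum_update_rpow_le (hD : 2 ≤ D) (F : Vertex D → ℝ≥0∞) :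
    ∑' x, ∏ i, (∑' s, F (Function.update x i s)) ^ (1 / ((D : ℝ) - 1)) ≤
      (∑' x, F x) ^ ((D : ℝ) / (D - 1)) := by
  have hD' : (2 : ℝ) ≤ D := by exact_mod_cast hD
  have hconj : Real.HolderConjugate (Fintype.card (Fin D)) ((D : ℝ) / (D - 1)) := by
    rw [Fintype.card_fin]
    exact Real.HolderConjugate.conjExponent (by linarith)
  have h := lintegral_prod_lintegral_pow_le (fun _ : Fin D => (Measure.count : Measure ℤ)) hconj
    (measurable_of_countable F)
  simpa only [lintegral_pi_count, lintegral_count, Fintype.card_fin] using h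

theorem sum_prod_sum_update_rpow_le (hD : 2 ≤ D) {f : Vertex D → ℝ} (hf : ∀ x, 0 ≤ f x) :
    ∑ x ∈ box D k, ∏ i, (∑ s ∈ Icc (-(k : ℤ)) k, f (Function.update x i s)) ^
        (1 / ((D : ℝ) - 1)) ≤ (∑ x ∈ box D k, f x) ^ ((D : ℝ) / (D - 1)) := by
  have hD' : (2 : ℝ) ≤ D := by exact_mod_cast hD
  have hp : 0 ≤ 1 / ((D : ℝ) - 1) := by
    apply div_nonneg <;> linarith
  let F : Vertex D → ℝ≥0∞ := fun x => if x ∈ box D k then ENNReal.ofReal (f x) else 0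
  have hline (x) (hx : x ∈ box D k) (i) : ∑' s, F (Function.update x i s) =
      ENNReal.ofReal (∑ s ∈ Icc (-(k : ℤ)) k, f (Function.update x i s)) := by
    rw [tsum_eq_sum (s := Icc (-(k : ℤ)) k) fun s hs => if_neg ((update_mem_box hx i).not.2 hs),
      ENNReal.ofReal_sum_of_nonneg fun s _ => hf _]
    exact sum_congr rfl fun s hs => if_pos ((update_mem_box hx i).2 hs)
  have hline0 (x i) : 0 ≤ ∑ s ∈ Icc (-(k : ℤ)) k, f (Function.update x i s) :=
    sum_nonneg fun s _ => hf _
  have hsum : ∑' x, F x = ENNReal.ofReal (∑ x ∈ box D k, f x) := by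
    rw [tsum_eq_sum (s := box D k) fun x hx => if_neg hx,
      ENNReal.ofReal_sum_of_nonneg fun x _ => hf x]
    exact sum_congr rfl fun x hx => if_pos hx
  have hfinal := (ENNReal.sum_le_tsum (box D k)).trans (tsum_prod_tsum_update_rpow_le hD F)
  rw [hsum, ENNReal.ofReal_rpow_of_nonneg (sum_nonneg fun x _ => hf x)
    (div_nonneg (by linarith) (by linarith))] at hfinal
  refine (ENNReal.ofReal_le_ofReal_iff (Real.rpow_nonneg (sum_nonneg fun x _ => hf x) _)).1 ?_
  refine le_trans (le_of_eq ?_) hfinal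
  rw [ENNReal.ofReal_sum_of_nonneg fun x _ => prod_nonneg fun i _ =>
    Real.rpow_nonneg (hline0 x i) _]
  refine sum_congr rfl fun x hx => ?_
  rw [ENNReal.ofReal_prod_of_nonneg fun i _ => Real.rpow_nonneg (hline0 x i) _]
  exact prod_congr rfl fun i _ => by
    rw [hline x hx i, ENNReal.ofReal_rpow_of_nonneg (hline0 x i) hp]

/-- The density of the discrete `W^{1,1}` norm on the box of radius `k`: its sum over the box is
`∑ |∇w| + (2 * k + 1)⁻¹ * ∑ w`, and already its sum over a grid line controls `w` on that line. -/
def sobolevDensity (k : ℕ) (w : Vertex D → ℝ) (x : Vertex D) : ℝ :=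
  (∑ i, if (x, i) ∈ bondsIn (box D k) then |grad w (x, i)| else 0) + (2 * k + 1 : ℝ)⁻¹ * w x

theorem sobolevDensity_nonneg {w : Vertex D → ℝ} (hw : ∀ x, 0 ≤ w x) (x : Vertex D) :
    0 ≤ sobolevDensity k w x :=
  add_nonneg (sum_nonneg fun i _ => by positivity) (mul_nonneg (by positivity) (hw x))

theorem sum_sobolevDensity (w : Vertex D → ℝ) :
    ∑ x ∈ box D k, sobolevDensity k w x =
      ∑ e ∈ bondsIn (box D k), |grad w e| + (2 * k + 1 : ℝ)⁻¹ * ∑ x ∈ box D k, w x := by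
  simp only [sobolevDensity, sum_bondsIn, mul_sum, sum_add_distrib]

theorem le_sum_sobolevDensity_update (w : Vertex D → ℝ) {x : Vertex D} (hx : x ∈ box D k)
    (i : Fin D) :
    w x ≤ ∑ s ∈ Icc (-(k : ℤ)) k, sobolevDensity k w (Function.update x i s) := by
  have h := le_sum_Icc_abs_sub_add_average (fun s => w (Function.update x i s))
    (mem_Icc.2 (abs_le.1 (mem_box.1 hx i)))
  rw [Function.update_eq_self] at h
  refine h.trans (sum_le_sum fun s hs => add_le_add_left ?_ _)
  split_ifs with hsk
  · have hmem : (Function.update x i s, i) ∈ bondsIn (box D k) := by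
      rw [mem_bondsIn, upper_update]
      refine ⟨(update_mem_box hx i).2 hs, (update_mem_box hx i).2 ?_⟩
      rw [mem_Icc] at hs ⊢
      omega
    refine le_trans (le_of_eq ?_) (single_le_sum (fun j _ => by positivity) (mem_univ i))
    rw [if_pos hmem, grad, upper_update]
    rfl
  · exact sum_nonneg fun j _ => by positivity

theorem gagliardo_nirenberg_box (hD : 2 ≤ D) {w : Vertex D → ℝ} (hw : ∀ x, 0 ≤ w x) :
    (∑ x ∈ box D k, w x ^ ((D : ℝ) / (D - 1))) ^ (((D : ℝ) - 1) / D) ≤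
      ∑ e ∈ bondsIn (box D k), |grad w e| + (2 * k + 1 : ℝ)⁻¹ * ∑ x ∈ box D k, w x := by
  have hD' : (2 : ℝ) ≤ D := by exact_mod_cast hD
  have hD1 : (0 : ℝ) < D - 1 := by linarith
  have hpow (x) (hx : x ∈ box D k) : w x ^ ((D : ℝ) / (D - 1)) ≤
      ∏ i, (∑ s ∈ Icc (-(k : ℤ)) k, sobolevDensity k w (Function.update x i s)) ^
        (1 / ((D : ℝ) - 1)) := by
    calc w x ^ ((D : ℝ) / (D - 1)) = ∏ _i : Fin D, w x ^ (1 / ((D : ℝ) - 1)) := by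
          rw [prod_const, card_univ, Fintype.card_fin, ← Real.rpow_mul_natCast (hw x)]
          congr 1
          ring
      _ ≤ _ := prod_le_prod (fun i _ => Real.rpow_nonneg (hw x) _) fun i _ =>
          Real.rpow_le_rpow (hw x) (le_sum_sobolevDensity_update w hx i) (by positivity)
  have hsum := (sum_le_sum hpow).trans
    (sum_prod_sum_update_rpow_le hD (sobolevDensity_nonneg hw))
  rw [← sum_sobolevDensity]
  have hnonneg : 0 ≤ ∑ x ∈ box D k, sobolevDensity k w x :=
    sum_nonneg fun x _ => sobolevDensity_nonneg hw x
  calc (∑ x ∈ box D k, w x ^ ((D : ℝ) / (D - 1))) ^ (((D : ℝ) - 1) / D)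
      ≤ ((∑ x ∈ box D k, sobolevDensity k w x) ^ ((D : ℝ) / (D - 1))) ^ (((D : ℝ) - 1) / D) :=
        Real.rpow_le_rpow (sum_nonneg fun x _ => Real.rpow_nonneg (hw x) _) hsum (by positivity)
    _ = ∑ x ∈ box D k, sobolevDensity k w x := by
        rw [← Real.rpow_mul hnonneg, div_mul_div_cancel₀ hD1.ne', div_self (by positivity),
          Real.rpow_one]

end GagliardoNirenberg

section SobolevInequality

variable {d D n k : ℕ} {s t : ℝ} {S T : Finset (Vertex d)} {v w : Vertex d → ℝ}

/-- The `s`-th power of the (unnormalised) discrete `W^{1,s}` norm of `w ≥ 0` on `S`, made scale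
invariant at the length scale `n`. -/
def sobolevSum (n : ℕ) (s : ℝ) (S : Finset (Vertex d)) (w : Vertex d → ℝ) : ℝ :=
  ∑ e ∈ bondsIn S, (n * |grad w e|) ^ s + ∑ x ∈ S, w x ^ s

theorem sobolevSum_nonneg (hw : ∀ x, 0 ≤ w x) : 0 ≤ sobolevSum n s S w :=
  add_nonneg (sum_nonneg fun e _ => by positivity)
    (sum_nonneg fun x _ => Real.rpow_nonneg (hw x) s)

theorem sum_rpow_le_sobolevSum : ∑ x ∈ S, w x ^ s ≤ sobolevSum n s S w :=
  le_add_of_nonneg_left (sum_nonneg fun e _ => by positivity)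

theorem sum_rpow_grad_le_sobolevSum (hw : ∀ x, 0 ≤ w x) :
    ∑ e ∈ bondsIn S, (n * |grad w e|) ^ s ≤ sobolevSum n s S w :=
  le_add_of_nonneg_right (sum_nonneg fun x _ => Real.rpow_nonneg (hw x) s)

theorem card_box_div_le (hn : 1 ≤ n) (hk : k ≤ 2 * n) :
    (#(box D k) / (n : ℝ) ^ D) ≤ 5 ^ D := by
  have hn' : (1 : ℝ) ≤ n := by exact_mod_cast hn
  have hk' : (k : ℝ) ≤ 2 * n := by exact_mod_cast hk
  rw [div_le_iff₀ (by positivity), ← mul_pow, card_box]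
  push_cast
  gcongr
  linarith

theorem gagliardo_nirenberg_box_normalized (hD : 2 ≤ D) (hn : 1 ≤ n) (hk : n ≤ k)
    {w : Vertex D → ℝ} (hw : ∀ x, 0 ≤ w x) :
    ((∑ x ∈ box D k, w x ^ ((D : ℝ) / (D - 1))) / (n : ℝ) ^ D) ^ (((D : ℝ) - 1) / D) ≤
      sobolevSum n 1 (box D k) w / (n : ℝ) ^ D := by
  have hn' : (1 : ℝ) ≤ n := by exact_mod_cast hn
  have hk' : (n : ℝ) ≤ k := by exact_mod_cast hk
  have hvolume : ((n : ℝ) ^ D) ^ (((D : ℝ) - 1) / D) = (n : ℝ) ^ D / n := by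
    rw [← Real.rpow_natCast, ← Real.rpow_mul (by positivity), mul_div_cancel₀ _ (by positivity),
      Real.rpow_sub_one (by positivity)]
  have hmean : n * ((2 * k + 1 : ℝ)⁻¹ * ∑ x ∈ box D k, w x) ≤ ∑ x ∈ box D k, w x := by
    rw [← mul_assoc]
    refine mul_le_of_le_one_left (sum_nonneg fun x _ => hw x) ?_
    rw [← div_eq_mul_inv, div_le_one (by positivity)]
    linarith
  rw [Real.div_rpow (sum_nonneg fun x _ => Real.rpow_nonneg (hw x) _) (by positivity), hvolume,
    div_div_eq_mul_div]
  gcongr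
  calc (∑ x ∈ box D k, w x ^ ((D : ℝ) / (D - 1))) ^ (((D : ℝ) - 1) / D) * n
      ≤ (∑ e ∈ bondsIn (box D k), |grad w e| + (2 * k + 1 : ℝ)⁻¹ * ∑ x ∈ box D k, w x) * n := by
        gcongr
        exact gagliardo_nirenberg_box hD hw
    _ ≤ sobolevSum n 1 (box D k) w := by
        simp only [sobolevSum, Real.rpow_one, ← mul_sum]
        linarith

theorem card_bondsIn_box_div_le (hn : 1 ≤ n) (hk : k ≤ 2 * n) :
    #(bondsIn (box D k)) / (n : ℝ) ^ D ≤ (D + 1) * 5 ^ D :=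
  calc #(bondsIn (box D k)) / (n : ℝ) ^ D ≤ (D * #(box D k) : ℕ) / (n : ℝ) ^ D := by
        gcongr
        exact card_bondsIn_le
    _ = D * (#(box D k) / (n : ℝ) ^ D) := by
        push_cast
        ring
    _ ≤ (D + 1) * 5 ^ D := by
        gcongr
        · linarith
        · exact card_box_div_le hn hk

theorem sum_max_rpow_le (hw : ∀ x, 0 ≤ w x) :
    ∑ e ∈ bondsIn S, max (w e.lower) (w e.upper) ^ t ≤ 2 * d * ∑ x ∈ S, w x ^ t :=
  (sum_le_sum fun _ _ => max_rpow_le_add (hw _) (hw _)).trans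
    (sum_bondsIn_lower_add_upper_le fun x _ => Real.rpow_nonneg (hw x) t)

theorem sum_rpow_div_le_mul_sobolevSum (hn : 1 ≤ n) (hk : k ≤ 2 * n) (hs : 1 ≤ s) (ht : 0 < t)
    {β : ℝ} (hβ : 1 ≤ β) (hst : (β - 1) / t + 1 / s ≤ 1) {w : Vertex D → ℝ} (hw : ∀ x, 0 ≤ w x) :
    (∑ x ∈ box D k, w x ^ β) / (n : ℝ) ^ D ≤
      5 ^ D * (((∑ x ∈ box D k, w x ^ t) / (n : ℝ) ^ D) ^ ((β - 1) / t) *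
        (sobolevSum n s (box D k) w / (n : ℝ) ^ D) ^ (1 / s)) := by
  have hs0 : 0 < s := by linarith
  have hpow (x) : w x ^ β = (w x ^ t) ^ ((β - 1) / t) * (w x ^ s) ^ (1 / s) := by
    rw [← Real.rpow_mul (hw x), ← Real.rpow_mul (hw x), mul_div_cancel₀ _ ht.ne',
      mul_one_div_cancel hs0.ne', ← Real.rpow_add_of_nonneg (hw x) (by linarith) zero_le_one,
      sub_add_cancel]
  simp only [hpow]
  rw [← one_mul ((5 : ℝ) ^ D)]
  refine sum_rpow_mul_rpow_div_le_of_le (fun x _ => Real.rpow_nonneg (hw x) t)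
    (fun x _ => Real.rpow_nonneg (hw x) s) (div_nonneg (by linarith) ht.le) (by positivity) hst
    (by positivity) le_rfl (one_le_pow₀ (by norm_num)) (one_mul _).ge ?_ (card_box_div_le hn hk)
  gcongr
  exact sum_rpow_le_sobolevSum

theorem sum_grad_rpow_div_le_mul_sobolevSum (hn : 1 ≤ n) (hk : k ≤ 2 * n) (hs : 1 ≤ s)
    (ht : 0 < t) {β : ℝ} (hβ : 1 ≤ β) (hst : (β - 1) / t + 1 / s ≤ 1) {w : Vertex D → ℝ}
    (hw : ∀ x, 0 ≤ w x) :
    (∑ e ∈ bondsIn (box D k), n * |grad (fun x => w x ^ β) e|) / (n : ℝ) ^ D ≤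
      β * (2 * (D + 1) * ((D + 1) * 5 ^ D) *
        (((∑ x ∈ box D k, w x ^ t) / (n : ℝ) ^ D) ^ ((β - 1) / t) *
          (sobolevSum n s (box D k) w / (n : ℝ) ^ D) ^ (1 / s))) := by
  have hs0 : 0 < s := by linarith
  have hD : (0 : ℝ) ≤ D := D.cast_nonneg
  set m : Bond D → ℝ := fun e => max (w e.lower) (w e.upper)
  have hm (e) : 0 ≤ m e := (hw _).trans (le_max_left _ _)
  have hchain (e : Bond D) : n * |grad (fun x => w x ^ β) e| ≤
      β * ((m e ^ t) ^ ((β - 1) / t) * ((n * |grad w e|) ^ s) ^ (1 / s)) := by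
    rw [← Real.rpow_mul (hm e), mul_div_cancel₀ _ ht.ne', one_div,
      Real.rpow_rpow_inv (by positivity) hs0.ne']
    have h := abs_rpow_sub_rpow_le (hw e.upper) (hw e.lower) hβ
    rw [max_comm] at h
    calc n * |grad (fun x => w x ^ β) e| ≤ n * (β * m e ^ (β - 1) * |grad w e|) :=
          mul_le_mul_of_nonneg_left h n.cast_nonneg
      _ = _ := by ring
  have hmax : (∑ e ∈ bondsIn (box D k), m e ^ t) / (n : ℝ) ^ D ≤
      2 * (D + 1) * ((∑ x ∈ box D k, w x ^ t) / (n : ℝ) ^ D) := by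
    rw [← mul_div_assoc]
    have hnonneg := sum_nonneg fun x (_ : x ∈ box D k) => Real.rpow_nonneg (hw x) t
    gcongr
    linarith [sum_max_rpow_le (S := box D k) (t := t) hw]
  refine (div_le_div_of_nonneg_right (sum_le_sum fun e _ => hchain e) (by positivity)).trans ?_
  rw [← mul_sum, mul_div_assoc]
  refine mul_le_mul_of_nonneg_left (sum_rpow_mul_rpow_div_le_of_le
    (fun e _ => Real.rpow_nonneg (hm e) t) (fun e _ => by positivity)
    (div_nonneg (by linarith) ht.le) (by positivity) hst (by positivity) (by linarith)
    (one_le_mul_of_one_le_of_one_le (by linarith) (one_le_pow₀ (by norm_num))) hmax ?_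
    (card_bondsIn_box_div_le hn hk)) (by linarith)
  gcongr
  exact sum_rpow_grad_le_sobolevSum hw

theorem exists_sobolev_box_of_le (hD : 2 ≤ D) (hs : 1 ≤ s) (ht : (D : ℝ) / (D - 1) ≤ t)
    (hst : 1 / s - 1 / D ≤ 1 / t) :
    ∃ C, 0 < C ∧ ∀ n k : ℕ, 1 ≤ n → n ≤ k → k ≤ 2 * n → ∀ w : Vertex D → ℝ, (∀ x, 0 ≤ w x) →
      (∑ x ∈ box D k, w x ^ t) / (n : ℝ) ^ D ≤
        C * (sobolevSum n s (box D k) w / (n : ℝ) ^ D) ^ (t / s) := by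
  have hD' : (2 : ℝ) ≤ D := by exact_mod_cast hD
  have ht0 : 0 < t := lt_of_lt_of_le (div_pos (by linarith) (by linarith)) ht
  set β : ℝ := t * ((D - 1) / D)
  have hβ : 1 ≤ β := by
    rwa [← div_le_iff₀ (div_pos (by linarith) (by linarith)), one_div_div]
  have hβt : ((D : ℝ) - 1) / D - (β - 1) / t = 1 / t := by
    simp only [β]
    field_simp
    ring
  have hst' : (β - 1) / t + 1 / s ≤ 1 := by
    have : ((D : ℝ) - 1) / D = 1 - 1 / D := by field_simp
    linarith
  set c : ℝ := β * (2 * (D + 1) * ((D + 1) * 5 ^ D)) + 5 ^ D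
  have hc : 0 < c := by positivity
  refine ⟨c ^ t, by positivity, fun n k hn hnk hk w hw => ?_⟩
  set X := (∑ x ∈ box D k, w x ^ t) / (n : ℝ) ^ D
  set M := sobolevSum n s (box D k) w / (n : ℝ) ^ D
  have hX : 0 ≤ X := div_nonneg (sum_nonneg fun x _ => Real.rpow_nonneg (hw x) t) (by positivity)
  have hM : 0 ≤ M := div_nonneg (sobolevSum_nonneg hw) (by positivity)
  have hmain : X ^ (((D : ℝ) - 1) / D) ≤ c * (X ^ ((β - 1) / t) * M ^ (1 / s)) := by
    have hGN := gagliardo_nirenberg_box_normalized hD hn hnk fun x => Real.rpow_nonneg (hw x) β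
    have hβ' : β * ((D : ℝ) / (D - 1)) = t := by
      have : (D : ℝ) - 1 ≠ 0 := by linarith
      simp only [β]
      field_simp
    simp only [← Real.rpow_mul (hw _), hβ', sobolevSum, mul_one, Real.rpow_one, add_div] at hGN
    linear_combination hGN + sum_grad_rpow_div_le_mul_sobolevSum hn hk hs ht0 hβ hst' hw +
      sum_rpow_div_le_mul_sobolevSum hn hk hs ht0 hβ hst' hw
  calc X ≤ (c * M ^ (1 / s)) ^ t :=
        le_rpow_of_rpow_le_mul_rpow hX (by positivity) ht0 hβt (by linarith)
    _ = c ^ t * M ^ (t / s) := by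
        rw [Real.mul_rpow hc.le (by positivity), ← Real.rpow_mul hM, one_div_mul_eq_div]

theorem exists_sobolev_box (hD : 2 ≤ D) (hs : 1 ≤ s) (ht : 0 < t) (hst : 1 / s - 1 / D ≤ 1 / t) :
    ∃ C, 0 < C ∧ ∀ n k : ℕ, 1 ≤ n → n ≤ k → k ≤ 2 * n → ∀ w : Vertex D → ℝ, (∀ x, 0 ≤ w x) →
      (∑ x ∈ box D k, w x ^ t) / (n : ℝ) ^ D ≤
        C * (sobolevSum n s (box D k) w / (n : ℝ) ^ D) ^ (t / s) := by
  have hD' : (2 : ℝ) ≤ D := by exact_mod_cast hD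
  rcases le_or_gt ((D : ℝ) / (D - 1)) t with ht₀ | ht₀
  · exact exists_sobolev_box_of_le hD hs ht₀ hst
  set t₀ : ℝ := D / (D - 1)
  have ht₀pos : 0 < t₀ := div_pos (by linarith) (by linarith)
  obtain ⟨C, hC, hsob⟩ := exists_sobolev_box_of_le (t := t₀) hD hs le_rfl (by
    have : 1 / t₀ = 1 - 1 / D := by
      simp only [t₀]
      field_simp
    have : 1 / s ≤ 1 := by rwa [div_le_one (by linarith)]
    linarith)
  refine ⟨C ^ (t / t₀) * 5 ^ D, by positivity, fun n k hn hnk hk w hw => ?_⟩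
  have hM : 0 ≤ sobolevSum n s (box D k) w / (n : ℝ) ^ D :=
    div_nonneg (sobolevSum_nonneg hw) (by positivity)
  have hpow (x) : w x ^ t = (w x ^ t₀) ^ (t / t₀) := by
    rw [← Real.rpow_mul (hw x), mul_div_cancel₀ _ ht₀pos.ne']
  have htt₀ : t / t₀ ≤ 1 := by rw [div_le_one ht₀pos]; exact ht₀.le
  calc (∑ x ∈ box D k, w x ^ t) / (n : ℝ) ^ D
      ≤ ((∑ x ∈ box D k, w x ^ t₀) / (n : ℝ) ^ D) ^ (t / t₀) *
          (#(box D k) / (n : ℝ) ^ D) ^ (1 - t / t₀) := by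
        simp only [hpow]
        exact sum_rpow_div_le (fun x _ => Real.rpow_nonneg (hw x) t₀) (by positivity) htt₀
          (by positivity)
    _ ≤ (C * (sobolevSum n s (box D k) w / (n : ℝ) ^ D) ^ (t₀ / s)) ^ (t / t₀) * 5 ^ D := by
        gcongr
        · exact div_nonneg (sum_nonneg fun x _ => Real.rpow_nonneg (hw x) t₀) (by positivity)
        · exact hsob n k hn hnk hk w hw
        · exact rpow_le_of_le_one_le (by positivity) (card_box_div_le hn hk)
            (one_le_pow₀ (by norm_num)) (by linarith) (by linarith [div_pos ht ht₀pos])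
    _ = _ := by
        rw [Real.mul_rpow hC.le (by positivity), ← Real.rpow_mul hM,
          show t₀ / s * (t / t₀) = t / s by field_simp]
        ring

end SobolevInequality

section Layers

variable {d k m n : ℕ} {s : ℝ} {w : Vertex d → ℝ}

/-- The sup norm of a vertex. -/
def rad (x : Vertex d) : ℕ := univ.sup fun i => (x i).natAbs

theorem rad_le {x : Vertex d} : rad x ≤ n ↔ x ∈ box d n := by
  simp only [rad, Finset.sup_le_iff, mem_univ, true_implies, mem_box, Int.abs_eq_natAbs,
    Nat.cast_le]

theorem natAbs_le_rad (x : Vertex d) (i : Fin d) : (x i).natAbs ≤ rad x :=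
  le_sup (f := fun i => (x i).natAbs) (mem_univ i)

theorem natAbs_upper_sub_lower_le (e : Bond d) (i : Fin d) :
    (e.upper i - e.lower i).natAbs ≤ 1 := by
  obtain ⟨x, j⟩ := e
  rcases eq_or_ne i j with rfl | h <;> simp [Bond.upper, Bond.lower, *]

theorem rad_upper_le (e : Bond d) : rad e.upper ≤ rad e.lower + 1 :=
  Finset.sup_le fun i _ => by
    have := natAbs_upper_sub_lower_le e i
    have := natAbs_le_rad e.lower i
    omega

theorem rad_lower_le (e : Bond d) : rad e.lower ≤ rad e.upper + 1 :=
  Finset.sup_le fun i _ => by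
    have := natAbs_upper_sub_lower_le e i
    have := natAbs_le_rad e.upper i
    omega

/-- The sphere of radius `k` in the sup norm. -/
def sphere (d k : ℕ) : Finset (Vertex d) := (box d k).filter fun x => rad x = k

theorem mem_sphere {x : Vertex d} : x ∈ sphere d k ↔ rad x = k := by
  rw [sphere, mem_filter, ← rad_le]
  exact ⟨And.right, fun h => ⟨h.le, h⟩⟩

/-- The bonds of the box of radius `m` whose end-point closest to the origin has distance `k` to
it. They join vertices of the spheres of radius `k` and `k + 1`. -/
def layer (d m k : ℕ) : Finset (Bond d) :=
  (bondsIn (box d m)).filter fun e => min (rad e.lower) (rad e.upper) = k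

theorem layer_subset_bondsIn_sphere_union :
    layer d m k ⊆ bondsIn (sphere d k ∪ sphere d (k + 1)) := by
  intro e he
  have hk := (mem_filter.1 he).2
  have h1 := rad_upper_le e
  have h2 := rad_lower_le e
  simp only [mem_bondsIn, mem_union, mem_sphere]
  omega

theorem sum_layer_lower_add_upper_le {f : Vertex d → ℝ} (hf : ∀ x, 0 ≤ f x) :
    ∑ e ∈ layer d m k, (f e.lower + f e.upper) ≤
      2 * d * (∑ x ∈ sphere d k, f x + ∑ x ∈ sphere d (k + 1), f x) :=
  calc ∑ e ∈ layer d m k, (f e.lower + f e.upper)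
      ≤ ∑ e ∈ bondsIn (sphere d k ∪ sphere d (k + 1)), (f e.lower + f e.upper) :=
        sum_le_sum_of_subset_of_nonneg layer_subset_bondsIn_sphere_union fun e _ _ =>
          add_nonneg (hf _) (hf _)
    _ ≤ 2 * d * ∑ x ∈ sphere d k ∪ sphere d (k + 1), f x :=
        sum_bondsIn_lower_add_upper_le fun x _ => hf x
    _ ≤ 2 * d * (∑ x ∈ sphere d k, f x + ∑ x ∈ sphere d (k + 1), f x) := by
        rw [← sum_union_inter]
        have := sum_nonneg fun x (_ : x ∈ sphere d k ∩ sphere d (k + 1)) => hf x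
        gcongr
        linarith

theorem sum_sum_layer (I : Finset ℕ) (F : Bond d → ℝ) :
    ∑ k ∈ I, ∑ e ∈ layer d m k, F e =
      ∑ e ∈ bondsIn (box d m), if min (rad e.lower) (rad e.upper) ∈ I then F e else 0 := by
  simp only [layer, sum_filter]
  rw [sum_comm]
  exact sum_congr rfl fun e _ => sum_ite_eq I _ fun _ => F e

theorem sum_sum_layer_le (I : Finset ℕ) {F : Bond d → ℝ} (hF : ∀ e, 0 ≤ F e) :
    ∑ k ∈ I, ∑ e ∈ layer d m k, F e ≤ ∑ e ∈ bondsIn (box d m), F e :=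
  sum_fiberwise_le_sum_of_sum_fiber_nonneg fun _ _ => sum_nonneg fun e _ => hF e

theorem sum_sobolevSum_sphere_le {I : Finset ℕ} (hI : ∀ k ∈ I, k ≤ m) (hw : ∀ x, 0 ≤ w x) :
    ∑ k ∈ I, sobolevSum n s (sphere d k) w ≤ sobolevSum n s (box d m) w := by
  have hpow (e : Bond d) : 0 ≤ (n * |grad w e|) ^ s := by positivity
  have hsphere {k : ℕ} (hk : k ∈ I) : sphere d k ⊆ (box d m).filter fun x => rad x = k :=
    fun x hx => mem_filter.2 ⟨box_mono (hI k hk) (mem_filter.1 hx).1, mem_sphere.1 hx⟩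
  rw [sobolevSum, sum_congr rfl fun k _ => sobolevSum.eq_1 n s (sphere d k) w, sum_add_distrib]
  refine add_le_add ?_ ?_
  · refine (sum_le_sum fun k hk => ?_).trans (sum_fiberwise_le_sum_of_sum_fiber_nonneg
      (g := fun e => rad e.lower) (t := I) fun _ _ => sum_nonneg fun e _ => hpow e)
    refine sum_le_sum_of_subset_of_nonneg (fun e he => ?_) fun e _ _ => hpow e
    have he := mem_bondsIn.1 he
    exact mem_filter.2 ⟨mem_bondsIn.2 (he.imp (fun h => (mem_filter.1 (hsphere hk h)).1)
      fun h => (mem_filter.1 (hsphere hk h)).1), mem_sphere.1 he.1⟩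
  · refine (sum_le_sum fun k hk => ?_).trans (sum_fiberwise_le_sum_of_sum_fiber_nonneg
      (g := rad) (t := I) fun _ _ => sum_nonneg fun x _ => Real.rpow_nonneg (hw x) s)
    exact sum_le_sum_of_subset_of_nonneg (hsphere hk) fun x _ _ => Real.rpow_nonneg (hw x) s

end Layers

section Caccioppoli

variable {d m ρ σ : ℕ} {α : ℝ} {ω : Bond d → ℝ} {v : Vertex d → ℝ}

theorem sum_mul_divStar (F : Bond d → ℝ) {ψ : Vertex d → ℝ} (hψ : ∀ x, x ∉ box d m → ψ x = 0) :
    ∑ x ∈ box d m, ψ x * divStar F x = ∑ e ∈ bondsIn (box d (m + 1)), F e * grad ψ e := by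
  have hmem {x : Vertex d} (h : rad x ≤ m + 1) : x ∈ box d (m + 1) := rad_le.1 h
  have hlower : ∑ e ∈ box d m ×ˢ (univ : Finset (Fin d)), F e * ψ e.1 =
      ∑ e ∈ bondsIn (box d (m + 1)), F e * ψ e.lower := by
    refine sum_subset (fun e he => ?_) fun e _ he => ?_
    · have he := rad_le.2 (mem_product.1 he).1
      have := rad_upper_le e
      exact mem_bondsIn.2 ⟨hmem (he.trans m.le_succ), hmem (this.trans (Nat.succ_le_succ he))⟩
    · rw [hψ e.1 fun h => he (mem_product.2 ⟨h, mem_univ _⟩), mul_zero]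
  have hupper : ∑ e ∈ box d m ×ˢ (univ : Finset (Fin d)), F (e.1 - Pi.single e.2 1, e.2) * ψ e.1 =
      ∑ e ∈ bondsIn (box d (m + 1)), F e * ψ e.upper := by
    refine sum_of_injOn (fun e => (e.1 - Pi.single e.2 1, e.2)) ?_ (fun e he => ?_)
      (fun e _ he => ?_) fun e _ => ?_
    · rintro ⟨x, i⟩ _ ⟨y, j⟩ _ h
      simp only [Prod.mk.injEq] at h
      obtain ⟨h, rfl⟩ := h
      rw [sub_left_injective h]
    · have he := rad_le.2 (mem_product.1 he).1
      have := rad_lower_le ((e.1 - Pi.single e.2 1, e.2) : Bond d)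
      simp only [Bond.upper, sub_add_cancel] at this
      refine mem_bondsIn.2 ⟨hmem (this.trans (by gcongr)), ?_⟩
      simpa only [Bond.upper, sub_add_cancel] using hmem (he.trans m.le_succ)
    · rw [hψ e.upper fun h => he ⟨(e.upper, e.2), by simpa using h, by simp [Bond.upper]⟩,
        mul_zero]
    · simp [Bond.upper]
  simp only [grad, mul_sub, sum_sub_distrib, ← hlower, ← hupper]
  simp only [sum_product, ← sum_sub_distrib, divStar, mul_sum]
  exact sum_congr rfl fun x _ => sum_congr rfl fun i _ => by ring

/-- A subsolution of `∇* (ω ∇v) = 0`; note that `∇*` is minus the divergence. -/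
def IsSubsolution (ω : Bond d → ℝ) (v : Vertex d → ℝ) : Prop :=
  ∀ x, divStar (fun e => ω e * grad v e) x ≤ 0

theorem IsSolution.isSubsolution_abs {u : Vertex d → ℝ} (hω : ∀ e, 0 ≤ ω e)
    (hu : IsSolution ω u) : IsSubsolution ω fun x => |u x| := by
  intro x
  obtain ⟨ε, hεx, hε⟩ : ∃ ε : ℝ, |u x| = ε * u x ∧ ∀ y, ε * u y ≤ |u y| := by
    rcases abs_choice (u x) with h | h
    · exact ⟨1, by rw [h, one_mul], fun y => by simpa using le_abs_self (u y)⟩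
    · exact ⟨-1, by rw [h, neg_one_mul], fun y => by simpa using neg_le_abs (u y)⟩
  calc divStar (fun e => ω e * grad (fun x => |u x|) e) x
      ≤ ε * divStar (fun e => ω e * grad u e) x := by
        simp only [divStar, mul_sum, grad, Bond.upper, Bond.lower, sub_add_cancel, hεx]
        refine sum_le_sum fun i _ => ?_
        have h1 := mul_le_mul_of_nonneg_left (hε (x - Pi.single i 1)) (hω (x - Pi.single i 1, i))
        have h2 := mul_le_mul_of_nonneg_left (hε (x + Pi.single i 1)) (hω (x, i))
        linear_combination h1 + h2
    _ = 0 := by rw [hu x, mul_zero]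

theorem IsSubsolution.caccioppoli (hω : ∀ e, 0 ≤ ω e) (hv : IsSubsolution ω v)
    (hv0 : ∀ x, 0 ≤ v x) (hα : 1 ≤ α) {η : Vertex d → ℝ} (hη0 : ∀ x, 0 ≤ η x)
    (hη : ∀ x, x ∉ box d m → η x = 0) :
    ∑ e ∈ bondsIn (box d (m + 1)),
        ω e * ((η e.lower ^ 2 + η e.upper ^ 2) * grad (fun x => v x ^ α) e ^ 2) ≤
      8 * α ^ 2 * ∑ e ∈ bondsIn (box d (m + 1)),
        ω e * (grad η e ^ 2 * (v e.lower ^ α + v e.upper ^ α) ^ 2) := by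
  have htest : ∑ e ∈ bondsIn (box d (m + 1)),
      ω e * grad v e * grad (fun x => η x ^ 2 * v x ^ (2 * α - 1)) e ≤ 0 := by
    rw [← sum_mul_divStar (m := m) _ fun x hx => by simp [hη x hx]]
    exact sum_nonpos fun x _ => mul_nonpos_of_nonneg_of_nonpos
      (mul_nonneg (sq_nonneg _) (Real.rpow_nonneg (hv0 x) _)) (hv x)
  have hbond (e : Bond d) := mul_le_mul_of_nonneg_left (sq_add_sq_mul_sq_rpow_sub_le
    (hv0 e.upper) (hv0 e.lower) (hη0 e.upper) (hη0 e.lower) hα) (hω e)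
  calc _ ≤ 4 * α * ∑ e ∈ bondsIn (box d (m + 1)),
            ω e * grad v e * grad (fun x => η x ^ 2 * v x ^ (2 * α - 1)) e +
          8 * α ^ 2 * ∑ e ∈ bondsIn (box d (m + 1)),
            ω e * (grad η e ^ 2 * (v e.lower ^ α + v e.upper ^ α) ^ 2) := by
        rw [mul_sum, mul_sum, ← sum_add_distrib]
        refine sum_le_sum fun e _ => ?_
        simp only [grad]
        linear_combination hbond e
    _ ≤ _ := add_le_of_nonpos_left (mul_nonpos_of_nonneg_of_nonpos (by linarith) htest)

/-- The cutoff function that decreases by `1` across each layer in `G`. -/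
def layerCutoff (G : Finset ℕ) (x : Vertex d) : ℝ := #(G.filter (rad x ≤ ·))

theorem layerCutoff_eq_zero {G : Finset ℕ} {x : Vertex d} (hx : ∀ k ∈ G, k < rad x) :
    layerCutoff G x = 0 := by
  rw [layerCutoff, Nat.cast_eq_zero, card_eq_zero]
  exact filter_eq_empty_iff.2 fun k hk => not_le.2 (hx k hk)

theorem layerCutoff_eq_card {G : Finset ℕ} {x : Vertex d} (hx : ∀ k ∈ G, rad x ≤ k) :
    layerCutoff G x = #G := by
  rw [layerCutoff, filter_true_of_mem hx]

theorem abs_layerCutoff_sub_le {G : Finset ℕ} {x y : Vertex d} (hxy : rad x ≤ rad y)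
    (hyx : rad y ≤ rad x + 1) :
    |layerCutoff G x - layerCutoff G y| ≤ if rad x ∈ G then 1 else 0 := by
  have hsub : G.filter (rad y ≤ ·) ⊆ G.filter (rad x ≤ ·) :=
    monotone_filter_right _ fun _ _ h => hxy.trans h
  have hdiff : G.filter (rad x ≤ ·) ⊆ G.filter (rad y ≤ ·) ∪ G.filter (· = rad x) := by
    intro k
    simp only [mem_union, mem_filter, ← and_or_left]
    exact And.imp_right (by omega)
  have hcard : #(G.filter (rad x ≤ ·)) ≤ #(G.filter (rad y ≤ ·)) + if rad x ∈ G then 1 else 0 := by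
    refine (card_le_card hdiff).trans ((card_union_le _ _).trans (le_of_eq ?_))
    rw [filter_eq']
    split_ifs <;> rfl
  rw [layerCutoff, layerCutoff, abs_of_nonneg (sub_nonneg.2 (Nat.cast_le.2 (card_le_card hsub))),
    sub_le_iff_le_add']
  exact_mod_cast hcard

theorem grad_layerCutoff_sq_le (G : Finset ℕ) (e : Bond d) :
    grad (layerCutoff G) e ^ 2 ≤ if min (rad e.lower) (rad e.upper) ∈ G then 1 else 0 := by
  have hle : |grad (layerCutoff G) e| ≤
      if min (rad e.lower) (rad e.upper) ∈ G then 1 else 0 := by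
    rcases le_total (rad e.lower) (rad e.upper) with h | h
    · rw [min_eq_left h, grad, abs_sub_comm]
      exact abs_layerCutoff_sub_le h (rad_upper_le e)
    · rw [min_eq_right h, grad]
      exact abs_layerCutoff_sub_le h (rad_lower_le e)
  rw [← sq_abs]
  refine (pow_le_pow_left₀ (abs_nonneg _) hle 2).trans (le_of_eq ?_)
  split_ifs <;> simp

theorem sum_grad_layerCutoff_sq_mul_le (hω : ∀ e, 0 ≤ ω e) (hv0 : ∀ x, 0 ≤ v x) {G : Finset ℕ} :
    ∑ e ∈ bondsIn (box d m),
        ω e * (grad (layerCutoff G) e ^ 2 * (v e.lower ^ α + v e.upper ^ α) ^ 2) ≤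
      2 * ∑ k ∈ G, ∑ e ∈ layer d m k, ω e * (v e.lower ^ (2 * α) + v e.upper ^ (2 * α)) := by
  have hsq (x : Vertex d) : v x ^ (2 * α) = (v x ^ α) ^ 2 := by
    rw [← Real.rpow_mul_natCast (hv0 x), mul_comm, Nat.cast_ofNat]
  rw [sum_sum_layer, mul_sum]
  refine sum_le_sum fun e _ => ?_
  calc ω e * (grad (layerCutoff G) e ^ 2 * (v e.lower ^ α + v e.upper ^ α) ^ 2)
      ≤ ω e * ((if min (rad e.lower) (rad e.upper) ∈ G then 1 else 0) *
          (2 * ((v e.lower ^ α) ^ 2 + (v e.upper ^ α) ^ 2))) :=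
        mul_le_mul_of_nonneg_left (mul_le_mul (grad_layerCutoff_sq_le G e) add_sq_le
          (sq_nonneg _) (by split_ifs <;> norm_num)) (hω e)
    _ = 2 * if min (rad e.lower) (rad e.upper) ∈ G then
          ω e * (v e.lower ^ (2 * α) + v e.upper ^ (2 * α)) else 0 := by
        rw [hsq, hsq]
        split_ifs <;> ring

theorem IsSubsolution.card_sq_mul_energy_le (hω : ∀ e, 0 ≤ ω e) (hv : IsSubsolution ω v)
    (hv0 : ∀ x, 0 ≤ v x) (hα : 1 ≤ α) {G : Finset ℕ} (hG : G ⊆ Ico σ ρ) :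
    #G ^ 2 * ∑ e ∈ bondsIn (box d σ), ω e * grad (fun x => v x ^ α) e ^ 2 ≤
      8 * α ^ 2 * ∑ k ∈ G, ∑ e ∈ layer d ρ k,
        ω e * (v e.lower ^ (2 * α) + v e.upper ^ (2 * α)) := by
  rcases G.eq_empty_or_nonempty with rfl | ⟨k₀, hk₀⟩
  · simp
  have hσρ := mem_Ico.1 (hG hk₀)
  obtain ⟨m, rfl⟩ : ∃ m, ρ = m + 1 := ⟨ρ - 1, by omega⟩
  have hcacc := hv.caccioppoli (m := m) hω hv0 hα (η := layerCutoff G) (fun _ => Nat.cast_nonneg _)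
    fun x hx => layerCutoff_eq_zero fun k hk => by
      have := mem_Ico.1 (hG hk)
      rw [← rad_le] at hx
      omega
  have hinner {x : Vertex d} (hx : x ∈ box d σ) : layerCutoff G x = #G :=
    layerCutoff_eq_card fun k hk => (rad_le.2 hx).trans (mem_Ico.1 (hG hk)).1
  have hleft : 2 * (#G ^ 2 * ∑ e ∈ bondsIn (box d σ), ω e * grad (fun x => v x ^ α) e ^ 2) ≤
      ∑ e ∈ bondsIn (box d (m + 1)), ω e * ((layerCutoff G e.lower ^ 2 +
        layerCutoff G e.upper ^ 2) * grad (fun x => v x ^ α) e ^ 2) := by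
    rw [← mul_assoc, mul_sum]
    refine (sum_le_sum fun e he => le_of_eq ?_).trans (sum_le_sum_of_subset_of_nonneg
      (bondsIn_mono (box_mono (hσρ.1.trans hσρ.2.le))) fun e _ _ => ?_)
    · have he := mem_bondsIn.1 he
      rw [hinner he.1, hinner he.2]
      ring
    · have := hω e
      positivity
  have hright := sum_grad_layerCutoff_sq_mul_le (α := α) (m := m + 1) (G := G) hω hv0
  have hα2 : 0 ≤ 8 * α ^ 2 := by positivity
  linear_combination (hleft + hcacc + 8 * α ^ 2 * hright) / 2

end Caccioppoli

section SobolevSphere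

variable {D k n : ℕ} {s t : ℝ} {w : Vertex (D + 1) → ℝ}

theorem rad_insertNth (i : Fin (D + 1)) {c : ℤ} (hc : c.natAbs = k) {y : Vertex D}
    (hy : y ∈ box D k) : rad (i.insertNth c y : Vertex (D + 1)) = k := by
  refine le_antisymm (rad_le.2 (mem_box.2 fun j => ?_)) ?_
  · rcases Fin.eq_self_or_eq_succAbove i j with rfl | ⟨j, rfl⟩
    · simp [Int.abs_eq_natAbs, hc]
    · simpa using mem_box.1 hy j
  · simpa [hc] using natAbs_le_rad (i.insertNth c y : Vertex (D + 1)) i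

theorem insertNth_add_single (i : Fin (D + 1)) (c : ℤ) (y : Vertex D) (j : Fin D) :
    (i.insertNth c (y + Pi.single j 1) : Vertex (D + 1)) =
      i.insertNth c y + Pi.single (i.succAbove j) 1 := by
  funext l
  rcases Fin.eq_self_or_eq_succAbove i l with rfl | ⟨l, rfl⟩
  · simp
  · simp only [Fin.insertNth_apply_succAbove, Pi.add_apply, Pi.single_apply,
      Fin.succAbove_right_inj]

/-- The faces of the box of radius `k` in `ℤ^(D + 1)`: the pair `(i, c)` stands for the points of
the box whose `i`-th coordinate is `c = ±k`. -/
def faces (D k : ℕ) : Finset (Fin (D + 1) × ℤ) := univ ×ˢ {(k : ℤ), -(k : ℤ)}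

theorem card_faces_le : #(faces D k) ≤ 2 * (D + 1) := by
  rw [faces, card_product, card_univ, Fintype.card_fin, mul_comm]
  gcongr
  exact card_le_two

theorem sum_sphere_le_sum_faces {F : Vertex (D + 1) → ℝ} (hF : ∀ x, 0 ≤ F x) :
    ∑ x ∈ sphere (D + 1) k, F x ≤
      ∑ f ∈ faces D k, ∑ y ∈ box D k, F (Fin.insertNth f.1 f.2 y) := by
  rw [← sum_product' (f := fun (f : Fin (D + 1) × ℤ) y => F (f.1.insertNth f.2 y))]
  refine le_trans (sum_le_sum_of_subset_of_nonneg (fun x hx => ?_) fun x _ _ => hF x)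
    (sum_image_le_of_nonneg
      (g := fun a : (Fin (D + 1) × ℤ) × Vertex D => Fin.insertNth a.1.1 a.1.2 a.2)
      fun x _ => hF x)
  rw [mem_sphere] at hx
  obtain ⟨i, -, hi⟩ := exists_mem_eq_sup univ univ_nonempty fun i => (x i).natAbs
  change rad x = _ at hi
  refine mem_image.2 ⟨((i, x i), i.removeNth x), ?_, Fin.insertNth_self_removeNth i x⟩
  simp only [faces, mem_product, mem_univ, mem_insert, mem_singleton, true_and, mem_box]
  refine ⟨by omega, fun j => ?_⟩
  exact mem_box.1 (rad_le.1 hx.le) (i.succAbove j)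

theorem sobolevSum_insertNth_le (i : Fin (D + 1)) {c : ℤ} (hc : c.natAbs = k)
    (hw : ∀ x, 0 ≤ w x) :
    sobolevSum n s (box D k) (fun y => w (i.insertNth c y)) ≤
      sobolevSum n s (sphere (D + 1) k) w := by
  have hface {y : Vertex D} (hy : y ∈ box D k) : i.insertNth c y ∈ sphere (D + 1) k :=
    mem_sphere.2 (rad_insertNth i hc hy)
  have hinj : Function.Injective fun y : Vertex D => (i.insertNth c y : Vertex (D + 1)) :=
    Fin.insertNth_right_injective (α := fun _ => ℤ) c
  refine add_le_add ?_ ?_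
  · let φ : Bond D → Bond (D + 1) := fun e => (i.insertNth c e.1, i.succAbove e.2)
    have hupper (e : Bond D) : (φ e).upper = i.insertNth c e.upper :=
      (insertNth_add_single i c e.1 e.2).symm
    have hφ : Function.Injective φ := fun e e' h =>
      Prod.ext (hinj (Prod.ext_iff.1 h).1) (Fin.succAbove_right_injective (Prod.ext_iff.1 h).2)
    calc ∑ e ∈ bondsIn (box D k), (n * |grad (fun y => w (i.insertNth c y)) e|) ^ s
        = ∑ e ∈ (bondsIn (box D k)).image φ, (n * |grad w e|) ^ s := by
          rw [sum_image hφ.injOn]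
          exact sum_congr rfl fun e _ => by rw [grad, grad, hupper]; rfl
      _ ≤ ∑ e ∈ bondsIn (sphere (D + 1) k), (n * |grad w e|) ^ s := by
          refine sum_le_sum_of_subset_of_nonneg (fun e he => ?_) fun e _ _ => by positivity
          obtain ⟨e, he', rfl⟩ := mem_image.1 he
          have he' := mem_bondsIn.1 he'
          exact mem_bondsIn.2 ⟨hface he'.1, hupper e ▸ hface he'.2⟩
  · calc ∑ y ∈ box D k, w (i.insertNth c y) ^ s
        = ∑ x ∈ (box D k).image fun y => (i.insertNth c y : Vertex (D + 1)), w x ^ s := by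
          rw [sum_image hinj.injOn]
      _ ≤ ∑ x ∈ sphere (D + 1) k, w x ^ s := by
          refine sum_le_sum_of_subset_of_nonneg (fun x hx => ?_)
            fun x _ _ => Real.rpow_nonneg (hw x) s
          obtain ⟨y, hy, rfl⟩ := mem_image.1 hx
          exact hface hy

theorem exists_sobolev_sphere (hD : 2 ≤ D) (hs : 1 ≤ s) (ht : 0 < t)
    (hst : 1 / s - 1 / D ≤ 1 / t) :
    ∃ C, 0 < C ∧ ∀ n k : ℕ, 1 ≤ n → n ≤ k → k ≤ 2 * n → ∀ w : Vertex (D + 1) → ℝ,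
      (∀ x, 0 ≤ w x) → (∑ x ∈ sphere (D + 1) k, w x ^ t) / (n : ℝ) ^ D ≤
        C * (sobolevSum n s (sphere (D + 1) k) w / (n : ℝ) ^ D) ^ (t / s) := by
  obtain ⟨C, hC, hsobolev⟩ := exists_sobolev_box hD hs ht hst
  refine ⟨(2 * (D + 1)) * C, by positivity, fun n k hn hk hk' w hw => ?_⟩
  set X := sobolevSum n s (sphere (D + 1) k) w / (n : ℝ) ^ D
  have hface : ∀ f ∈ faces D k,
      (∑ y ∈ box D k, w (Fin.insertNth f.1 f.2 y) ^ t) / (n : ℝ) ^ D ≤ C * X ^ (t / s) := by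
    intro f hf
    have hc : f.2.natAbs = k := by
      simp only [faces, mem_product, mem_insert, mem_singleton] at hf
      omega
    refine (hsobolev n k hn hk hk' _ fun y => hw _).trans ?_
    have := sobolevSum_nonneg (n := n) (s := s) (S := box D k) fun y => hw (f.1.insertNth f.2 y)
    simp only [X]
    gcongr
    exact sobolevSum_insertNth_le f.1 hc hw
  calc (∑ x ∈ sphere (D + 1) k, w x ^ t) / (n : ℝ) ^ D
      ≤ (∑ f ∈ faces D k, ∑ y ∈ box D k, w (Fin.insertNth f.1 f.2 y) ^ t) / (n : ℝ) ^ D := by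
        gcongr
        exact sum_sphere_le_sum_faces fun x => Real.rpow_nonneg (hw x) t
    _ ≤ #(faces D k) • (C * X ^ (t / s)) := by
        rw [sum_div]
        exact sum_le_card_nsmul _ _ _ hface
    _ ≤ 2 * (D + 1) * C * X ^ (t / s) := by
        have : 0 ≤ C * X ^ (t / s) := mul_nonneg hC.le (Real.rpow_nonneg
          (div_nonneg (sobolevSum_nonneg hw) (by positivity)) _)
        rw [nsmul_eq_mul, mul_assoc _ C]
        gcongr
        exact_mod_cast card_faces_le

end SobolevSphere

/-- A form of the bound `‖f‖_{L^{1/θ}(S)} ≤ W` on the averaged norm of `f ≥ 0` that covers all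
exponents `1/θ ∈ [1, ∞]` at once: `f` is at most `W g^θ` for a function `g` of mean at most one. -/
structure AvgBounded {α : Type*} (S : Finset α) (θ W : ℝ) (f : α → ℝ) : Prop where
  nonneg : 0 ≤ W
  exists_majorant : ∃ g : α → ℝ, (∀ x, 0 ≤ g x) ∧ (∀ x ∈ S, f x ≤ W * g x ^ θ) ∧
    ∑ x ∈ S, g x ≤ #S

section WeightedNorms

variable {d m n ρ σ : ℕ} {P Q W Wp Wq V Y r s t : ℝ} {ω g : Bond d → ℝ} {w v : Vertex d → ℝ}

theorem sum_mul_rpow_add_rpow_div_le {T : Finset (Bond d)} (hg0 : ∀ e, 0 ≤ g e)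
    (hωg : ∀ e ∈ T, ω e ≤ W * g e ^ P) (hW : 0 ≤ W) (hP : 0 ≤ P) (hP1 : P ≤ 1)
    (htr : t * (1 - P) = r) (hV : 0 ≤ V) (hw : ∀ x, 0 ≤ w x) :
    (∑ e ∈ T, ω e * (w e.lower ^ r + w e.upper ^ r)) / V ≤
      2 * W * (((∑ e ∈ T, g e) / V) ^ P *
        ((∑ e ∈ T, (w e.lower ^ t + w e.upper ^ t)) / V) ^ (1 - P)) := by
  have hpow (x : Vertex d) : 0 ≤ w x ^ t := Real.rpow_nonneg (hw x) t
  have hsum (e : Bond d) : w e.lower ^ r + w e.upper ^ r ≤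
      2 * (w e.lower ^ t + w e.upper ^ t) ^ (1 - P) := by
    rw [← htr, Real.rpow_mul (hw _), Real.rpow_mul (hw _), two_mul]
    have hl := hpow e.lower
    have hu := hpow e.upper
    gcongr <;> linarith
  calc (∑ e ∈ T, ω e * (w e.lower ^ r + w e.upper ^ r)) / V
      ≤ (∑ e ∈ T, 2 * W * (g e ^ P * (w e.lower ^ t + w e.upper ^ t) ^ (1 - P))) / V := by
        refine div_le_div_of_nonneg_right (sum_le_sum fun e he => ?_) hV
        refine (mul_le_mul (hωg e he) (hsum e)
          (add_nonneg (Real.rpow_nonneg (hw _) r) (Real.rpow_nonneg (hw _) r))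
          (mul_nonneg hW (Real.rpow_nonneg (hg0 e) P))).trans_eq ?_
        ring
    _ = 2 * W * ((∑ e ∈ T, g e ^ P * (w e.lower ^ t + w e.upper ^ t) ^ (1 - P)) / V) := by
        rw [← mul_sum, mul_div_assoc]
    _ ≤ _ := by
        gcongr
        exact sum_rpow_mul_rpow_div_le (fun e _ => hg0 e)
          (fun e _ => add_nonneg (hpow _) (hpow _)) hP (by linarith) (by ring) hV

/-- The Dirichlet energy of `w` on the box of radius `m`, made scale invariant at the length
scale `n`. -/
def energy (n m : ℕ) (ω : Bond d → ℝ) (w : Vertex d → ℝ) : ℝ :=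
  (∑ e ∈ bondsIn (box d m), ω e * (n * grad w e) ^ 2) / (n : ℝ) ^ d

theorem energy_nonneg (hω : ∀ e, 0 ≤ ω e) : 0 ≤ energy n m ω w :=
  div_nonneg (sum_nonneg fun e _ => mul_nonneg (hω e) (sq_nonneg _)) (by positivity)

theorem sum_majorant_div_le (hn : 1 ≤ n) (hm : m ≤ 2 * n) (hg0 : ∀ e, 0 ≤ g e)
    (hg : ∑ e ∈ bondsIn (box d (2 * n)), g e ≤ #(bondsIn (box d (2 * n)))) :
    (∑ e ∈ bondsIn (box d m), g e) / (n : ℝ) ^ d ≤ (d + 1) * 5 ^ d :=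
  calc (∑ e ∈ bondsIn (box d m), g e) / (n : ℝ) ^ d
      ≤ #(bondsIn (box d (2 * n))) / (n : ℝ) ^ d := by
        gcongr
        exact (sum_le_sum_of_subset_of_nonneg (bondsIn_mono (box_mono hm))
          fun e _ _ => hg0 e).trans hg
    _ ≤ (d + 1) * 5 ^ d := card_bondsIn_box_div_le hn le_rfl

theorem mul_abs_grad_rpow_le {e : Bond d} {η : ℝ} (hω : 0 < ω e) (hWq : 0 ≤ Wq) (hη : 0 ≤ η)
    (hs : s * (1 + Q) = 2) (hs0 : 0 ≤ s) (hωη : (ω e)⁻¹ ≤ Wq * η ^ Q) :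
    (n * |grad w e|) ^ s ≤
      Wq ^ (s / 2) * ((ω e * (n * grad w e) ^ 2) ^ (s / 2) * η ^ (1 - s / 2)) := by
  have hηQ := Real.rpow_nonneg hη Q
  calc (n * |grad w e|) ^ s = ((n * grad w e) ^ 2) ^ (s / 2) := by
        rw [← sq_abs, abs_mul, Nat.abs_cast, ← Real.rpow_natCast_mul (by positivity)]
        congr 1
        push_cast
        ring
    _ = (ω e * (n * grad w e) ^ 2 * (ω e)⁻¹) ^ (s / 2) := by
        rw [mul_right_comm, mul_inv_cancel₀ hω.ne', one_mul]
    _ ≤ (ω e * (n * grad w e) ^ 2 * (Wq * η ^ Q)) ^ (s / 2) := by gcongr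
    _ = _ := by
        rw [Real.mul_rpow (by positivity) (by positivity), Real.mul_rpow hWq hηQ,
          ← Real.rpow_mul hη, show Q * (s / 2) = 1 - s / 2 by linarith]
        ring

theorem AvgBounded.sum_grad_rpow_div_le (hω : ∀ e, 0 < ω e)
    (hh : AvgBounded (bondsIn (box d (2 * n))) Q Wq fun e => (ω e)⁻¹) (hQ : 0 ≤ Q)
    (hs : s * (1 + Q) = 2) (hn : 1 ≤ n) (hm : m ≤ 2 * n) :
    (∑ e ∈ bondsIn (box d m), (n * |grad w e|) ^ s) / (n : ℝ) ^ d ≤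
      (d + 1) * 5 ^ d * (Wq * energy n m ω w) ^ (s / 2) := by
  obtain ⟨hWq, h, hh0, hωh, hsum⟩ := hh
  have hs0 : 0 < s := by nlinarith
  have hs2 : s ≤ 2 := by nlinarith
  have hω0 (e : Bond d) : 0 ≤ ω e := (hω e).le
  calc (∑ e ∈ bondsIn (box d m), (n * |grad w e|) ^ s) / (n : ℝ) ^ d
      ≤ Wq ^ (s / 2) * ((∑ e ∈ bondsIn (box d m),
          (ω e * (n * grad w e) ^ 2) ^ (s / 2) * h e ^ (1 - s / 2)) / (n : ℝ) ^ d) := by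
        rw [← mul_div_assoc, mul_sum]
        gcongr with e he
        exact mul_abs_grad_rpow_le (hω e) hWq (hh0 e) hs hs0.le
          (hωh e (bondsIn_mono (box_mono hm) he))
    _ ≤ Wq ^ (s / 2) * (energy n m ω w ^ (s / 2) *
          ((∑ e ∈ bondsIn (box d m), h e) / (n : ℝ) ^ d) ^ (1 - s / 2)) := by
        gcongr
        exact sum_rpow_mul_rpow_div_le (fun e _ => mul_nonneg (hω0 e) (sq_nonneg _))
          (fun e _ => hh0 e) (by positivity) (by linarith) (by ring) (by positivity)
    _ ≤ Wq ^ (s / 2) * (energy n m ω w ^ (s / 2) * ((d + 1) * 5 ^ d)) := by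
        have := energy_nonneg (n := n) (m := m) (w := w) hω0
        gcongr
        refine rpow_le_of_le_one_le (div_nonneg (sum_nonneg fun e _ => hh0 e) (by positivity))
          (sum_majorant_div_le hn hm hh0 hsum) ?_ (by linarith) (by linarith)
        exact one_le_mul_of_one_le_of_one_le (by simp) (one_le_pow₀ (by norm_num))
    _ = _ := by
        rw [Real.mul_rpow hWq (energy_nonneg hω0)]
        ring

/-- The discrete `W^{1,s}` norm of `w ≥ 0` on the box of radius `m`, made scale invariant at the
length scale `n`. -/
def sobolevNorm (n : ℕ) (s : ℝ) (m : ℕ) (w : Vertex d → ℝ) : ℝ :=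
  (sobolevSum n s (box d m) w / (n : ℝ) ^ d) ^ (1 / s)

theorem sobolevNorm_nonneg (hw : ∀ x, 0 ≤ w x) : 0 ≤ sobolevNorm n s m w :=
  Real.rpow_nonneg (div_nonneg (sobolevSum_nonneg hw) (by positivity)) _

theorem sobolevNorm_rpow (hw : ∀ x, 0 ≤ w x) (r : ℝ) :
    sobolevNorm n s m w ^ r = (sobolevSum n s (box d m) w / (n : ℝ) ^ d) ^ (r / s) := by
  rw [sobolevNorm, ← Real.rpow_mul (div_nonneg (sobolevSum_nonneg hw) (by positivity)),
    one_div_mul_eq_div]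

theorem AvgBounded.sobolevNorm_le (hω : ∀ e, 0 < ω e)
    (hh : AvgBounded (bondsIn (box d (2 * n))) Q Wq fun e => (ω e)⁻¹) (hQ : 0 ≤ Q)
    (hQ1 : Q ≤ 1) (hs : s * (1 + Q) = 2) (hn : 1 ≤ n) (hm : m ≤ 2 * n) (hw : ∀ x, 0 ≤ w x)
    (hY : 0 ≤ Y) (hW : 1 ≤ Wp * Wq) (henergy : energy n m ω w ≤ Wp * Y ^ 2)
    (hsum : (∑ x ∈ box d m, w x ^ s) / (n : ℝ) ^ d ≤ Y ^ s) :
    sobolevNorm n s m w ≤ ((d + 1) * 5 ^ d + 1) * √(Wp * Wq) * Y := by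
  have hs0 : 0 < s := by nlinarith
  have hs1 : 1 ≤ s := by nlinarith
  have hroot : 1 ≤ √(Wp * Wq) := Real.one_le_sqrt.2 hW
  have hgrad : (Wq * energy n m ω w) ^ (s / 2) ≤ (√(Wp * Wq) * Y) ^ s :=
    calc (Wq * energy n m ω w) ^ (s / 2) ≤ ((√(Wp * Wq) * Y) ^ 2) ^ (s / 2) := by
          rw [mul_pow, Real.sq_sqrt (by linarith)]
          refine Real.rpow_le_rpow (mul_nonneg hh.nonneg (energy_nonneg fun e => (hω e).le)) ?_
            (by positivity)
          linear_combination mul_le_mul_of_nonneg_left henergy hh.nonneg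
      _ = (√(Wp * Wq) * Y) ^ s := by
          rw [← Real.rpow_natCast_mul (by positivity)]
          congr 1
          push_cast
          ring
  have hsobolev : sobolevSum n s (box d m) w / (n : ℝ) ^ d ≤
      (((d + 1) * 5 ^ d + 1) * √(Wp * Wq) * Y) ^ s :=
    calc sobolevSum n s (box d m) w / (n : ℝ) ^ d
        ≤ (d + 1) * 5 ^ d * (√(Wp * Wq) * Y) ^ s + (√(Wp * Wq) * Y) ^ s := by
          rw [sobolevSum, add_div]
          refine add_le_add ((hh.sum_grad_rpow_div_le hω hQ hs hn hm).trans ?_) (hsum.trans ?_)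
          · gcongr
          · gcongr
            exact le_mul_of_one_le_left hY hroot
      _ = ((d + 1) * 5 ^ d + 1) * (√(Wp * Wq) * Y) ^ s := by ring
      _ ≤ ((d + 1) * 5 ^ d + 1) ^ s * (√(Wp * Wq) * Y) ^ s := by
          gcongr
          exact Real.self_le_rpow_of_one_le (le_add_of_nonneg_left (by positivity)) hs1
      _ = _ := by rw [← Real.mul_rpow (by positivity) (by positivity), mul_assoc]
  rw [sobolevNorm, one_div]
  exact (Real.rpow_inv_le_iff_of_pos (div_nonneg (sobolevSum_nonneg hw) (by positivity))
    (by positivity) hs0).2 hsobolev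

end WeightedNorms

/-- The exponents of the Moser iteration in dimension `D + 1`: `P` and `Q` are the reciprocals of
the integrability exponents of `ω` and `ω⁻¹`, the energy estimate controls gradients in `L^s`, and
one step of the iteration improves the exponent by the factor `1 + δ`. -/
structure MoserExponents (D : ℕ) (P Q s δ : ℝ) : Prop where
  two_le : 2 ≤ D
  P_nonneg : 0 ≤ P
  Q_nonneg : 0 ≤ Q
  s_mul : s * (1 + Q) = 2
  δ_pos : 0 < δ
  δ_eq : δ = 1 / D - (P + Q) / 2

namespace MoserExponents

variable {D : ℕ} {P Q s δ : ℝ} (h : MoserExponents D P Q s δ)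
include h

theorem one_div_le : 1 / (D : ℝ) ≤ 1 / 2 :=
  one_div_le_one_div_of_le two_pos (by exact_mod_cast h.two_le)

theorem δ_lt_one : δ < 1 := by
  linarith [h.one_div_le, h.δ_eq, h.P_nonneg, h.Q_nonneg]

theorem add_lt_one : P + Q < 1 := by
  linarith [h.one_div_le, h.δ_pos, h.δ_eq]

theorem P_lt_one : P < 1 := by linarith [h.add_lt_one, h.Q_nonneg]

theorem Q_lt_one : Q < 1 := by linarith [h.add_lt_one, h.P_nonneg]

theorem one_le_s : 1 ≤ s := by nlinarith [h.s_mul, h.Q_nonneg, h.Q_lt_one]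

theorem s_le_two : s ≤ 2 := by nlinarith [h.s_mul, h.Q_nonneg, h.one_le_s]

theorem s_pos : 0 < s := zero_lt_one.trans_le h.one_le_s

theorem two_div_s : 2 / s = 1 + Q := by
  rw [div_eq_iff h.s_pos.ne']
  linarith [h.s_mul]

theorem two_mul_div_s_le_two : 2 * (1 + δ) / s ≤ 2 := by
  rw [mul_comm, mul_div_assoc, h.two_div_s]
  nlinarith [h.one_div_le, h.δ_eq, h.P_nonneg, h.Q_nonneg, h.add_lt_one, sq_nonneg (Q - 1)]

theorem one_div_s_sub_le_sphere : 1 / s - 1 / D ≤ 1 / (2 * (1 + δ) / (1 - P)) := by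
  have hs : 1 / s = (1 + Q) / 2 := by linarith [h.two_div_s, (by ring : 2 / s = 2 * (1 / s))]
  have := h.δ_pos
  have := h.δ_eq
  rw [one_div_div, hs, le_div_iff₀ (by positivity)]
  nlinarith [h.P_nonneg, h.Q_nonneg, h.add_lt_one]

theorem one_div_s_sub_le_box :
    1 / s - 1 / ((D + 1 : ℕ) : ℝ) ≤ 1 / ((1 + δ) * s) := by
  have hs := h.s_pos
  have hδ := h.δ_pos
  have hD : (2 : ℝ) ≤ D := by exact_mod_cast h.two_le
  have hδD : δ * D ≤ 1 := by
    rw [← le_div_iff₀ (by linarith)]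
    linarith [h.δ_eq, h.P_nonneg, h.Q_nonneg]
  push_cast
  rw [div_sub_div _ _ hs.ne' (by linarith), div_le_div_iff₀ (by positivity) (by positivity)]
  nlinarith [h.one_le_s, mul_pos hs hδ]

end MoserExponents

section EnergyEstimate

variable {D : ℕ} {P Q s δ : ℝ}

theorem exists_layer_trace_le {t : ℝ} (hD : 2 ≤ D) (hs : 1 ≤ s) (ht : 0 < t)
    (hst : 1 / s - 1 / D ≤ 1 / t) : ∃ C, 0 < C ∧
    ∀ {n m k : ℕ}, 1 ≤ n → n ≤ k → k + 1 ≤ 2 * n →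
    ∀ {w : Vertex (D + 1) → ℝ}, (∀ x, 0 ≤ w x) →
    (∑ e ∈ layer (D + 1) m k, (w e.lower ^ t + w e.upper ^ t)) / (n : ℝ) ^ D ≤
      C * ((sobolevSum n s (sphere (D + 1) k) w + sobolevSum n s (sphere (D + 1) (k + 1)) w) /
        (n : ℝ) ^ D) ^ (t / s) := by
  obtain ⟨C, hC, hsphere⟩ := exists_sobolev_sphere hD hs ht hst
  refine ⟨2 * (D + 1 : ℕ) * C * 2, by positivity, fun {n m k} hn hnk hk {w} hw => ?_⟩
  have hZ (j : ℕ) : 0 ≤ sobolevSum n s (sphere (D + 1) j) w / (n : ℝ) ^ D :=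
    div_nonneg (sobolevSum_nonneg hw) (by positivity)
  rw [add_div (sobolevSum _ _ _ _)]
  set Z : ℕ → ℝ := fun j => sobolevSum n s (sphere (D + 1) j) w / (n : ℝ) ^ D
  calc (∑ e ∈ layer (D + 1) m k, (w e.lower ^ t + w e.upper ^ t)) / (n : ℝ) ^ D
      ≤ 2 * (D + 1 : ℕ) * ((∑ x ∈ sphere (D + 1) k, w x ^ t) / (n : ℝ) ^ D +
          (∑ x ∈ sphere (D + 1) (k + 1), w x ^ t) / (n : ℝ) ^ D) := by
        rw [← add_div, ← mul_div_assoc]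
        gcongr
        exact sum_layer_lower_add_upper_le fun x => Real.rpow_nonneg (hw x) t
    _ ≤ 2 * (D + 1 : ℕ) * (C * Z k ^ (t / s) + C * Z (k + 1) ^ (t / s)) := by
        gcongr
        · exact hsphere n k hn hnk (by lia) w hw
        · exact hsphere n (k + 1) hn (by lia) hk w hw
    _ ≤ 2 * (D + 1 : ℕ) * (C * (2 * (Z k + Z (k + 1)) ^ (t / s))) := by
        rw [← mul_add]
        gcongr
        exact rpow_add_rpow_le_two_mul (hZ k) (hZ (k + 1)) (by positivity)
    _ = _ := by ring

theorem MoserExponents.exists_layer_le (h : MoserExponents D P Q s δ) : ∃ C : ℝ, 0 < C ∧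
    ∀ {n m k : ℕ}, 1 ≤ n → n ≤ k → k + 1 ≤ 2 * n →
    ∀ {W : ℝ} {ω g : Bond (D + 1) → ℝ} {w : Vertex (D + 1) → ℝ}, 0 ≤ W → (∀ e, 0 ≤ g e) →
    (∀ e ∈ layer (D + 1) m k, ω e ≤ W * g e ^ P) → (∀ x, 0 ≤ w x) →
    (∑ e ∈ layer (D + 1) m k,
        ω e * (w e.lower ^ (2 * (1 + δ)) + w e.upper ^ (2 * (1 + δ)))) / (n : ℝ) ^ D ≤
      C * W * (((∑ e ∈ layer (D + 1) m k, g e) / (n : ℝ) ^ D) ^ P *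
        ((sobolevSum n s (sphere (D + 1) k) w + sobolevSum n s (sphere (D + 1) (k + 1)) w) /
          (n : ℝ) ^ D) ^ (2 * (1 + δ) / s)) := by
  have hP : 0 < 1 - P := by linarith [h.P_lt_one]
  have hδ := h.δ_pos
  set t := 2 * (1 + δ) / (1 - P)
  have ht : 0 < t := by positivity
  obtain ⟨c, hc, htrace⟩ := exists_layer_trace_le h.two_le h.one_le_s ht h.one_div_s_sub_le_sphere
  refine ⟨2 * c ^ (1 - P), by positivity, fun {n m k} hn hnk hk {W ω g w} hW hg hωg hw => ?_⟩
  set V := (sobolevSum n s (sphere (D + 1) k) w + sobolevSum n s (sphere (D + 1) (k + 1)) w) /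
    (n : ℝ) ^ D
  have hV : 0 ≤ V :=
    div_nonneg (add_nonneg (sobolevSum_nonneg hw) (sobolevSum_nonneg hw)) (by positivity)
  calc _ ≤ 2 * W * (((∑ e ∈ layer (D + 1) m k, g e) / (n : ℝ) ^ D) ^ P *
          ((∑ e ∈ layer (D + 1) m k, (w e.lower ^ t + w e.upper ^ t)) / (n : ℝ) ^ D) ^ (1 - P)) :=
        sum_mul_rpow_add_rpow_div_le hg hωg hW h.P_nonneg h.P_lt_one.le
          (div_mul_cancel₀ _ hP.ne') (by positivity) hw
    _ ≤ 2 * W * (((∑ e ∈ layer (D + 1) m k, g e) / (n : ℝ) ^ D) ^ P *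
          (c * V ^ (t / s)) ^ (1 - P)) := by
        have hG : 0 ≤ (∑ e ∈ layer (D + 1) m k, g e) / (n : ℝ) ^ D :=
          div_nonneg (sum_nonneg fun e _ => hg e) (by positivity)
        gcongr
        · exact div_nonneg (sum_nonneg fun e _ => add_nonneg (Real.rpow_nonneg (hw _) t)
            (Real.rpow_nonneg (hw _) t)) (by positivity)
        · exact htrace hn hnk hk hw
    _ = 2 * c ^ (1 - P) * W * (((∑ e ∈ layer (D + 1) m k, g e) / (n : ℝ) ^ D) ^ P *
          V ^ (2 * (1 + δ) / s)) := by
        rw [Real.mul_rpow (by positivity) (by positivity), ← Real.rpow_mul hV,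
          div_mul_eq_mul_div, div_mul_cancel₀ _ hP.ne']
        ring

theorem div_pow_le_of_mul_le {n D : ℕ} {A F f l : ℝ} (hn : 1 ≤ n) (hl : 0 < l)
    (hf : l * f ≤ 4 * F) (hF : F / (n : ℝ) ^ (D + 1) ≤ A) : f / (n : ℝ) ^ D ≤ 4 * (n / l * A) := by
  have hn' : (0 : ℝ) < n := by exact_mod_cast hn
  calc f / (n : ℝ) ^ D = n / l * (l * f / (n : ℝ) ^ (D + 1)) := by
        rw [pow_succ]
        field_simp
    _ ≤ n / l * (4 * F / (n : ℝ) ^ (D + 1)) := by gcongr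
    _ = 4 * (n / l * (F / (n : ℝ) ^ (D + 1))) := by ring
    _ ≤ 4 * (n / l * A) := by gcongr

theorem exists_good_layers {n σ ρ : ℕ} {g : Bond (D + 1) → ℝ} {w : Vertex (D + 1) → ℝ} {A : ℝ}
    (hn : 1 ≤ n) (hσρ : σ < ρ) (hg : ∀ e, 0 ≤ g e)
    (hA : (∑ e ∈ bondsIn (box (D + 1) ρ), g e) / (n : ℝ) ^ (D + 1) ≤ A) (hw : ∀ x, 0 ≤ w x) :
    ∃ G ⊆ Ico σ ρ, ((ρ - σ : ℕ) : ℝ) ≤ 2 * #G ∧ ∀ k ∈ G,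
      (∑ e ∈ layer (D + 1) ρ k, g e) / (n : ℝ) ^ D ≤ 4 * (n / (ρ - σ : ℕ) * A) ∧
      (sobolevSum n s (sphere (D + 1) k) w + sobolevSum n s (sphere (D + 1) (k + 1)) w) /
        (n : ℝ) ^ D ≤
        4 * (n / (ρ - σ : ℕ) * (2 * (sobolevSum n s (box (D + 1) ρ) w / (n : ℝ) ^ (D + 1)))) := by
  have hl : (0 : ℝ) < (ρ - σ : ℕ) := by exact_mod_cast Nat.sub_pos_of_lt hσρ
  obtain ⟨G, hG, hcard, haverage⟩ := exists_large_subset_le_average (S := Ico σ ρ)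
    (f := fun k => ∑ e ∈ layer (D + 1) ρ k, g e)
    (g := fun k => sobolevSum n s (sphere (D + 1) k) w + sobolevSum n s (sphere (D + 1) (k + 1)) w)
    (fun k _ => sum_nonneg fun e _ => hg e)
    fun k _ => add_nonneg (sobolevSum_nonneg hw) (sobolevSum_nonneg hw)
  simp only [Nat.card_Ico] at hcard haverage
  have hspheres : ∑ k ∈ Ico σ ρ, (sobolevSum n s (sphere (D + 1) k) w +
      sobolevSum n s (sphere (D + 1) (k + 1)) w) ≤ 2 * sobolevSum n s (box (D + 1) ρ) w := by
    rw [sum_add_distrib, sum_Ico_add' (fun k => sobolevSum n s (sphere (D + 1) k) w), two_mul]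
    exact add_le_add
      (sum_sobolevSum_sphere_le (fun k hk => (mem_Ico.1 hk).2.le) hw)
      (sum_sobolevSum_sphere_le (fun k hk => Nat.lt_succ_iff.1 (mem_Ico.1 hk).2) hw)
  refine ⟨G, hG, hcard, fun k hk => ⟨div_pow_le_of_mul_le hn hl (haverage k hk).1 ?_,
    div_pow_le_of_mul_le hn hl (haverage k hk).2 ?_⟩⟩
  · refine le_trans ?_ hA
    gcongr
    exact sum_sum_layer_le _ hg
  · rw [← mul_div_assoc]
    gcongr

theorem IsSubsolution.energy_le {n σ ρ : ℕ} {ω : Bond (D + 1) → ℝ} {v : Vertex (D + 1) → ℝ}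
    {G : Finset ℕ} {α M : ℝ} (hω : ∀ e, 0 ≤ ω e) (hv : IsSubsolution ω v) (hv0 : ∀ x, 0 ≤ v x)
    (hα : 1 ≤ α) (hn : 1 ≤ n) (hσρ : σ < ρ) (hG : G ⊆ Ico σ ρ)
    (hcard : ((ρ - σ : ℕ) : ℝ) ≤ 2 * #G)
    (hM : ∀ k ∈ G, (∑ e ∈ layer (D + 1) ρ k,
      ω e * (v e.lower ^ (2 * α) + v e.upper ^ (2 * α))) / (n : ℝ) ^ D ≤ M) :
    energy n σ ω (fun x => v x ^ α) ≤ 16 * α ^ 2 * (n / (ρ - σ : ℕ)) * M := by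
  have hn' : (0 : ℝ) < n := by exact_mod_cast hn
  have hl : (0 : ℝ) < (ρ - σ : ℕ) := by exact_mod_cast Nat.sub_pos_of_lt hσρ
  have hG0 : (0 : ℝ) < #G := by linarith
  have hM0 : 0 ≤ M := by
    obtain ⟨k, hk⟩ := card_pos.1 (by exact_mod_cast hG0)
    exact (div_nonneg (sum_nonneg fun e _ => mul_nonneg (hω e) (add_nonneg
      (Real.rpow_nonneg (hv0 _) _) (Real.rpow_nonneg (hv0 _) _))) (by positivity)).trans (hM k hk)
  have hsum : #G ^ 2 * ∑ e ∈ bondsIn (box (D + 1) σ), ω e * grad (fun x => v x ^ α) e ^ 2 ≤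
      8 * α ^ 2 * (#G * (M * (n : ℝ) ^ D)) := by
    refine (hv.card_sq_mul_energy_le hω hv0 hα hG).trans ?_
    rw [← nsmul_eq_mul]
    gcongr
    exact sum_le_card_nsmul _ _ _ fun k hk => (div_le_iff₀ (by positivity)).1 (hM k hk)
  have hscale : n / #G ≤ 2 * (n / (ρ - σ : ℕ) : ℝ) := by
    rw [← mul_div_assoc, div_le_div_iff₀ hG0 hl]
    linear_combination (n : ℝ) * hcard
  calc energy n σ ω (fun x => v x ^ α)
      = n ^ 2 / (#G ^ 2 * (n : ℝ) ^ (D + 1)) * (#G ^ 2 *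
          ∑ e ∈ bondsIn (box (D + 1) σ), ω e * grad (fun x => v x ^ α) e ^ 2) := by
        rw [energy, mul_comm ((#G : ℝ) ^ 2) (_ ^ _), div_mul_eq_mul_div]
        simp only [mul_pow, mul_left_comm _ ((n : ℝ) ^ 2), ← mul_sum]
        field_simp
    _ ≤ n ^ 2 / (#G ^ 2 * (n : ℝ) ^ (D + 1)) * (8 * α ^ 2 * (#G * (M * (n : ℝ) ^ D))) := by
        gcongr
    _ = 8 * α ^ 2 * (n / #G) * M := by
        field_simp
        ring
    _ ≤ 8 * α ^ 2 * (2 * (n / (ρ - σ : ℕ))) * M := by gcongr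
    _ = _ := by ring

end EnergyEstimate

section MoserStep

variable {D : ℕ} {P Q s δ : ℝ}

theorem one_le_div_sub {n σ ρ : ℕ} (hnσ : n ≤ σ) (hσρ : σ < ρ) (hρ : ρ ≤ 2 * n) :
    (1 : ℝ) ≤ n / (ρ - σ : ℕ) := by
  rw [one_le_div (by exact_mod_cast Nat.sub_pos_of_lt hσρ)]
  exact_mod_cast (by lia : ρ - σ ≤ n)

theorem MoserExponents.rpow_mul_rpow_le (h : MoserExponents D P Q s δ) {F V l c X : ℝ}
    (hF0 : 0 ≤ F) (hV0 : 0 ≤ V) (hl : 1 ≤ l) (hc : 1 ≤ c) (hX : 0 ≤ X) (hF : F ≤ 4 * (l * c))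
    (hV : V ≤ 4 * (l * (2 * X))) :
    F ^ P * V ^ (2 * (1 + δ) / s) ≤ 4 * c * 64 * l ^ 3 * X ^ (2 * (1 + δ) / s) := by
  have hκ : 0 ≤ 2 * (1 + δ) / s := by
    have := h.δ_pos
    have := h.s_pos
    positivity
  calc F ^ P * V ^ (2 * (1 + δ) / s)
      ≤ (4 * (l * c)) ^ P * (4 * (l * (2 * X))) ^ (2 * (1 + δ) / s) := by
        have := h.P_nonneg
        gcongr
    _ = (4 * (l * c)) ^ P * ((8 * l) ^ (2 * (1 + δ) / s) * X ^ (2 * (1 + δ) / s)) := by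
        rw [← Real.mul_rpow (by positivity) hX]
        ring_nf
    _ ≤ (4 * (l * c)) ^ (1 : ℝ) * ((8 * l) ^ (2 : ℝ) * X ^ (2 * (1 + δ) / s)) := by
        gcongr
        · nlinarith
        · exact h.P_lt_one.le
        · linarith
        · exact h.two_mul_div_s_le_two
    _ = 4 * c * 64 * l ^ 3 * X ^ (2 * (1 + δ) / s) := by
        rw [Real.rpow_one, Real.rpow_two]
        ring

theorem MoserExponents.exists_good_layers_le (h : MoserExponents D P Q s δ) : ∃ K : ℝ, 0 < K ∧
    ∀ {n σ ρ : ℕ}, 1 ≤ n → n ≤ σ → σ < ρ → ρ ≤ 2 * n →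
    ∀ {W : ℝ} {ω : Bond (D + 1) → ℝ} {w : Vertex (D + 1) → ℝ},
    AvgBounded (bondsIn (box (D + 1) (2 * n))) P W ω → (∀ x, 0 ≤ w x) →
    ∃ G ⊆ Ico σ ρ, ((ρ - σ : ℕ) : ℝ) ≤ 2 * #G ∧ ∀ k ∈ G,
      (∑ e ∈ layer (D + 1) ρ k,
          ω e * (w e.lower ^ (2 * (1 + δ)) + w e.upper ^ (2 * (1 + δ)))) / (n : ℝ) ^ D ≤
        K * W * (n / (ρ - σ : ℕ)) ^ 3 *
          (sobolevSum n s (box (D + 1) ρ) w / (n : ℝ) ^ (D + 1)) ^ (2 * (1 + δ) / s) := by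
  obtain ⟨C, hC, hlayer⟩ := h.exists_layer_le
  set c : ℝ := ((D + 1 : ℕ) + 1) * 5 ^ (D + 1)
  have hc : 1 ≤ c := one_le_mul_of_one_le_of_one_le (le_add_of_nonneg_left (Nat.cast_nonneg _))
    (one_le_pow₀ (by norm_num))
  refine ⟨C * (4 * c * 64), by positivity, fun {n σ ρ} hn hnσ hσρ hρ {W ω w} hW hw => ?_⟩
  obtain ⟨hW0, g, hg, hωg, hgsum⟩ := hW
  obtain ⟨G, hG, hcard, hgood⟩ :=
    exists_good_layers hn hσρ hg (sum_majorant_div_le hn hρ hg hgsum) hw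
  refine ⟨G, hG, hcard, fun k hk => ?_⟩
  have hkI := mem_Ico.1 (hG hk)
  have hωg' (e) (he : e ∈ layer (D + 1) ρ k) : ω e ≤ W * g e ^ P :=
    hωg e (bondsIn_mono (box_mono hρ) (mem_filter.1 he).1)
  calc _ ≤ _ := hlayer hn (hnσ.trans hkI.1) (by lia) hW0 hg hωg' hw
    _ ≤ C * W * (4 * c * 64 * (n / (ρ - σ : ℕ)) ^ 3 *
          (sobolevSum n s (box (D + 1) ρ) w / (n : ℝ) ^ (D + 1)) ^ (2 * (1 + δ) / s)) := by
        refine mul_le_mul_of_nonneg_left (h.rpow_mul_rpow_le ?_ ?_ (one_le_div_sub hnσ hσρ hρ) hc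
          ?_ (hgood k hk).1 (hgood k hk).2) (by positivity)
        · exact div_nonneg (sum_nonneg fun e _ => hg e) (by positivity)
        · exact div_nonneg (add_nonneg (sobolevSum_nonneg hw) (sobolevSum_nonneg hw))
            (by positivity)
        · exact div_nonneg (sobolevSum_nonneg hw) (by positivity)
    _ = _ := by ring

theorem MoserExponents.exists_energy_le (h : MoserExponents D P Q s δ) : ∃ K : ℝ, 0 < K ∧
    ∀ {n σ ρ : ℕ}, 1 ≤ n → n ≤ σ → σ < ρ → ρ ≤ 2 * n →
    ∀ {W a : ℝ} {ω : Bond (D + 1) → ℝ} {v : Vertex (D + 1) → ℝ}, (∀ e, 0 ≤ ω e) →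
    AvgBounded (bondsIn (box (D + 1) (2 * n))) P W ω → IsSubsolution ω v → (∀ x, 0 ≤ v x) →
    1 ≤ a →
    energy n σ ω (fun x => v x ^ ((1 + δ) * a)) ≤ K * W * (a * (n / (ρ - σ : ℕ)) ^ 2 *
      sobolevNorm n s ρ (fun x => v x ^ a) ^ (1 + δ)) ^ 2 := by
  obtain ⟨K, hK, hlayers⟩ := h.exists_good_layers_le
  refine ⟨16 * 4 * K, by positivity, fun {n σ ρ} hn hnσ hσρ hρ {W a ω v} hω hW hv hv0 ha => ?_⟩
  have hδ := h.δ_pos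
  have hW0 := hW.nonneg
  have hl := one_le_div_sub hnσ hσρ hρ
  set l : ℝ := n / (ρ - σ : ℕ)
  set w : Vertex (D + 1) → ℝ := fun x => v x ^ a
  have hw (x) : 0 ≤ w x := Real.rpow_nonneg (hv0 x) a
  set Y := (sobolevSum n s (box (D + 1) ρ) w / (n : ℝ) ^ (D + 1)) ^ (2 * (1 + δ) / s) with hY
  have hY0 : 0 ≤ Y := Real.rpow_nonneg (div_nonneg (sobolevSum_nonneg hw) (by positivity)) _
  obtain ⟨G, hG, hcard, hgood⟩ := hlayers hn hnσ hσρ hρ hW hw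
  have hpow (x) : w x ^ (2 * (1 + δ)) = v x ^ (2 * ((1 + δ) * a)) := by
    rw [← Real.rpow_mul (hv0 x)]
    congr 1
    ring
  simp only [hpow] at hgood
  have hα : 1 ≤ (1 + δ) * a := one_le_mul_of_one_le_of_one_le (by linarith) ha
  calc energy n σ ω (fun x => v x ^ ((1 + δ) * a))
      ≤ 16 * ((1 + δ) * a) ^ 2 * l * (K * W * l ^ 3 * Y) :=
        hv.energy_le hω hv0 hα hn hσρ hG hcard hgood
    _ ≤ 16 * (2 * a) ^ 2 * l * (K * W * l ^ 3 * Y) := by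
        gcongr
        linarith [h.δ_lt_one]
    _ = 16 * 4 * K * W * ((a * l ^ 2) ^ 2 * Y) := by ring
    _ = _ := by
        rw [mul_pow _ (_ ^ (1 + δ)), ← Real.rpow_mul_natCast (sobolevNorm_nonneg hw),
          sobolevNorm_rpow hw, Nat.cast_two, mul_comm (1 + δ) 2, hY]

theorem MoserExponents.exists_sum_rpow_rpow_le (h : MoserExponents D P Q s δ) : ∃ C : ℝ, 0 < C ∧
    ∀ {n σ ρ : ℕ}, 1 ≤ n → n ≤ σ → σ ≤ ρ → ρ ≤ 2 * n →
    ∀ {a : ℝ} {v : Vertex (D + 1) → ℝ}, (∀ x, 0 ≤ v x) →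
    (∑ x ∈ box (D + 1) σ, (v x ^ ((1 + δ) * a)) ^ s) / (n : ℝ) ^ (D + 1) ≤
      C * (sobolevNorm n s ρ (fun x => v x ^ a) ^ (1 + δ)) ^ s := by
  have hδ := h.δ_pos
  have hs := h.s_pos
  obtain ⟨C, hC, hsobolev⟩ := exists_sobolev_box (D := D + 1) (by linarith [h.two_le])
    h.one_le_s (by positivity : 0 < (1 + δ) * s) h.one_div_s_sub_le_box
  refine ⟨C, hC, fun {n σ ρ} hn hnσ hσρ hρ {a v} hv0 => ?_⟩
  have hw (x) : 0 ≤ v x ^ a := Real.rpow_nonneg (hv0 x) a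
  have hpow (x) : (v x ^ ((1 + δ) * a)) ^ s = (v x ^ a) ^ ((1 + δ) * s) := by
    rw [← Real.rpow_mul (hv0 x), ← Real.rpow_mul (hv0 x)]
    congr 1
    ring
  calc (∑ x ∈ box (D + 1) σ, (v x ^ ((1 + δ) * a)) ^ s) / (n : ℝ) ^ (D + 1)
      ≤ (∑ x ∈ box (D + 1) ρ, (v x ^ a) ^ ((1 + δ) * s)) / (n : ℝ) ^ (D + 1) := by
        simp only [hpow]
        gcongr
        · exact fun x _ _ => Real.rpow_nonneg (hw x) _
        · exact box_mono hσρ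
    _ ≤ _ := hsobolev n ρ hn (hnσ.trans hσρ) hρ _ hw
    _ = _ := by
        rw [← Real.rpow_mul (sobolevNorm_nonneg hw), sobolevNorm_rpow hw]

theorem MoserExponents.exists_moser_step (h : MoserExponents D P Q s δ) : ∃ K : ℝ, 1 ≤ K ∧
    ∀ {n σ ρ : ℕ}, 1 ≤ n → n ≤ σ → σ < ρ → ρ ≤ 2 * n →
    ∀ {Wp Wq a : ℝ} {ω : Bond (D + 1) → ℝ} {v : Vertex (D + 1) → ℝ}, (∀ e, 0 < ω e) →
    AvgBounded (bondsIn (box (D + 1) (2 * n))) P Wp ω →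
    AvgBounded (bondsIn (box (D + 1) (2 * n))) Q Wq (fun e => (ω e)⁻¹) → 1 ≤ Wp * Wq →
    IsSubsolution ω v → (∀ x, 0 ≤ v x) → 1 ≤ a →
    sobolevNorm n s σ (fun x => v x ^ ((1 + δ) * a)) ≤
      K * √(Wp * Wq) * (a * (n / (ρ - σ : ℕ)) ^ 2) *
        sobolevNorm n s ρ (fun x => v x ^ a) ^ (1 + δ) := by
  have hδ := h.δ_pos
  have hs := h.s_pos
  obtain ⟨K, hK, henergy⟩ := h.exists_energy_le
  obtain ⟨C, hC, hsobolev⟩ := h.exists_sum_rpow_rpow_le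
  set c : ℝ := ((D + 1 : ℕ) + 1) * 5 ^ (D + 1) + 1
  have hc : 1 ≤ c := le_add_of_nonneg_left (by positivity)
  refine ⟨c * (1 + K + C), one_le_mul_of_one_le_of_one_le hc (by linarith),
    fun {n σ ρ} hn hnσ hσρ hρ {Wp Wq a ω v} hω hWp hWq hW hv hv0 ha => ?_⟩
  set l : ℝ := n / (ρ - σ : ℕ)
  have hl : 1 ≤ l := one_le_div_sub hnσ hσρ hρ
  have hw (x) : 0 ≤ v x ^ a := Real.rpow_nonneg (hv0 x) a
  set N := sobolevNorm n s ρ (fun x => v x ^ a)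
  have hN0 : 0 ≤ N := sobolevNorm_nonneg hw
  have hWp0 := hWp.nonneg
  set Y := (1 + K + C) * (a * l ^ 2 * N ^ (1 + δ))
  have hsum : (∑ x ∈ box (D + 1) σ, (v x ^ ((1 + δ) * a)) ^ s) / (n : ℝ) ^ (D + 1) ≤ Y ^ s :=
    calc (∑ x ∈ box (D + 1) σ, (v x ^ ((1 + δ) * a)) ^ s) / (n : ℝ) ^ (D + 1)
        ≤ C * (N ^ (1 + δ)) ^ s := hsobolev hn hnσ hσρ.le hρ hv0
      _ ≤ (1 + K + C) ^ s * ((a * l ^ 2) * N ^ (1 + δ)) ^ s := by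
          gcongr
          · exact (by linarith : C ≤ 1 + K + C).trans
              (Real.self_le_rpow_of_one_le (by linarith) h.one_le_s)
          · exact le_mul_of_one_le_left (by positivity)
              (one_le_mul_of_one_le_of_one_le ha (one_le_pow₀ hl))
      _ = Y ^ s := (Real.mul_rpow (by positivity) (by positivity)).symm
  calc sobolevNorm n s σ (fun x => v x ^ ((1 + δ) * a)) ≤ c * √(Wp * Wq) * Y := by
        refine hWq.sobolevNorm_le hω h.Q_nonneg h.Q_lt_one.le h.s_mul hn (by lia)
          (fun x => Real.rpow_nonneg (hv0 x) _) (by positivity) hW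
          ((henergy hn hnσ hσρ hρ (fun e => (hω e).le) hWp hv hv0 ha).trans ?_) hsum
        rw [mul_pow (1 + K + C), mul_comm K, mul_assoc]
        gcongr
        nlinarith
    _ = _ := by ring

end MoserStep

/-- The `L^r` norm of `w ≥ 0` on the box of radius `m`, made scale invariant at the length scale
`n`. -/
def boxNorm {d : ℕ} (n : ℕ) (r : ℝ) (m : ℕ) (w : Vertex d → ℝ) : ℝ :=
  ((∑ x ∈ box d m, w x ^ r) / (n : ℝ) ^ d) ^ (1 / r)

section InitialStep

variable {D n m σ ρ : ℕ} {P Q s δ r : ℝ}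

theorem boxNorm_nonneg {d : ℕ} {w : Vertex d → ℝ} (hw : ∀ x, 0 ≤ w x) : 0 ≤ boxNorm n r m w :=
  Real.rpow_nonneg (div_nonneg (sum_nonneg fun x _ => Real.rpow_nonneg (hw x) r)
    (by positivity)) _

theorem boxNorm_rpow {d : ℕ} {w : Vertex d → ℝ} (hw : ∀ x, 0 ≤ w x) (t : ℝ) :
    boxNorm n r m w ^ t = ((∑ x ∈ box d m, w x ^ r) / (n : ℝ) ^ d) ^ (t / r) := by
  rw [boxNorm, ← Real.rpow_mul (div_nonneg (sum_nonneg fun x _ => Real.rpow_nonneg (hw x) r)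
    (by positivity)), one_div_mul_eq_div]

theorem sum_rpow_div_le_boxNorm_rpow {d : ℕ} {w : Vertex d → ℝ} (hn : 1 ≤ n) (hσρ : σ ≤ ρ)
    (hρ : ρ ≤ 2 * n) (hw : ∀ x, 0 ≤ w x) (hs : 0 ≤ s) (hr : 0 < r) (hsr : s ≤ r) :
    (∑ x ∈ box d σ, w x ^ s) / (n : ℝ) ^ d ≤ 5 ^ d * boxNorm n r ρ w ^ s := by
  have hsr1 : s / r ≤ 1 := (div_le_one hr).2 hsr
  calc (∑ x ∈ box d σ, w x ^ s) / (n : ℝ) ^ d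
      ≤ (∑ x ∈ box d ρ, w x ^ s) / (n : ℝ) ^ d := by
        gcongr
        · exact fun x _ _ => Real.rpow_nonneg (hw x) s
        · exact box_mono hσρ
    _ = (∑ x ∈ box d ρ, (w x ^ r) ^ (s / r)) / (n : ℝ) ^ d := by
        simp only [← Real.rpow_mul (hw _), mul_div_cancel₀ s hr.ne']
    _ ≤ boxNorm n r ρ w ^ s * (#(box d ρ) / (n : ℝ) ^ d) ^ (1 - s / r) := by
        rw [boxNorm_rpow hw]
        exact sum_rpow_div_le (fun x _ => Real.rpow_nonneg (hw x) r) (by positivity) hsr1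
          (by positivity)
    _ ≤ boxNorm n r ρ w ^ s * 5 ^ d := by
        have := boxNorm_nonneg (n := n) (m := ρ) (r := r) hw
        gcongr
        exact rpow_le_of_le_one_le (by positivity) (card_box_div_le hn hρ)
          (one_le_pow₀ (by norm_num)) (by linarith) (by linarith [div_nonneg hs hr.le])
    _ = _ := mul_comm _ _

variable {Wp Wq : ℝ} {ω : Bond (D + 1) → ℝ} {v : Vertex (D + 1) → ℝ}

theorem sum_mul_sq_add_sq_div_le_boxNorm_sq {g : Bond (D + 1) → ℝ} (hg : ∀ e, 0 ≤ g e)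
    (hωg : ∀ e ∈ bondsIn (box (D + 1) (2 * n)), ω e ≤ Wp * g e ^ P)
    (hgsum : ∑ e ∈ bondsIn (box (D + 1) (2 * n)), g e ≤ #(bondsIn (box (D + 1) (2 * n))))
    (hW : 0 ≤ Wp) (hP : 0 ≤ P) (hP1 : P < 1) (hn : 1 ≤ n) (hρ : ρ ≤ 2 * n) (hv0 : ∀ x, 0 ≤ v x) :
    (∑ e ∈ bondsIn (box (D + 1) ρ),
        ω e * (v e.lower ^ (2 : ℝ) + v e.upper ^ (2 : ℝ))) / (n : ℝ) ^ (D + 1) ≤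
      2 * Wp * (((D + 1 : ℕ) + 1) * 5 ^ (D + 1) *
        (2 * (D + 1 : ℕ) * boxNorm n (2 / (1 - P)) ρ v ^ 2)) := by
  set r := 2 / (1 - P) with hr
  have hr0 (x) : 0 ≤ v x ^ r := Real.rpow_nonneg (hv0 x) r
  have hP' : 0 < 1 - P := sub_pos.2 hP1
  set F := (∑ e ∈ bondsIn (box (D + 1) ρ), (v e.lower ^ r + v e.upper ^ r)) / (n : ℝ) ^ (D + 1)
  have hF0 : 0 ≤ F := div_nonneg (sum_nonneg fun e _ => add_nonneg (hr0 _) (hr0 _))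
    (by positivity)
  set E := (∑ x ∈ box (D + 1) ρ, v x ^ r) / (n : ℝ) ^ (D + 1)
  have hE0 : 0 ≤ E := div_nonneg (sum_nonneg fun x _ => hr0 x) (by positivity)
  have hFE : F ≤ 2 * (D + 1 : ℕ) * E :=
    (div_le_div_of_nonneg_right (sum_bondsIn_lower_add_upper_le fun x _ => hr0 x)
      (by positivity)).trans_eq (mul_div_assoc _ _ _)
  have hFpow : F ^ (1 - P) ≤ 2 * (D + 1 : ℕ) * boxNorm n r ρ v ^ 2 :=
    calc F ^ (1 - P) ≤ (2 * (D + 1 : ℕ)) ^ (1 - P) * E ^ (1 - P) := by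
          rw [← Real.mul_rpow (by positivity) hE0]
          gcongr
      _ ≤ 2 * (D + 1 : ℕ) * E ^ (1 - P) := by
          gcongr
          refine Real.rpow_le_self_of_one_le ?_ (by linarith)
          push_cast
          linarith [(Nat.cast_nonneg D : (0 : ℝ) ≤ D)]
      _ = 2 * (D + 1 : ℕ) * boxNorm n r ρ v ^ 2 := by
          rw [← Real.rpow_two (boxNorm _ _ _ _), boxNorm_rpow hv0, hr, div_div_cancel₀ two_ne_zero]
  have hc : (1 : ℝ) ≤ ((D + 1 : ℕ) + 1) * 5 ^ (D + 1) :=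
    one_le_mul_of_one_le_of_one_le (le_add_of_nonneg_left (Nat.cast_nonneg _))
      (one_le_pow₀ (by norm_num))
  refine (sum_mul_rpow_add_rpow_div_le hg (fun e he => hωg e (bondsIn_mono (box_mono hρ) he))
    hW hP hP1.le (t := r) (div_mul_cancel₀ _ hP'.ne') (by positivity) hv0).trans ?_
  gcongr
  exact rpow_le_of_le_one_le (div_nonneg (sum_nonneg fun e _ => hg e) (by positivity))
    (sum_majorant_div_le hn hρ hg hgsum) hc hP hP1.le

theorem AvgBounded.energy_le_boxNorm_sq (hω : ∀ e, 0 ≤ ω e)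
    (hW : AvgBounded (bondsIn (box (D + 1) (2 * n))) P Wp ω) (hP : 0 ≤ P) (hP1 : P < 1)
    (hv : IsSubsolution ω v) (hv0 : ∀ x, 0 ≤ v x) (hn : 1 ≤ n) (hσρ : σ < ρ) (hρ : ρ ≤ 2 * n) :
    energy n σ ω v ≤ 16 * ((D + 1 : ℕ) + 1) * 5 ^ (D + 1) * (2 * (D + 1 : ℕ)) * Wp *
      (n / (ρ - σ : ℕ) * boxNorm n (2 / (1 - P)) ρ v) ^ 2 := by
  obtain ⟨hW0, g, hg, hωg, hgsum⟩ := hW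
  have hl : (0 : ℝ) < (ρ - σ : ℕ) := by exact_mod_cast Nat.sub_pos_of_lt hσρ
  have hcaccioppoli : ((ρ - σ : ℕ) : ℝ) ^ 2 * ∑ e ∈ bondsIn (box (D + 1) σ), ω e * grad v e ^ 2 ≤
      8 * ∑ e ∈ bondsIn (box (D + 1) ρ),
        ω e * (v e.lower ^ (2 : ℝ) + v e.upper ^ (2 : ℝ)) := by
    have h := hv.card_sq_mul_energy_le hω hv0 le_rfl subset_rfl (σ := σ) (ρ := ρ)
    simp only [Real.rpow_one, Nat.card_Ico, one_pow, mul_one] at h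
    refine h.trans ?_
    gcongr
    exact sum_sum_layer_le _ fun e => mul_nonneg (hω e)
      (add_nonneg (Real.rpow_nonneg (hv0 _) _) (Real.rpow_nonneg (hv0 _) _))
  calc energy n σ ω v
      = (n / (ρ - σ : ℕ)) ^ 2 * (((ρ - σ : ℕ) : ℝ) ^ 2 *
          (∑ e ∈ bondsIn (box (D + 1) σ), ω e * grad v e ^ 2) / (n : ℝ) ^ (D + 1)) := by
        simp only [energy, mul_pow, mul_left_comm _ ((n : ℝ) ^ 2), ← mul_sum]
        field_simp
    _ ≤ (n / (ρ - σ : ℕ)) ^ 2 * (8 * (∑ e ∈ bondsIn (box (D + 1) ρ),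
          ω e * (v e.lower ^ (2 : ℝ) + v e.upper ^ (2 : ℝ))) / (n : ℝ) ^ (D + 1)) := by
        gcongr
    _ ≤ (n / (ρ - σ : ℕ)) ^ 2 * (8 * (2 * Wp * (((D + 1 : ℕ) + 1) * 5 ^ (D + 1) *
          (2 * (D + 1 : ℕ) * boxNorm n (2 / (1 - P)) ρ v ^ 2)))) := by
        rw [mul_div_assoc]
        gcongr
        exact sum_mul_sq_add_sq_div_le_boxNorm_sq hg hωg hgsum hW0 hP hP1 hn hρ hv0
    _ = _ := by ring

theorem MoserExponents.exists_initial_step (h : MoserExponents D P Q s δ) : ∃ K : ℝ, 1 ≤ K ∧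
    ∀ {n σ ρ : ℕ}, 1 ≤ n → n ≤ σ → σ < ρ → ρ ≤ 2 * n →
    ∀ {Wp Wq : ℝ} {ω : Bond (D + 1) → ℝ} {v : Vertex (D + 1) → ℝ}, (∀ e, 0 < ω e) →
    AvgBounded (bondsIn (box (D + 1) (2 * n))) P Wp ω →
    AvgBounded (bondsIn (box (D + 1) (2 * n))) Q Wq (fun e => (ω e)⁻¹) → 1 ≤ Wp * Wq →
    IsSubsolution ω v → (∀ x, 0 ≤ v x) →
    sobolevNorm n s σ v ≤
      K * √(Wp * Wq) * (n / (ρ - σ : ℕ)) * boxNorm n (2 / (1 - P)) ρ v := by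
  set c : ℝ := ((D + 1 : ℕ) + 1) * 5 ^ (D + 1) + 1
  have hc : 1 ≤ c := le_add_of_nonneg_left (by positivity)
  set E : ℝ := 16 * ((D + 1 : ℕ) + 1) * 5 ^ (D + 1) * (2 * (D + 1 : ℕ))
  have hE : 0 ≤ E := by positivity
  set K : ℝ := E + 5 ^ (D + 1)
  have hK : 5 ^ (D + 1) ≤ K := le_add_of_nonneg_left hE
  have hK1 : 1 ≤ K := (one_le_pow₀ (by norm_num)).trans hK
  have hP := h.P_lt_one
  have hs := h.s_pos
  have hr : 2 ≤ 2 / (1 - P) := by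
    rw [le_div_iff₀ (by linarith)]
    linarith [h.P_nonneg]
  refine ⟨c * K, one_le_mul_of_one_le_of_one_le hc hK1,
    fun {n σ ρ} hn hnσ hσρ hρ {Wp Wq ω v} hω hWp hWq hW hv hv0 => ?_⟩
  set l : ℝ := n / (ρ - σ : ℕ)
  have hl : 1 ≤ l := one_le_div_sub hnσ hσρ hρ
  set N := boxNorm n (2 / (1 - P)) ρ v
  have hN : 0 ≤ N := boxNorm_nonneg hv0
  have hWp0 := hWp.nonneg
  have henergy : energy n σ ω v ≤ Wp * (K * l * N) ^ 2 :=
    calc energy n σ ω v ≤ E * Wp * (l * N) ^ 2 :=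
          hWp.energy_le_boxNorm_sq (fun e => (hω e).le) h.P_nonneg hP hv hv0 hn hσρ hρ
      _ ≤ K ^ 2 * Wp * (l * N) ^ 2 := by
          gcongr
          exact (le_add_of_nonneg_right (by positivity)).trans (le_self_pow₀ hK1 two_ne_zero)
      _ = Wp * (K * l * N) ^ 2 := by ring
  have hsum : (∑ x ∈ box (D + 1) σ, v x ^ s) / (n : ℝ) ^ (D + 1) ≤ (K * l * N) ^ s :=
    calc (∑ x ∈ box (D + 1) σ, v x ^ s) / (n : ℝ) ^ (D + 1)
        ≤ 5 ^ (D + 1) * N ^ s := sum_rpow_div_le_boxNorm_rpow hn hσρ.le hρ hv0 hs.le (by linarith)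
          (h.s_le_two.trans hr)
      _ ≤ (K * l) ^ s * N ^ s := by
          gcongr
          calc (5 : ℝ) ^ (D + 1) ≤ K := hK
            _ ≤ K * l := le_mul_of_one_le_right (by positivity) hl
            _ ≤ (K * l) ^ s :=
              Real.self_le_rpow_of_one_le (one_le_mul_of_one_le_of_one_le hK1 hl) h.one_le_s
      _ = (K * l * N) ^ s := (Real.mul_rpow (by positivity) hN).symm
  calc sobolevNorm n s σ v ≤ c * √(Wp * Wq) * (K * l * N) :=
        hWq.sobolevNorm_le hω h.Q_nonneg h.Q_lt_one.le h.s_mul hn (by lia) hv0 (by positivity) hW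
          henergy hsum
    _ = _ := by ring

end InitialStep

section GeometricIteration

variable {A B θ δ : ℝ}

theorem sum_range_pow_le (hθ : 0 ≤ θ) (hθ1 : θ < 1) (J : ℕ) :
    ∑ j ∈ range J, θ ^ j ≤ 1 / (1 - θ) := by
  rw [one_div]
  exact sum_le_hasSum _ (fun j _ => by positivity) (hasSum_geometric_of_lt_one hθ hθ1)

theorem sum_range_mul_pow_le (hθ : 0 ≤ θ) (hθ1 : θ < 1) (J : ℕ) :
    ∑ j ∈ range J, (j : ℝ) * θ ^ j ≤ θ / (1 - θ) ^ 2 :=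
  sum_le_hasSum _ (fun j _ => by positivity)
    (hasSum_coe_mul_geometric_of_norm_lt_one (by rwa [Real.norm_of_nonneg hθ]))

theorem mul_pow_rpow_pow_le (hA : 1 ≤ A) (hB : 1 ≤ B) (hθ : 0 ≤ θ) (hθ1 : θ < 1) (j : ℕ) :
    (A * B ^ j) ^ (θ ^ j) ≤ A * B ^ (θ / (1 - θ) ^ 2) := by
  have hterm : (j : ℝ) * θ ^ j ≤ θ / (1 - θ) ^ 2 :=
    (single_le_sum (f := fun j : ℕ => (j : ℝ) * θ ^ j) (fun i _ => by positivity)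
      (self_mem_range_succ j)).trans (sum_range_mul_pow_le hθ hθ1 _)
  rw [Real.mul_rpow (by positivity) (by positivity), ← Real.rpow_natCast_mul (by positivity)]
  gcongr
  exact Real.rpow_le_self_of_one_le hA (pow_le_one₀ hθ hθ1.le)

theorem prod_mul_pow_rpow_pow_le (hA : 1 ≤ A) (hB : 1 ≤ B) (hθ : 0 ≤ θ) (hθ1 : θ < 1) (J : ℕ) :
    ∏ j ∈ range J, (A * B ^ j) ^ (θ ^ j) ≤ A ^ (1 / (1 - θ)) * B ^ (θ / (1 - θ) ^ 2) := by
  have hA0 : 0 < A := by positivity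
  have hB0 : 0 < B := by positivity
  calc ∏ j ∈ range J, (A * B ^ j) ^ (θ ^ j)
      = A ^ (∑ j ∈ range J, θ ^ j) * B ^ (∑ j ∈ range J, (j : ℝ) * θ ^ j) := by
        rw [Real.rpow_sum_of_pos hA0, Real.rpow_sum_of_pos hB0, ← prod_mul_distrib]
        refine prod_congr rfl fun j _ => ?_
        rw [Real.mul_rpow (by positivity) (by positivity), ← Real.rpow_natCast_mul (by positivity)]
    _ ≤ _ := by
        gcongr
        · exact sum_range_pow_le hθ hθ1 J
        · exact sum_range_mul_pow_le hθ hθ1 J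

theorem rpow_pow_le_of_le_mul_rpow {x : ℕ → ℝ} {J : ℕ} (hA : 1 ≤ A) (hB : 1 ≤ B) (hδ : 0 < δ)
    (hx : ∀ j, 0 ≤ x j) (hstep : ∀ j < J, x (j + 1) ≤ A * B ^ j * x j ^ (1 + δ)) :
    x J ^ ((1 + δ)⁻¹ ^ J) ≤ A ^ (1 / δ) * B ^ (1 / δ ^ 2) * x 0 := by
  set θ := (1 + δ)⁻¹
  have hθ : 0 < θ := by positivity
  have hθ1 : θ < 1 := inv_lt_one_of_one_lt₀ (by linarith)
  have hprod : ∀ j ≤ J, x j ^ (θ ^ j) ≤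
      (∏ i ∈ range j, (A ^ θ * (B ^ θ) ^ i) ^ (θ ^ i)) * x 0 := by
    intro j hj
    induction j with
    | zero => simp
    | succ j ih =>
      have hxj := hx j
      calc x (j + 1) ^ (θ ^ (j + 1)) ≤ (A * B ^ j * x j ^ (1 + δ)) ^ (θ ^ (j + 1)) :=
            Real.rpow_le_rpow (hx _) (hstep j hj) (by positivity)
        _ = ((A * B ^ j * x j ^ (1 + δ)) ^ θ) ^ (θ ^ j) := by
            rw [pow_succ', Real.rpow_mul (by positivity)]
        _ = (A ^ θ * (B ^ θ) ^ j) ^ (θ ^ j) * x j ^ (θ ^ j) := by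
            rw [Real.mul_rpow (by positivity) (Real.rpow_nonneg hxj _), ← Real.rpow_mul hxj,
              mul_inv_cancel₀ (by positivity), Real.rpow_one, Real.mul_rpow (by positivity) hxj,
              Real.mul_rpow (by positivity) (by positivity), Real.rpow_pow_comm (by positivity)]
        _ ≤ (A ^ θ * (B ^ θ) ^ j) ^ (θ ^ j) *
              ((∏ i ∈ range j, (A ^ θ * (B ^ θ) ^ i) ^ (θ ^ i)) * x 0) := by
            gcongr
            exact ih (by lia)
        _ = _ := by
            rw [prod_range_succ]
            ring
  calc x J ^ (θ ^ J) ≤ ((A ^ θ) ^ (1 / (1 - θ)) * (B ^ θ) ^ (θ / (1 - θ) ^ 2)) * x 0 :=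
        (hprod J le_rfl).trans (mul_le_mul_of_nonneg_right (prod_mul_pow_rpow_pow_le
          (Real.one_le_rpow hA hθ.le) (Real.one_le_rpow hB hθ.le) hθ.le hθ1 J) (hx 0))
    _ = _ := by
        have hδθ : 1 - θ = δ * θ := by
          linear_combination - mul_inv_cancel₀ (by positivity : 1 + δ ≠ 0)
        rw [← Real.rpow_mul (by positivity), ← Real.rpow_mul (by positivity), hδθ]
        congr 3 <;> field_simp

end GeometricIteration

section SupBound

variable {D n σ ρ : ℕ} {P Q s δ : ℝ}

theorem le_two_pow_mul_div_sub_div {i l : ℕ} (h : 2 ^ i ≤ l) :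
    l ≤ 2 ^ (i + 2) * (l / 2 ^ i - l / 2 ^ (i + 1)) := by
  have h1 : 1 ≤ l / 2 ^ i := (Nat.one_le_div_iff (by positivity)).2 h
  have h2 : l < 2 ^ i * (l / 2 ^ i + 1) := Nat.lt_mul_div_succ l (by positivity)
  rw [pow_succ 2 i, ← Nat.div_div_eq_div_mul]
  calc l ≤ 2 ^ i * (l / 2 ^ i + 1) := h2.le
    _ ≤ 2 ^ i * (4 * (l / 2 ^ i - l / 2 ^ i / 2)) := by
        gcongr
        lia
    _ = _ := by ring

theorem div_div_sub_div_le {i l : ℕ} (n : ℕ) (hl : 0 < l) (h : 2 ^ i ≤ l) :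
    (n : ℝ) / (l / 2 ^ i - l / 2 ^ (i + 1) : ℕ) ≤ 4 * 2 ^ i * (n / l) := by
  have hcast : (l : ℝ) ≤ 2 ^ (i + 2) * (l / 2 ^ i - l / 2 ^ (i + 1) : ℕ) := by
    exact_mod_cast le_two_pow_mul_div_sub_div h
  have hl' : (0 : ℝ) < l := by exact_mod_cast hl
  have hgap : (0 : ℝ) < (l / 2 ^ i - l / 2 ^ (i + 1) : ℕ) :=
    pos_of_mul_pos_right (hl'.trans_le hcast) (by positivity)
  rw [← mul_div_assoc, div_le_div_iff₀ hgap hl']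
  calc (n : ℝ) * l ≤ n * (2 ^ (i + 2) * (l / 2 ^ i - l / 2 ^ (i + 1) : ℕ)) := by gcongr
    _ = _ := by ring

theorem le_mul_sobolevNorm_rpow {d : ℕ} {v : Vertex d → ℝ} {a : ℝ} {x : Vertex d} (hs : 1 ≤ s)
    (hn : 1 ≤ n) (ha : 0 < a) (hv0 : ∀ x, 0 ≤ v x) (hx : x ∈ box d σ) :
    v x ≤ ((n : ℝ) ^ d * sobolevNorm n s σ fun x => v x ^ a) ^ a⁻¹ := by
  have hw (x) : 0 ≤ v x ^ a := Real.rpow_nonneg (hv0 x) a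
  have hnd : (1 : ℝ) ≤ (n : ℝ) ^ d := one_le_pow₀ (by exact_mod_cast hn)
  have hs0 : 0 < s := by linarith
  have hX : 0 ≤ sobolevSum n s (box d σ) fun x => v x ^ a := sobolevSum_nonneg hw
  rw [Real.le_rpow_inv_iff_of_pos (hv0 x) (mul_nonneg (by positivity) (sobolevNorm_nonneg hw)) ha]
  calc v x ^ a ≤ (sobolevSum n s (box d σ) fun x => v x ^ a) ^ (1 / s) := by
        rw [one_div, Real.le_rpow_inv_iff_of_pos (hw x) hX hs0]
        exact (single_le_sum (fun y _ => Real.rpow_nonneg (hw y) s) hx).trans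
          sum_rpow_le_sobolevSum
    _ = ((n : ℝ) ^ d) ^ (1 / s) * sobolevNorm n s σ fun x => v x ^ a := by
        rw [sobolevNorm, ← Real.mul_rpow (by positivity) (by positivity),
          mul_div_cancel₀ _ (by positivity)]
    _ ≤ (n : ℝ) ^ d * sobolevNorm n s σ fun x => v x ^ a := by
        have := sobolevNorm_nonneg (n := n) (s := s) (m := σ) hw
        gcongr
        exact Real.rpow_le_self_of_one_le hnd ((div_le_one hs0).2 hs)

end SupBound

section Iteration

variable {D : ℕ} {P Q s δ : ℝ}

theorem MoserExponents.exists_dyadic_step (h : MoserExponents D P Q s δ) : ∃ K : ℝ, 1 ≤ K ∧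
    ∀ {n σ ρ j : ℕ}, 1 ≤ n → n ≤ σ → σ < ρ → ρ ≤ 2 * n → 2 ^ (j + 1) ≤ ρ - σ →
    ∀ {Wp Wq : ℝ} {ω : Bond (D + 1) → ℝ} {v : Vertex (D + 1) → ℝ}, (∀ e, 0 < ω e) →
    AvgBounded (bondsIn (box (D + 1) (2 * n))) P Wp ω →
    AvgBounded (bondsIn (box (D + 1) (2 * n))) Q Wq (fun e => (ω e)⁻¹) → 1 ≤ Wp * Wq →
    IsSubsolution ω v → (∀ x, 0 ≤ v x) →
    sobolevNorm n s (σ + (ρ - σ) / 2 ^ (j + 2)) (fun x => v x ^ ((1 + δ) ^ (j + 1))) ≤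
      K * (√(Wp * Wq) * (n / (ρ - σ : ℕ)) ^ 2) * 8 ^ j *
        sobolevNorm n s (σ + (ρ - σ) / 2 ^ (j + 1)) (fun x => v x ^ ((1 + δ) ^ j)) ^ (1 + δ) := by
  have hδ := h.δ_pos
  obtain ⟨K, hK, hmoser⟩ := h.exists_moser_step
  refine ⟨64 * K, by linarith, ?_⟩
  intro n σ ρ j hn hnσ hσρ hρ hj Wp Wq ω v hω hωp hωq hW hsub hv0
  have hl0 : 0 < ρ - σ := Nat.sub_pos_of_lt hσρ
  have hgap : 0 < (ρ - σ) / 2 ^ (j + 1) - (ρ - σ) / 2 ^ (j + 2) :=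
    pos_of_mul_pos_right (hl0.trans_le (le_two_pow_mul_div_sub_div hj)) (by positivity)
  have hdiv : (ρ - σ) / 2 ^ (j + 1) ≤ ρ - σ := Nat.div_le_self _ _
  have hgain := hmoser (σ := σ + (ρ - σ) / 2 ^ (j + 2)) (ρ := σ + (ρ - σ) / 2 ^ (j + 1)) hn (by lia)
    (by lia) (by lia) hω hωp hωq hW hsub hv0 (one_le_pow₀ (by linarith : 1 ≤ 1 + δ) (n := j))
  rw [← pow_succ', Nat.add_sub_add_left] at hgain
  have hN := Real.rpow_nonneg (sobolevNorm_nonneg (n := n) (s := s)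
    (m := σ + (ρ - σ) / 2 ^ (j + 1)) fun x => Real.rpow_nonneg (hv0 x) ((1 + δ) ^ j)) (1 + δ)
  refine hgain.trans (mul_le_mul_of_nonneg_right ?_ hN)
  calc K * √(Wp * Wq) *
        ((1 + δ) ^ j * (n / ((ρ - σ) / 2 ^ (j + 1) - (ρ - σ) / 2 ^ (j + 2) : ℕ)) ^ 2)
      ≤ K * √(Wp * Wq) * (2 ^ j * (4 * 2 ^ (j + 1) * (n / (ρ - σ : ℕ))) ^ 2) := by
        gcongr
        · linarith [h.δ_lt_one]
        · exact div_div_sub_div_le n hl0 hj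
    _ = _ := by
        rw [show (8 : ℝ) ^ j = 2 ^ j * 2 ^ j * 2 ^ j by rw [← mul_pow, ← mul_pow]; norm_num]
        ring

theorem MoserExponents.exists_iterated_step (h : MoserExponents D P Q s δ) : ∃ K : ℝ, 1 ≤ K ∧
    ∀ {n σ ρ J : ℕ}, 1 ≤ n → n ≤ σ → σ < ρ → ρ ≤ 2 * n → 2 ^ J ≤ ρ - σ →
    ∀ {Wp Wq : ℝ} {ω : Bond (D + 1) → ℝ} {v : Vertex (D + 1) → ℝ}, (∀ e, 0 < ω e) →
    AvgBounded (bondsIn (box (D + 1) (2 * n))) P Wp ω →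
    AvgBounded (bondsIn (box (D + 1) (2 * n))) Q Wq (fun e => (ω e)⁻¹) → 1 ≤ Wp * Wq →
    IsSubsolution ω v → (∀ x, 0 ≤ v x) →
    sobolevNorm n s (σ + (ρ - σ) / 2 ^ (J + 1)) (fun x => v x ^ ((1 + δ) ^ J)) ^
        ((1 + δ)⁻¹ ^ J) ≤
      K * (√(Wp * Wq) * (n / (ρ - σ : ℕ)) ^ 2) ^ (1 / δ) *
        sobolevNorm n s (σ + (ρ - σ) / 2) v := by
  have hδ := h.δ_pos
  obtain ⟨K, hK, hstep⟩ := h.exists_dyadic_step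
  refine ⟨K ^ (1 / δ) * 8 ^ (1 / δ ^ 2), one_le_mul_of_one_le_of_one_le
    (Real.one_le_rpow hK (by positivity)) (Real.one_le_rpow (by norm_num) (by positivity)), ?_⟩
  intro n σ ρ J hn hnσ hσρ hρ hJ Wp Wq ω v hω hωp hωq hW hsub hv0
  have hlam := one_le_div_sub hnσ hσρ hρ
  set lam : ℝ := n / (ρ - σ : ℕ)
  set x : ℕ → ℝ := fun j =>
    sobolevNorm n s (σ + (ρ - σ) / 2 ^ (j + 1)) fun y => v y ^ ((1 + δ) ^ j) with hx
  have hx0 (j : ℕ) : 0 ≤ x j := sobolevNorm_nonneg fun y => Real.rpow_nonneg (hv0 y) _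
  have hA : 1 ≤ K * (√(Wp * Wq) * lam ^ 2) := one_le_mul_of_one_le_of_one_le hK
    (one_le_mul_of_one_le_of_one_le (Real.one_le_sqrt.2 hW) (one_le_pow₀ hlam))
  calc x J ^ ((1 + δ)⁻¹ ^ J)
      ≤ (K * (√(Wp * Wq) * lam ^ 2)) ^ (1 / δ) * 8 ^ (1 / δ ^ 2) * x 0 :=
        rpow_pow_le_of_le_mul_rpow hA (by norm_num) hδ hx0 fun j hj =>
          hstep hn hnσ hσρ hρ ((Nat.pow_le_pow_right two_pos hj).trans hJ) hω hωp hωq hW hsub hv0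
    _ = _ := by
        rw [Real.mul_rpow (by positivity) (by positivity), hx]
        simp only [pow_zero, Real.rpow_one, zero_add, pow_one]
        ring

theorem pow_rpow_pow_le_of_le_mul_two_pow {J : ℕ} {N lam θ : ℝ} (d : ℕ) (hθ : 0 ≤ θ)
    (hθ1 : θ < 1) (hN : 0 ≤ N) (hlam : 1 ≤ lam) (h : N ≤ lam * 2 ^ J) :
    (N ^ d) ^ (θ ^ J) ≤ lam ^ d * ((2 : ℝ) ^ d) ^ (θ / (1 - θ) ^ 2) :=
  calc (N ^ d) ^ (θ ^ J) ≤ (lam ^ d * (2 ^ d) ^ J) ^ (θ ^ J) := by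
        gcongr
        calc N ^ d ≤ (lam * 2 ^ J) ^ d := by gcongr
          _ = lam ^ d * (2 ^ d) ^ J := by ring
    _ ≤ _ := mul_pow_rpow_pow_le (one_le_pow₀ hlam) (one_le_pow₀ one_le_two) hθ hθ1 J

theorem sqrt_mul_sq_rpow_mul_sqrt_mul {W lam : ℝ} (hW : 0 < W) (hlam : 0 < lam) (hδ : 0 < δ) :
    (√W * lam ^ 2) ^ (1 / δ) * (√W * lam) =
      W ^ ((δ + 1) / (2 * δ)) * lam ^ (2 / δ + 1) := by
  have hexp : 1 / 2 * (1 / δ) + 1 / 2 = (δ + 1) / (2 * δ) := by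
    field_simp
    ring
  rw [Real.mul_rpow (by positivity) (by positivity), Real.sqrt_eq_rpow,
    ← Real.rpow_mul hW.le, ← hexp, Real.rpow_add hW, Real.rpow_add hlam, Real.rpow_one,
    ← Real.rpow_natCast_mul hlam.le, Nat.cast_two, mul_one_div (2 : ℝ)]
  ring

theorem MoserExponents.exists_sobolevNorm_log_le (h : MoserExponents D P Q s δ) : ∃ K : ℝ, 1 ≤ K ∧
    ∀ {n σ ρ : ℕ}, 1 ≤ n → n ≤ σ → σ < ρ → ρ ≤ 2 * n →
    ∀ {Wp Wq : ℝ} {ω : Bond (D + 1) → ℝ} {v : Vertex (D + 1) → ℝ}, (∀ e, 0 < ω e) →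
    AvgBounded (bondsIn (box (D + 1) (2 * n))) P Wp ω →
    AvgBounded (bondsIn (box (D + 1) (2 * n))) Q Wq (fun e => (ω e)⁻¹) → 1 ≤ Wp * Wq →
    IsSubsolution ω v → (∀ x, 0 ≤ v x) →
    sobolevNorm n s σ (fun x => v x ^ ((1 + δ) ^ Nat.log 2 (ρ - σ))) ^
        ((1 + δ)⁻¹ ^ Nat.log 2 (ρ - σ)) ≤
      K * (Wp * Wq) ^ ((δ + 1) / (2 * δ)) * (n / (ρ - σ : ℕ)) ^ (2 / δ + 1) *
        boxNorm n (2 / (1 - P)) ρ v := by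
  obtain ⟨K₀, hK₀, hinitial⟩ := h.exists_initial_step
  obtain ⟨K₁, hK₁, hiterated⟩ := h.exists_iterated_step
  refine ⟨K₁ * (4 * K₀), one_le_mul_of_one_le_of_one_le hK₁ (by linarith), ?_⟩
  intro n σ ρ hn hnσ hσρ hρ Wp Wq ω v hω hωp hωq hW hsub hv0
  have hlam := one_le_div_sub hnσ hσρ hρ
  have hl0 : 0 < ρ - σ := Nat.sub_pos_of_lt hσρ
  have hgap := div_div_sub_div_le (i := 0) n hl0 (by rwa [pow_zero])
  have hinit := hinitial (σ := σ + (ρ - σ) / 2) hn (by lia) (by lia) hρ hω hωp hωq hW hsub hv0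
  rw [show ρ - (σ + (ρ - σ) / 2) = (ρ - σ) / 2 ^ 0 - (ρ - σ) / 2 ^ (0 + 1) by
    simp only [pow_zero, zero_add, pow_one, Nat.div_one]; lia] at hinit
  have hiter := hiterated (J := Nat.log 2 (ρ - σ)) hn hnσ hσρ hρ
    (Nat.pow_log_le_self 2 hl0.ne') hω hωp hωq hW hsub hv0
  rw [Nat.div_eq_of_lt (Nat.lt_pow_succ_log_self one_lt_two _), add_zero] at hiter
  have hN := boxNorm_nonneg (n := n) (r := 2 / (1 - P)) (m := ρ) hv0
  set lam : ℝ := n / (ρ - σ : ℕ)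
  calc _ ≤ K₁ * (√(Wp * Wq) * lam ^ 2) ^ (1 / δ) *
        (K₀ * √(Wp * Wq) * (4 * 2 ^ 0 * lam) * boxNorm n (2 / (1 - P)) ρ v) := by
        refine hiter.trans ?_
        gcongr
        refine hinit.trans ?_
        gcongr
    _ = K₁ * (4 * K₀) * ((√(Wp * Wq) * lam ^ 2) ^ (1 / δ) * (√(Wp * Wq) * lam)) *
          boxNorm n (2 / (1 - P)) ρ v := by ring
    _ = _ := by
        rw [sqrt_mul_sq_rpow_mul_sqrt_mul (by linarith) (by linarith) h.δ_pos]
        ring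

theorem MoserExponents.exists_sup_le (h : MoserExponents D P Q s δ) : ∃ K b : ℝ, 1 ≤ K ∧ 0 ≤ b ∧
    ∀ {n σ ρ : ℕ}, 1 ≤ n → n ≤ σ → σ < ρ → ρ ≤ 2 * n →
    ∀ {Wp Wq : ℝ} {ω : Bond (D + 1) → ℝ} {v : Vertex (D + 1) → ℝ}, (∀ e, 0 < ω e) →
    AvgBounded (bondsIn (box (D + 1) (2 * n))) P Wp ω →
    AvgBounded (bondsIn (box (D + 1) (2 * n))) Q Wq (fun e => (ω e)⁻¹) → 1 ≤ Wp * Wq →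
    IsSubsolution ω v → (∀ x, 0 ≤ v x) → ∀ x ∈ box (D + 1) σ,
    v x ≤ K * (Wp * Wq) ^ ((δ + 1) / (2 * δ)) * (n / (ρ - σ : ℕ)) ^ b *
      boxNorm n (2 / (1 - P)) ρ v := by
  have hδ := h.δ_pos
  obtain ⟨K, hK, hsobolev⟩ := h.exists_sobolevNorm_log_le
  set d := D + 1
  set c : ℝ := ((2 : ℝ) ^ d) ^ ((1 + δ)⁻¹ / (1 - (1 + δ)⁻¹) ^ 2)
  have hc : 1 ≤ c := Real.one_le_rpow (one_le_pow₀ one_le_two) (by positivity)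
  refine ⟨c * 2 ^ d * K, d + (2 / δ + 1), one_le_mul_of_one_le_of_one_le
    (one_le_mul_of_one_le_of_one_le hc (one_le_pow₀ one_le_two)) hK, by positivity, ?_⟩
  intro n σ ρ hn hnσ hσρ hρ Wp Wq ω v hω hωp hωq hW hsub hv0 x hx
  have hlam := one_le_div_sub hnσ hσρ hρ
  have hl0 : 0 < ρ - σ := Nat.sub_pos_of_lt hσρ
  have hlog := Nat.lt_pow_succ_log_self one_lt_two (ρ - σ)
  have hnorm := hsobolev hn hnσ hσρ hρ hω hωp hωq hW hsub hv0
  set J := Nat.log 2 (ρ - σ)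
  set lam : ℝ := n / (ρ - σ : ℕ)
  have hn_le : (n : ℝ) ≤ 2 * lam * 2 ^ J :=
    calc (n : ℝ) = lam * (ρ - σ : ℕ) := (div_mul_cancel₀ _ (by exact_mod_cast hl0.ne')).symm
      _ ≤ lam * 2 ^ (J + 1) := by
          gcongr
          exact_mod_cast hlog.le
      _ = 2 * lam * 2 ^ J := by ring
  have hX : 0 ≤ sobolevNorm n s σ fun y => v y ^ ((1 + δ) ^ J) :=
    sobolevNorm_nonneg fun y => Real.rpow_nonneg (hv0 y) _
  calc v x ≤ ((n : ℝ) ^ d * sobolevNorm n s σ fun y => v y ^ ((1 + δ) ^ J)) ^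
          ((1 + δ)⁻¹ ^ J) := by
        rw [inv_pow]
        exact le_mul_sobolevNorm_rpow h.one_le_s hn (by positivity) hv0 hx
    _ = ((n : ℝ) ^ d) ^ ((1 + δ)⁻¹ ^ J) *
          (sobolevNorm n s σ fun y => v y ^ ((1 + δ) ^ J)) ^ ((1 + δ)⁻¹ ^ J) :=
        Real.mul_rpow (by positivity) hX
    _ ≤ (2 * lam) ^ d * c * (K * (Wp * Wq) ^ ((δ + 1) / (2 * δ)) * lam ^ (2 / δ + 1) *
          boxNorm n (2 / (1 - P)) ρ v) := by
        gcongr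
        exact pow_rpow_pow_le_of_le_mul_two_pow d (by positivity)
          (inv_lt_one_of_one_lt₀ (by linarith)) (by positivity) (by linarith) hn_le
    _ = _ := by
        rw [Real.rpow_add (by linarith : 0 < lam) d, Real.rpow_natCast]
        ring

end Iteration

section Interpolation

variable {d n m ρ : ℕ} {v : Vertex d → ℝ} {r γ : ℝ}

theorem zero_mem_box (d m : ℕ) : (0 : Vertex d) ∈ box d m := mem_box.2 fun i => by simp

theorem le_mul_boxNorm (hn : 1 ≤ n) (hv0 : ∀ x, 0 ≤ v x) (hr : 0 < r) {x : Vertex d}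
    (hx : x ∈ box d m) : v x ≤ ((n : ℝ) ^ d) ^ (1 / r) * boxNorm n r m v := by
  have hsum : 0 ≤ ∑ y ∈ box d m, v y ^ r := sum_nonneg fun y _ => Real.rpow_nonneg (hv0 y) r
  rw [boxNorm, ← Real.mul_rpow (by positivity) (by positivity), mul_div_cancel₀ _ (by positivity),
    one_div, Real.le_rpow_inv_iff_of_pos (hv0 x) hsum hr]
  exact single_le_sum (f := fun y => v y ^ r) (fun y _ => Real.rpow_nonneg (hv0 y) r) hx

/-- The maximum of a function over the box `B(m)`. -/
def boxSup (m : ℕ) (v : Vertex d → ℝ) : ℝ := (box d m).sup' ⟨0, zero_mem_box d m⟩ v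

theorem le_boxSup {x : Vertex d} (hx : x ∈ box d m) : v x ≤ boxSup m v := le_sup' v hx

theorem boxSup_nonneg (hv0 : ∀ x, 0 ≤ v x) : 0 ≤ boxSup m v :=
  (hv0 0).trans (le_boxSup (zero_mem_box d m))

theorem boxSup_rpow_pow_le {J : ℕ} (hn : 1 ≤ n) (hmρ : m ≤ ρ) (hJ : (n : ℝ) ≤ 2 * 2 ^ J)
    (hv0 : ∀ x, 0 ≤ v x) (hr : 0 < r) (hγ : 0 < γ) (hγ1 : γ ≤ 1) :
    boxSup m v ^ ((1 - γ) ^ J) ≤ (2 ^ d * ((2 : ℝ) ^ d) ^ ((1 - γ) / γ ^ 2)) ^ (1 / r) *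
      boxNorm n r ρ v ^ ((1 - γ) ^ J) := by
  have h1γ : 0 ≤ 1 - γ := by linarith
  have hN : 0 ≤ boxNorm n r ρ v := boxNorm_nonneg hv0
  calc boxSup m v ^ ((1 - γ) ^ J)
      ≤ (((n : ℝ) ^ d) ^ (1 / r) * boxNorm n r ρ v) ^ ((1 - γ) ^ J) :=
        Real.rpow_le_rpow (boxSup_nonneg hv0)
          (sup'_le _ _ fun y hy => le_mul_boxNorm hn hv0 hr (box_mono hmρ hy)) (by positivity)
    _ = (((n : ℝ) ^ d) ^ ((1 - γ) ^ J)) ^ (1 / r) * boxNorm n r ρ v ^ ((1 - γ) ^ J) := by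
        rw [Real.mul_rpow (by positivity) hN, ← Real.rpow_mul (by positivity), mul_comm (1 / r),
          Real.rpow_mul (by positivity)]
    _ ≤ _ := by
        gcongr
        have := pow_rpow_pow_le_of_le_mul_two_pow (J := J) d h1γ (by linarith)
          (Nat.cast_nonneg n) one_le_two hJ
        rwa [sub_sub_cancel] at this

theorem boxNorm_le_mul_boxSup_rpow (hmρ : m ≤ ρ) (hv0 : ∀ x, 0 ≤ v x)
    (hr : 0 < r) (hγ : 0 < γ) (hγ1 : γ ≤ 1) :
    boxNorm n r m v ≤ boxNorm n (r * γ) ρ v ^ γ * boxSup m v ^ (1 - γ) := by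
  set M := boxSup m v
  have hM0 : 0 ≤ M := boxSup_nonneg hv0
  have h1γ : 0 ≤ 1 - γ := by linarith
  have hpow (x) : 0 ≤ v x ^ (r * γ) := Real.rpow_nonneg (hv0 x) _
  have hsum : ∑ x ∈ box d m, v x ^ r ≤ M ^ ((1 - γ) * r) * ∑ x ∈ box d ρ, v x ^ (r * γ) :=
    calc ∑ x ∈ box d m, v x ^ r = ∑ x ∈ box d m, v x ^ ((1 - γ) * r) * v x ^ (r * γ) := by
          refine sum_congr rfl fun x _ => ?_
          rw [← Real.rpow_add_of_nonneg (hv0 x) (by positivity) (by positivity)]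
          ring_nf
      _ ≤ ∑ x ∈ box d m, M ^ ((1 - γ) * r) * v x ^ (r * γ) := by
          refine sum_le_sum fun x hx => mul_le_mul_of_nonneg_right ?_ (hpow x)
          exact Real.rpow_le_rpow (hv0 x) (le_boxSup hx) (by positivity)
      _ ≤ _ := by
          rw [← mul_sum]
          gcongr
          · exact fun x _ _ => hpow x
          · exact box_mono hmρ
  have hSm : 0 ≤ ∑ x ∈ box d m, v x ^ r := sum_nonneg fun x _ => Real.rpow_nonneg (hv0 x) r
  have hSρ : 0 ≤ ∑ x ∈ box d ρ, v x ^ (r * γ) := sum_nonneg fun x _ => hpow x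
  calc boxNorm n r m v
      ≤ (M ^ ((1 - γ) * r) * ((∑ x ∈ box d ρ, v x ^ (r * γ)) / (n : ℝ) ^ d)) ^ (1 / r) := by
        rw [boxNorm, ← mul_div_assoc]
        gcongr
    _ = _ := by
        rw [boxNorm_rpow hv0, Real.mul_rpow (by positivity) (by positivity),
          ← Real.rpow_mul hM0, mul_assoc, mul_one_div_cancel hr.ne', mul_one, mul_comm]
        congr 2
        field_simp

theorem le_of_le_mul_rpow_one_sub {A B N : ℝ} {M : ℕ → ℝ} (hA : 1 ≤ A) (hB : 1 ≤ B) (hN : 0 ≤ N)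
    (hγ : 0 < γ) (hγ1 : γ ≤ 1) (hM : ∀ j, 0 ≤ M j) {J : ℕ}
    (hstep : ∀ j < J, M j ≤ A * B ^ j * N ^ γ * M (j + 1) ^ (1 - γ)) :
    M 0 ≤ A ^ (1 / γ) * B ^ ((1 - γ) / γ ^ 2) * N ^ (1 - (1 - γ) ^ J) * M J ^ ((1 - γ) ^ J) := by
  obtain ⟨θ, rfl⟩ : ∃ θ, γ = 1 - θ := ⟨1 - γ, by ring⟩
  simp only [sub_sub_cancel] at hstep ⊢
  have hθ : 0 ≤ θ := by linarith
  have hθ1 : θ < 1 := by linarith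
  have hiter (j : ℕ) (hj : j ≤ J) :
      M 0 ≤ (∏ i ∈ range j, (A * B ^ i) ^ (θ ^ i)) * N ^ (1 - θ ^ j) * M j ^ (θ ^ j) := by
    induction j with
    | zero => simp
    | succ j ih =>
      have hθj : θ ^ j ≤ 1 := pow_le_one₀ hθ hθ1.le
      have hMj : M j ^ (θ ^ j) ≤
          (A * B ^ j) ^ (θ ^ j) * N ^ ((1 - θ) * θ ^ j) * M (j + 1) ^ (θ ^ (j + 1)) :=
        calc M j ^ (θ ^ j) ≤ (A * B ^ j * N ^ (1 - θ) * M (j + 1) ^ θ) ^ (θ ^ j) :=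
              Real.rpow_le_rpow (hM j) (hstep j hj) (by positivity)
          _ = _ := by
              rw [Real.mul_rpow (by positivity) (Real.rpow_nonneg (hM _) _),
                Real.mul_rpow (by positivity) (by positivity), ← Real.rpow_mul hN,
                ← Real.rpow_mul (hM _), ← pow_succ']
      calc M 0 ≤ (∏ i ∈ range j, (A * B ^ i) ^ (θ ^ i)) * N ^ (1 - θ ^ j) *
            ((A * B ^ j) ^ (θ ^ j) * N ^ ((1 - θ) * θ ^ j) * M (j + 1) ^ (θ ^ (j + 1))) :=
          (ih (by lia)).trans (mul_le_mul_of_nonneg_left hMj (by positivity))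
        _ = _ := by
          rw [prod_range_succ, show 1 - θ ^ (j + 1) = (1 - θ ^ j) + (1 - θ) * θ ^ j by ring,
            Real.rpow_add_of_nonneg hN (by linarith) (by positivity)]
          ring
  have := hM J
  exact (hiter J le_rfl).trans (by gcongr; exact prod_mul_pow_rpow_pow_le hA hB hθ hθ1 J)

theorem boxSup_dyadic_le {A b N : ℝ} {j : ℕ} (hA : 0 ≤ A) (hb : 0 ≤ b) (hN : 0 ≤ N)
    (hv0 : ∀ x, 0 ≤ v x) (hj : 2 ^ j ≤ n)
    (hstep : ∀ {σ ρ : ℕ}, n ≤ σ → σ < ρ → ρ ≤ 2 * n →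
      boxSup σ v ≤ A * (n / (ρ - σ : ℕ)) ^ b * N * boxSup ρ v ^ (1 - γ)) :
    boxSup (2 * n - n / 2 ^ j) v ≤
      A * 4 ^ b * (2 ^ b) ^ j * N * boxSup (2 * n - n / 2 ^ (j + 1)) v ^ (1 - γ) := by
  have hn : 0 < n := (by positivity : 0 < 2 ^ j).trans_le hj
  have hgap : 0 < n / 2 ^ j - n / 2 ^ (j + 1) :=
    pos_of_mul_pos_right (hn.trans_le (le_two_pow_mul_div_sub_div hj)) (by positivity)
  have hdiv : n / 2 ^ j ≤ n := Nat.div_le_self n _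
  have hratio := div_div_sub_div_le n hn hj
  rw [div_self (by positivity), mul_one] at hratio
  have hle := hstep (σ := 2 * n - n / 2 ^ j) (ρ := 2 * n - n / 2 ^ (j + 1)) (by lia) (by lia)
    (Nat.sub_le _ _)
  rw [show 2 * n - n / 2 ^ (j + 1) - (2 * n - n / 2 ^ j) = n / 2 ^ j - n / 2 ^ (j + 1) by lia]
    at hle
  have := boxSup_nonneg (m := 2 * n - n / 2 ^ (j + 1)) hv0
  calc boxSup (2 * n - n / 2 ^ j) v
      ≤ A * (4 * 2 ^ j) ^ b * N * boxSup (2 * n - n / 2 ^ (j + 1)) v ^ (1 - γ) :=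
        hle.trans (by gcongr)
    _ = _ := by
        rw [Real.mul_rpow (by norm_num) (by positivity), Real.rpow_pow_comm (by norm_num)]
        ring

theorem boxSup_le_of_le_mul_rpow_one_sub {A b : ℝ} (hn : 1 ≤ n) (hA : 1 ≤ A) (hb : 0 ≤ b)
    (hv0 : ∀ x, 0 ≤ v x) (hr : 0 < r) (hγ : 0 < γ) (hγ1 : γ ≤ 1)
    (hstep : ∀ {σ ρ : ℕ}, n ≤ σ → σ < ρ → ρ ≤ 2 * n → boxSup σ v ≤
      A * (n / (ρ - σ : ℕ)) ^ b * boxNorm n r (2 * n) v ^ γ * boxSup ρ v ^ (1 - γ)) :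
    boxSup n v ≤ (A * 4 ^ b) ^ (1 / γ) * (2 ^ b) ^ ((1 - γ) / γ ^ 2) *
      (2 ^ d * ((2 : ℝ) ^ d) ^ ((1 - γ) / γ ^ 2)) ^ (1 / r) * boxNorm n r (2 * n) v := by
  have h1γ : 0 ≤ 1 - γ := by linarith
  set N := boxNorm n r (2 * n) v
  have hN : 0 ≤ N := boxNorm_nonneg hv0
  set c : ℝ := 2 ^ d * ((2 : ℝ) ^ d) ^ ((1 - γ) / γ ^ 2)
  set J := Nat.log 2 n
  set M : ℕ → ℝ := fun j => boxSup (2 * n - n / 2 ^ j) v with hMdef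
  have hM (j : ℕ) : 0 ≤ M j := boxSup_nonneg hv0
  have hMstep (j : ℕ) (hj : j < J) :
      M j ≤ A * 4 ^ b * (2 ^ b) ^ j * N ^ γ * M (j + 1) ^ (1 - γ) :=
    boxSup_dyadic_le (by linarith) hb (by positivity) hv0 (Nat.pow_le_of_le_log (by lia) hj.le)
      hstep
  have hn_le : (n : ℝ) ≤ 2 * 2 ^ J := by
    rw [← pow_succ']
    exact_mod_cast (Nat.lt_pow_succ_log_self one_lt_two n).le
  have hM_zero : M 0 = boxSup n v := by
    simp only [hMdef, pow_zero, Nat.div_one, two_mul, Nat.add_sub_cancel]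
  calc boxSup n v ≤ (A * 4 ^ b) ^ (1 / γ) * (2 ^ b) ^ ((1 - γ) / γ ^ 2) *
          N ^ (1 - (1 - γ) ^ J) * M J ^ ((1 - γ) ^ J) :=
        hM_zero ▸ le_of_le_mul_rpow_one_sub (one_le_mul_of_one_le_of_one_le hA
          (Real.one_le_rpow (by norm_num) hb)) (Real.one_le_rpow one_le_two hb) hN hγ hγ1 hM hMstep
    _ ≤ (A * 4 ^ b) ^ (1 / γ) * (2 ^ b) ^ ((1 - γ) / γ ^ 2) *
          N ^ (1 - (1 - γ) ^ J) * (c ^ (1 / r) * N ^ ((1 - γ) ^ J)) := by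
        gcongr
        exact boxSup_rpow_pow_le hn (Nat.sub_le _ _) hn_le hv0 hr hγ hγ1
    _ = (A * 4 ^ b) ^ (1 / γ) * (2 ^ b) ^ ((1 - γ) / γ ^ 2) * c ^ (1 / r) *
          (N ^ (1 - (1 - γ) ^ J) * N ^ ((1 - γ) ^ J)) := by ring
    _ = _ := by
        have hθJ : (1 - γ) ^ J ≤ 1 := pow_le_one₀ h1γ (by linarith)
        rw [← Real.rpow_add_of_nonneg hN (by linarith) (by positivity), sub_add_cancel,
          Real.rpow_one]

end Interpolation

section LocalBoundedness

variable {D : ℕ} {P Q s δ γ : ℝ}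

theorem MoserExponents.exists_boxSup_le (h : MoserExponents D P Q s δ) (hγ : 0 < γ)
    (hγ1 : γ ≤ 1) : ∃ K b : ℝ, 1 ≤ K ∧ 0 ≤ b ∧
    ∀ {n σ ρ : ℕ}, 1 ≤ n → n ≤ σ → σ < ρ → ρ ≤ 2 * n →
    ∀ {Wp Wq : ℝ} {ω : Bond (D + 1) → ℝ} {v : Vertex (D + 1) → ℝ}, (∀ e, 0 < ω e) →
    AvgBounded (bondsIn (box (D + 1) (2 * n))) P Wp ω →
    AvgBounded (bondsIn (box (D + 1) (2 * n))) Q Wq (fun e => (ω e)⁻¹) → 1 ≤ Wp * Wq →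
    IsSubsolution ω v → (∀ x, 0 ≤ v x) →
    boxSup σ v ≤ K * (Wp * Wq) ^ ((δ + 1) / (2 * δ)) * (n / (ρ - σ : ℕ)) ^ b *
      boxNorm n (2 / (1 - P) * γ) (2 * n) v ^ γ * boxSup ρ v ^ (1 - γ) := by
  have hr : 0 < 2 / (1 - P) := div_pos two_pos (by linarith [h.P_lt_one])
  obtain ⟨K, b, hK, hb, hsup⟩ := h.exists_sup_le
  refine ⟨K, b, hK, hb, ?_⟩
  intro n σ ρ hn hnσ hσρ hρ Wp Wq ω v hω hωp hωq hW hsub hv0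
  refine sup'_le _ _ fun x hx => (hsup hn hnσ hσρ hρ hω hωp hωq hW hsub hv0 x hx).trans ?_
  rw [mul_assoc _ (_ ^ γ)]
  gcongr
  exact boxNorm_le_mul_boxSup_rpow hρ hv0 hr hγ hγ1

theorem MoserExponents.exists_le_mul_boxNorm (h : MoserExponents D P Q s δ) (hγ : 0 < γ)
    (hγ1 : γ ≤ 1) : ∃ K : ℝ, 1 ≤ K ∧ ∀ {n : ℕ}, 1 ≤ n →
    ∀ {Wp Wq : ℝ} {ω : Bond (D + 1) → ℝ} {v : Vertex (D + 1) → ℝ}, (∀ e, 0 < ω e) →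
    AvgBounded (bondsIn (box (D + 1) (2 * n))) P Wp ω →
    AvgBounded (bondsIn (box (D + 1) (2 * n))) Q Wq (fun e => (ω e)⁻¹) → 1 ≤ Wp * Wq →
    IsSubsolution ω v → (∀ x, 0 ≤ v x) → ∀ x ∈ box (D + 1) n,
    v x ≤ K * (Wp * Wq) ^ ((δ + 1) / (2 * δ * γ)) *
      boxNorm n (2 / (1 - P) * γ) (2 * n) v := by
  have hδ := h.δ_pos
  have h1γ : 0 ≤ 1 - γ := by linarith
  obtain ⟨K, b, hK, hb, hsup⟩ := h.exists_boxSup_le hγ hγ1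
  set r := 2 / (1 - P) * γ
  have hr : 0 < r := mul_pos (div_pos two_pos (by linarith [h.P_lt_one])) hγ
  set c : ℝ := 2 ^ (D + 1) * ((2 : ℝ) ^ (D + 1)) ^ ((1 - γ) / γ ^ 2)
  have hc : 1 ≤ c := one_le_mul_of_one_le_of_one_le (one_le_pow₀ one_le_two)
    (Real.one_le_rpow (one_le_pow₀ one_le_two) (by positivity))
  have hB : (1 : ℝ) ≤ 2 ^ b := Real.one_le_rpow one_le_two hb
  have hKb : 1 ≤ K * 4 ^ b :=
    one_le_mul_of_one_le_of_one_le hK (Real.one_le_rpow (by norm_num) hb)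
  refine ⟨(K * 4 ^ b) ^ (1 / γ) * (2 ^ b) ^ ((1 - γ) / γ ^ 2) * c ^ (1 / r),
    one_le_mul_of_one_le_of_one_le (one_le_mul_of_one_le_of_one_le
      (Real.one_le_rpow hKb (by positivity)) (Real.one_le_rpow hB (by positivity)))
      (Real.one_le_rpow hc (by positivity)), ?_⟩
  intro n hn Wp Wq ω v hω hωp hωq hW hsub hv0 x hx
  set W := (Wp * Wq) ^ ((δ + 1) / (2 * δ)) with hWdef
  have hW1 : 1 ≤ W := Real.one_le_rpow hW (by positivity)
  have hWγ : W ^ (1 / γ) = (Wp * Wq) ^ ((δ + 1) / (2 * δ * γ)) := by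
    rw [hWdef, ← Real.rpow_mul (by linarith), div_mul_div_comm, mul_one]
  calc v x ≤ (K * W * 4 ^ b) ^ (1 / γ) * (2 ^ b) ^ ((1 - γ) / γ ^ 2) * c ^ (1 / r) *
          boxNorm n r (2 * n) v :=
        (le_boxSup hx).trans (boxSup_le_of_le_mul_rpow_one_sub hn
          (one_le_mul_of_one_le_of_one_le hK hW1) hb hv0 hr hγ hγ1 fun hnσ hσρ hρ =>
            hsup hn hnσ hσρ hρ hω hωp hωq hW hsub hv0)
    _ = _ := by
        rw [mul_right_comm K, Real.mul_rpow (by positivity) (by positivity), hWγ]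
        ring

end LocalBoundedness

section AveragedNorm

variable {α : Type*} {S : Finset α} {f : α → ℝ} {P Q Wp Wq : ℝ}

theorem avgBounded_avgNorm {p : ℝ≥0∞} (hp : p ≠ 0) (hS : S.Nonempty) (hf : ∀ x, 0 < f x) :
    AvgBounded S p⁻¹.toReal (avgNorm p S f) f := by
  by_cases htop : p = ∞
  · have hle (x) (hx : x ∈ S) : f x ≤ avgNorm p S f := by
      rw [avgNorm, if_pos htop]
      exact (le_abs_self _).trans (le_csSup (S.finite_toSet.image _).bddAbove ⟨x, hx, rfl⟩)
    obtain ⟨x₀, hx₀⟩ := hS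
    exact ⟨(hf x₀).le.trans (hle x₀ hx₀), fun _ => 1, fun _ => zero_le_one,
      fun x hx => by simpa using hle x hx, by simp⟩
  · have hr : 0 < p.toReal := ENNReal.toReal_pos hp htop
    have hcard : (0 : ℝ) < #S := by exact_mod_cast hS.card_pos
    have hsum : 0 < ∑ x ∈ S, |f x| ^ p.toReal :=
      sum_pos (fun x _ => Real.rpow_pos_of_pos (abs_pos.2 (hf x).ne') _) hS
    have hmean : 0 < 1 / (#S : ℝ) * ∑ x ∈ S, |f x| ^ p.toReal := by positivity
    have hA : avgNorm p S f = (1 / (#S : ℝ) * ∑ x ∈ S, |f x| ^ p.toReal) ^ (1 / p.toReal) :=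
      if_neg htop
    have hApos : 0 < avgNorm p S f := hA ▸ Real.rpow_pos_of_pos hmean _
    have hApow : avgNorm p S f ^ p.toReal = 1 / (#S : ℝ) * ∑ x ∈ S, |f x| ^ p.toReal := by
      rw [hA, ← Real.rpow_mul hmean.le, one_div_mul_cancel hr.ne', Real.rpow_one]
    have hdiv (x) : 0 ≤ f x / avgNorm p S f := div_nonneg (hf x).le hApos.le
    refine ⟨hApos.le, fun x => (f x / avgNorm p S f) ^ p.toReal,
      fun x => Real.rpow_nonneg (hdiv x) _, fun x _ => ?_, le_of_eq ?_⟩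
    · rw [ENNReal.toReal_inv, Real.rpow_rpow_inv (hdiv x) hr.ne', mul_div_cancel₀ _ hApos.ne']
    · calc ∑ x ∈ S, (f x / avgNorm p S f) ^ p.toReal
          = (∑ x ∈ S, |f x| ^ p.toReal) / avgNorm p S f ^ p.toReal := by
            rw [sum_div]
            exact sum_congr rfl fun x _ => by
              rw [Real.div_rpow (hf x).le hApos.le, abs_of_pos (hf x)]
        _ = #S := by
            rw [hApow]
            field_simp

theorem AvgBounded.one_le_mul (hfP : AvgBounded S P Wp f) (hfQ : AvgBounded S Q Wq fun x => (f x)⁻¹)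
    (hS : S.Nonempty) (hf : ∀ x, 0 < f x) (hP : 0 ≤ P) (hQ : 0 ≤ Q) (hPQ : P + Q ≤ 1) :
    1 ≤ Wp * Wq := by
  obtain ⟨hWp, g, hg0, hg, hgS⟩ := hfP
  obtain ⟨hWq, h, hh0, hh, hhS⟩ := hfQ
  have hcard : (0 : ℝ) < #S := by exact_mod_cast hS.card_pos
  have hpointwise (x) (hx : x ∈ S) : 1 ≤ Wp * Wq * (g x ^ P * h x ^ Q) :=
    calc 1 = f x * (f x)⁻¹ := (mul_inv_cancel₀ (hf x).ne').symm
      _ ≤ (Wp * g x ^ P) * (Wq * h x ^ Q) :=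
          mul_le_mul (hg x hx) (hh x hx) (inv_pos.2 (hf x)).le ((hf x).le.trans (hg x hx))
      _ = _ := by ring
  calc 1 ≤ (∑ x ∈ S, Wp * Wq * (g x ^ P * h x ^ Q)) / #S := by
        rw [le_div_iff₀ hcard, one_mul]
        simpa using card_nsmul_le_sum S _ 1 hpointwise
    _ = Wp * Wq * ((∑ x ∈ S, g x ^ P * h x ^ Q) / #S) := by rw [← mul_sum, mul_div_assoc]
    _ ≤ Wp * Wq * (((∑ x ∈ S, g x) / #S) ^ P * ((∑ x ∈ S, h x) / #S) ^ Q *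
          (#S / #S) ^ (1 - (P + Q))) := by
        gcongr
        exact sum_rpow_mul_rpow_div_le_of_add_le_one (fun x _ => hg0 x) (fun x _ => hh0 x) hP hQ
          hPQ hcard.le
    _ ≤ Wp * Wq * (1 ^ P * 1 ^ Q * 1 ^ (1 - (P + Q))) := by
        have hG : 0 ≤ ∑ x ∈ S, g x := sum_nonneg fun x _ => hg0 x
        have hH : 0 ≤ ∑ x ∈ S, h x := sum_nonneg fun x _ => hh0 x
        have h1 : 0 ≤ 1 - (P + Q) := by linarith
        gcongr
        · exact (div_le_one hcard).2 hgS
        · exact (div_le_one hcard).2 hhS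
        · exact (div_self hcard.ne').le
    _ = Wp * Wq := by simp only [Real.one_rpow, mul_one]

theorem bondsIn_box_nonempty {d m : ℕ} (hd : 1 ≤ d) (hm : 1 ≤ m) :
    (bondsIn (box d m)).Nonempty := by
  refine ⟨(0, ⟨0, hd⟩), mem_bondsIn.2 ⟨zero_mem_box d m, mem_box.2 fun i => ?_⟩⟩
  by_cases hi : i = ⟨0, hd⟩
  · subst hi
    simpa [Bond.upper] using hm
  · simp [Bond.upper, Pi.single_eq_of_ne hi]

theorem boxNorm_le_mul_avgNorm {d n : ℕ} {r : ℝ} {v : Vertex d → ℝ} (hn : 1 ≤ n) (hr : 0 < r)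
    (hv0 : ∀ x, 0 ≤ v x) :
    boxNorm n r (2 * n) v ≤
      (5 ^ d) ^ (1 / r) * avgNorm (ENNReal.ofReal r) (box d (2 * n)) v := by
  have hcard : (0 : ℝ) < #(box d (2 * n)) := by
    rw [card_box]
    positivity
  have hsum : 0 ≤ ∑ x ∈ box d (2 * n), v x ^ r :=
    sum_nonneg fun x _ => Real.rpow_nonneg (hv0 x) _
  rw [boxNorm, avgNorm, if_neg ENNReal.ofReal_ne_top, ENNReal.toReal_ofReal hr.le,
    ← Real.mul_rpow (by positivity) (by positivity)]
  simp only [abs_of_nonneg (hv0 _)]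
  refine Real.rpow_le_rpow (by positivity) ?_ (by positivity)
  calc (∑ x ∈ box d (2 * n), v x ^ r) / (n : ℝ) ^ d
      = #(box d (2 * n)) / (n : ℝ) ^ d *
          (1 / #(box d (2 * n)) * ∑ x ∈ box d (2 * n), v x ^ r) := by
        field_simp
    _ ≤ _ := by
        gcongr
        exact card_box_div_le hn le_rfl

end AveragedNorm

theorem moserExponents_delta {D : ℕ} {p q : ℝ≥0∞} (hD : 2 ≤ D)
    (hpq : p⁻¹.toReal + q⁻¹.toReal < 2 / D) :
    MoserExponents D p⁻¹.toReal q⁻¹.toReal (2 / (1 + q⁻¹.toReal)) (delta (D + 1) p q) := by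
  have hQ : 0 ≤ q⁻¹.toReal := ENNReal.toReal_nonneg
  have hdelta : delta (D + 1) p q = 1 / D - (p⁻¹.toReal + q⁻¹.toReal) / 2 := by
    rw [delta]
    push_cast
    ring
  refine ⟨hD, ENNReal.toReal_nonneg, hQ, div_mul_cancel₀ _ (by positivity), ?_, hdelta⟩
  linarith [(by ring : 2 / (D : ℝ) = 2 * (1 / D))]

end RandomConductance

end

open RandomConductance in
theorem corollary3p4_general (d : ℕ) (hd : 3 ≤ d) (p q : ℝ≥0∞) (hp : p ≠ 0) (hq : q ≠ 0)
    (hpq : p⁻¹.toReal + q⁻¹.toReal < 2 / ((d : ℝ) - 1)) :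
    0 < delta d p q ∧
    ∀ γ : ℝ, 0 < γ → γ ≤ 1 →
      ∃ c : ℝ, 1 ≤ c ∧
        ∀ ω : Bond d → ℝ, (∀ e, 0 < ω e) →
        ∀ v : Vertex d → ℝ, IsSubsolution ω v → (∀ x, 0 ≤ v x) →
        ∀ n : ℕ, 1 ≤ n →
        ∀ x ∈ box d n,
          v x ≤ c * Lam p q ω (box d (2 * n)) ^ ((delta d p q + 1) / (2 * delta d p q * γ)) *
            avgNorm (ENNReal.ofReal (2 * conj p * γ)) (box d (2 * n)) v := by
  obtain ⟨D, rfl⟩ : ∃ D, d = D + 1 := ⟨d - 1, by lia⟩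
  have h := moserExponents_delta (D := D) (p := p) (q := q) (by lia) (by simpa using hpq)
  refine ⟨h.δ_pos, fun γ hγ hγ1 => ?_⟩
  have hr : 0 < 2 * conj p * γ :=
    mul_pos (mul_pos two_pos (inv_pos.2 (by linarith [h.P_lt_one]))) hγ
  obtain ⟨K, hK, hsup⟩ := h.exists_le_mul_boxNorm hγ hγ1
  refine ⟨K * (5 ^ (D + 1)) ^ (1 / (2 * conj p * γ)), one_le_mul_of_one_le_of_one_le hK
    (Real.one_le_rpow (one_le_pow₀ (by norm_num)) (by positivity)), ?_⟩
  intro ω hω v hv hv0 n hn x hx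
  have hbonds := bondsIn_box_nonempty (d := D + 1) (m := 2 * n) (by lia) (by lia)
  have hωp := avgBounded_avgNorm hp hbonds hω
  have hωq := avgBounded_avgNorm hq hbonds fun e => inv_pos.2 (hω e)
  have hLam : 1 ≤ Lam p q ω (box (D + 1) (2 * n)) :=
    hωp.one_le_mul hωq hbonds hω h.P_nonneg h.Q_nonneg h.add_lt_one.le
  calc v x ≤ K * Lam p q ω (box (D + 1) (2 * n)) ^ _ * boxNorm n (2 * conj p * γ) (2 * n) v :=
        hsup hn hω hωp hωq hLam hv hv0 x hx
    _ ≤ _ := by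
        grw [boxNorm_le_mul_avgNorm hn hr hv0]
        exact le_of_eq (by ring)

theorem corollary3p4 (d : ℕ) (hd : 3 ≤ d) (p q : ℝ≥0∞) (hp : 1 < p) (hq : 1 < q)
    (hpq : p⁻¹.toReal + q⁻¹.toReal < 2 / ((d : ℝ) - 1)) :
    0 < RandomConductance.delta d p q ∧
    ∀ γ : ℝ, 0 < γ → γ ≤ 1 →
      ∃ c : ℝ, 1 ≤ c ∧
        ∀ ω : RandomConductance.Bond d → ℝ, (∀ e, 0 < ω e) →
        ∀ u : RandomConductance.Vertex d → ℝ, RandomConductance.IsSolution ω u →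
        ∀ n : ℕ, 1 ≤ n →
        ∀ x ∈ RandomConductance.box d n,
          |u x| ≤
            c * RandomConductance.Lam p q ω (RandomConductance.box d (2 * n)) ^
                  ((RandomConductance.delta d p q + 1) / (2 * RandomConductance.delta d p q * γ)) *
              RandomConductance.avgNorm (ENNReal.ofReal (2 * RandomConductance.conj p * γ))
                (RandomConductance.box d (2 * n)) u := by
  refine (corollary3p4_general d hd p q (zero_lt_one.trans hp).ne' (zero_lt_one.trans hq).ne'
    hpq).imp_right fun hsup γ hγ hγ1 => (hsup γ hγ hγ1).imp fun c hc => hc.imp_right ?_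
  intro h ω hω u hu n hn x hx
  simpa only [RandomConductance.avgNorm, abs_abs] using
    h ω hω _ (hu.isSubsolution_abs fun e => (hω e).le) (fun _ => abs_nonneg _) n hn x hx
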